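/- Let $\mathbb{H}^3=\{(x,y,t): t>0\}$ be the upper half-space with the hyperbolic metric $(dx^2+dy^2+dt^2)/t^2$, and let $\Gamma\subset \mathrm{PSL}(2,\mathbb{C})$ be a group acting freely and properly discontinuously on $\mathbb{H}^3$ such that $M=\mathbb{H}^3/\Gamma$ is non-compact and of finite volume. Setup. Then $M$ has finitely many cusps, i.e. there are finitely many $\Gamma$-orbits of parabolic fixed points. For the $i$-th cusp ($1\le i\le k$) there is $g_i\in\mathrm{PSL}(2,\mathbb{C})$ moving a representative fixed point to $\infty$ such that the stabilizer of $\infty$ in $g_i\Gamma g_i^{-1}$ is generated by $z\mapsto z+\mu_i$ and $z\mapsto z+\nu_i$ with $\mu_i,\nu_i\in\mathbb{C}$ linearly independent over $\mathbb{R}$, and such that $\{t\ge 1\}$ is the maximal horoball: the distinct translates of $\{t>1\}$ under $g_i\Gamma g_i^{-1}$ are disjoint, and two distinct translates of $\{t\ge1\}$ touch. Fix any such choices. For $\tau\in\mathbb{R}$ let $T_i\times(\tau,\infty)\subset M$ denote the image of $g_i^{-1}\{t>e^\tau\}$, and put $$\Omega(\tau)=\mathbb{H}^3\setminus\bigcup_{i}\bigcup_{\gamma\in\Gamma}\gamma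 g_i^{-1}\{t>e^{\tau}\},\qquad M(\tau)=M\setminus\bigcup_i T_i\times(\tau,\infty)=\Omega(\tau)/\Gamma .$$ There is a smallest $\tau_0\ge 0$ for which the regions $T_i\times(\tau_0,\infty)$ are pairwise disjoint. Let $\tau_0$ be this number, or any larger one, and put $$L_0=\max\{e^{\tau_0},|\mu_1|+|\nu_1|,\dots,|\mu_k|+|\nu_k|\},\qquad \tau_j=\log(jL_0).$$ There are smooth functions $\varphi:(0,\infty)\to[0,\infty)$ and $f:(0,\infty)\to(0,\infty)$ such that $\varphi(t)=1/t$ for $t\le 3L_0$, $\varphi'(t)<0$ for $3L_0<t<4L_0$, $\varphi(t)=0$ for $t\ge 4L_0$, $0\le\varphi(t)\le1/t$ for all $t$, $f'/f=\varphi$, and $f(t)=t$ for $t\le 3L_0$. Fix any such $\varphi,f$. Let $\bar g$ be the metric on $\Omega(\tau_4)$ that is hyperbolic on $\Omega(\tau_3)$ and that, on each region $U=\gamma g_i^{-1}\{3L_0\le t\le 4L_0\}$ ($\gamma\in\Gamma$), is the pull-back of $(dx^2+dy^2+dt^2)/f(t)^2$ under some $h\in\mathrm{PSL}(2,\mathbb{C})$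 with $h(U)=\{3L_0\le t\le4L_0\}$; such a metric exists, whatever the choice of $\varphi,f$. Theorem. (a) $\Gamma$ is a subgroup of the isometry group of $(\Omega(\tau_4),\bar g)$: every $\gamma\in\Gamma$ maps $\Omega(\tau_4)$ onto itself, preserves the tensor $\bar g$ and preserves the distance on $\Omega(\tau_4)$ given by the infimum of $\bar g$-lengths of $C^1$ curves in $\Omega(\tau_4)$; and the resulting homomorphism from $\Gamma$ to the isometry group is injective. (b) $\Omega(\tau_4)$ is a smooth submanifold of $\mathbb{H}^3$ with boundary, and $M(\tau_4)=\Omega(\tau_4)/\Gamma$ is a compact Hausdorff smooth $3$-manifold with boundary $\bigcup_i T_i\times\{\tau_4\}$ (the image of $\bigcup_i g_i^{-1}\{t=4L_0\}$) such that the projection $\Omega(\tau_4)\to M(\tau_4)$ is a surjective local diffeomorphism. The metric $\bar g$ is induced by a smooth Riemannian metric on $M(\tau_4)$, also denoted by $\bar g$, all of whose sectional curvatures at the interior points of $M(\tau_4)$ are negative and for which the boundary of $M(\tau_4)$ is totally geodesic. On $M(\tau_3)$ the metric $\bar g$ is the hyperbolic metric, of constant curvature $-1$. -/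

import Mathlib

open Set MeasureTheory
open scoped Manifold ContDiff MatrixGroups

noncomputable section

namespace CuspedHyperbolic

/-! ### Upper half-space and the action of `PSL(2, ℂ)` -/

/-- Euclidean three-space, with coordinates `(x, y, t)`. -/
abbrev E3 : Type := EuclideanSpace ℝ (Fin 3)

/-- The open upper half-space `t > 0`. -/
def upperHalfSpace : TopologicalSpace.Opens E3 :=
  ⟨{p | 0 < p 2}, isOpen_lt continuous_const (by fun_prop)⟩

/-- Hyperbolic three-space in the upper half-space model. -/
abbrev H3 : Type := ↥upperHalfSpace

/-- The Euclidean height `t` of a point `(x, y, t)`. -/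
def height (p : H3) : ℝ := (p : E3) 2

theorem height_pos (p : H3) : 0 < height p := p.2

/-- The horizontal coordinate `z = x + i y` of a point `(x, y, t)`. -/
def horiz (p : H3) : ℂ := ⟨(p : E3) 0, (p : E3) 1⟩

/-- The point with horizontal coordinate `z` and height `t`. -/
def ofCoords (z : ℂ) (t : ℝ) (ht : 0 < t) : H3 :=
  ⟨!₂[z.re, z.im, t], by simpa [upperHalfSpace] using ht⟩

@[simp] theorem height_ofCoords (z : ℂ) (t : ℝ) (ht : 0 < t) :
    height (ofCoords z t ht) = t := by
  simp [height, ofCoords]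

@[simp] theorem horiz_ofCoords (z : ℂ) (t : ℝ) (ht : 0 < t) :
    horiz (ofCoords z t ht) = z := by
  simp [horiz, ofCoords]

theorem H3.ext_coords {p q : H3} (hz : horiz p = horiz q) (ht : height p = height q) :
    p = q := by
  have h0 := congrArg Complex.re hz
  have h1 := congrArg Complex.im hz
  apply Subtype.ext
  ext i
  fin_cases i
  · exact h0
  · exact h1
  · exact ht

/-- `|c z + d|² + |c|² t²`. -/
def mobDenom (A : SL(2, ℂ)) (p : H3) : ℝ :=
  Complex.normSq (A 1 0 * horiz p + A 1 1) + Complex.normSq (A 1 0) * height p ^ 2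

/-- `(a z + b) conj (c z + d) + a conj c t²`. -/
def mobNum (A : SL(2, ℂ)) (p : H3) : ℂ :=
  (A 0 0 * horiz p + A 0 1) * (starRingEnd ℂ) (A 1 0 * horiz p + A 1 1)
    + A 0 0 * (starRingEnd ℂ) (A 1 0) * (height p : ℂ) ^ 2

theorem det_eq (A : SL(2, ℂ)) : A 0 0 * A 1 1 - A 0 1 * A 1 0 = 1 := by
  have h := A.det_coe
  rwa [Matrix.det_fin_two] at h

theorem mobDenom_pos (A : SL(2, ℂ)) (p : H3) : 0 < mobDenom A p := by
  have ht := height_pos p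
  by_cases hc : A 1 0 = 0
  · have hd : A 1 1 ≠ 0 := by
      intro h
      have := det_eq A
      simp [hc, h] at this
    have := Complex.normSq_pos.2 hd
    simpa [mobDenom, hc] using this
  · have := Complex.normSq_pos.2 hc
    have := Complex.normSq_nonneg (A 1 0 * horiz p + A 1 1)
    unfold mobDenom
    positivity

/-- The Poincaré extension of the Möbius transformation of `A` to upper half-space. -/
def mob (A : SL(2, ℂ)) (p : H3) : H3 :=
  ofCoords (mobNum A p / (mobDenom A p : ℂ)) (height p / mobDenom A p)
    (div_pos (height_pos p) (mobDenom_pos A p))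

theorem mobDenom_cast (A : SL(2, ℂ)) (p : H3) :
    (mobDenom A p : ℂ) =
      (A 1 0 * horiz p + A 1 1) * (starRingEnd ℂ) (A 1 0 * horiz p + A 1 1)
        + A 1 0 * (starRingEnd ℂ) (A 1 0) * (height p : ℂ) ^ 2 := by
  simp only [mobDenom, Complex.ofReal_add, Complex.ofReal_mul, Complex.ofReal_pow,
    ← Complex.mul_conj]

theorem mob_one (p : H3) : mob 1 p = p := by
  apply H3.ext_coords <;> simp [mob, mobNum, mobDenom]

theorem mobNum_normSq (A : SL(2, ℂ)) (p : H3) :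
    mobNum A p * (starRingEnd ℂ) (mobNum A p) + (height p : ℂ) ^ 2 =
      (mobDenom A p : ℂ) *
        ((A 0 0 * horiz p + A 0 1) * (starRingEnd ℂ) (A 0 0 * horiz p + A 0 1)
        + A 0 0 * (starRingEnd ℂ) (A 0 0) * (height p : ℂ) ^ 2) := by
  have h := det_eq A
  have h' := congrArg (starRingEnd ℂ) h
  simp only [map_sub, map_mul, map_one] at h'
  rw [mobDenom_cast]
  simp only [mobNum, map_add, map_mul, map_pow, Complex.conj_conj, Complex.conj_ofReal]
  generalize (starRingEnd ℂ) (A 0 0) = a' at *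
  generalize (starRingEnd ℂ) (A 0 1) = b' at *
  generalize (starRingEnd ℂ) (A 1 0) = c' at *
  generalize (starRingEnd ℂ) (A 1 1) = d' at *
  generalize (starRingEnd ℂ) (horiz p) = z' at *
  generalize A 0 0 = a at *
  generalize A 0 1 = b at *
  generalize A 1 0 = c at *
  generalize A 1 1 = d at *
  generalize horiz p = z at *
  generalize (height p : ℂ) = t at *
  linear_combination (-t ^ 2 * (a' * d' - b' * c')) * h - t ^ 2 * h'

theorem mobDenom_mul (A B : SL(2, ℂ)) (p : H3) :
    mobDenom (A * B) p = mobDenom A (mob B p) * mobDenom B p := by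
  have hD : (mobDenom B p : ℂ) ≠ 0 := by exact_mod_cast (mobDenom_pos B p).ne'
  have hN := mobNum_normSq B p
  have hc := mobDenom_cast B p
  apply Complex.ofReal_injective
  rw [Complex.ofReal_mul, mobDenom_cast A, mobDenom_cast (A * B)]
  simp only [mob, horiz_ofCoords, height_ofCoords, Complex.ofReal_div, map_add, map_mul,
    map_div₀, Complex.conj_ofReal]
  have e10 : (A * B) 1 0 = A 1 0 * B 0 0 + A 1 1 * B 1 0 := by
    simp [Matrix.SpecialLinearGroup.coe_mul, Matrix.mul_apply, Fin.sum_univ_two]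
  have e11 : (A * B) 1 1 = A 1 0 * B 0 1 + A 1 1 * B 1 1 := by
    simp [Matrix.SpecialLinearGroup.coe_mul, Matrix.mul_apply, Fin.sum_univ_two]
  rw [e10, e11]
  simp only [map_add, map_mul] at hN hc ⊢
  have key : ∀ X Y X' Y' n n' D t : ℂ, D ≠ 0 →
      ((X * (n / D) + Y) * (X' * (n' / D) + Y') + X * X' * (t / D) ^ 2) * D =
        X * X' * ((n * n' + t ^ 2) / D) + X * Y' * n + X' * Y * n' + Y * Y' * D := by
    intro X Y X' Y' n n' D t h
    field_simp
    ring
  rw [key _ _ _ _ _ _ _ _ hD, hN, mul_div_cancel_left₀ _ hD, hc]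
  simp only [mobNum, map_add, map_mul, map_pow, Complex.conj_conj, Complex.conj_ofReal]
  ring

theorem mobNum_mul (A B : SL(2, ℂ)) (p : H3) :
    mobNum (A * B) p = mobNum A (mob B p) * (mobDenom B p : ℂ) := by
  have hD : (mobDenom B p : ℂ) ≠ 0 := by exact_mod_cast (mobDenom_pos B p).ne'
  have hN := mobNum_normSq B p
  have hc := mobDenom_cast B p
  rw [mobNum, mobNum]
  have e00 : (A * B) 0 0 = A 0 0 * B 0 0 + A 0 1 * B 1 0 := by
    simp [Matrix.SpecialLinearGroup.coe_mul, Matrix.mul_apply, Fin.sum_univ_two]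
  have e01 : (A * B) 0 1 = A 0 0 * B 0 1 + A 0 1 * B 1 1 := by
    simp [Matrix.SpecialLinearGroup.coe_mul, Matrix.mul_apply, Fin.sum_univ_two]
  have e10 : (A * B) 1 0 = A 1 0 * B 0 0 + A 1 1 * B 1 0 := by
    simp [Matrix.SpecialLinearGroup.coe_mul, Matrix.mul_apply, Fin.sum_univ_two]
  have e11 : (A * B) 1 1 = A 1 0 * B 0 1 + A 1 1 * B 1 1 := by
    simp [Matrix.SpecialLinearGroup.coe_mul, Matrix.mul_apply, Fin.sum_univ_two]
  rw [e00, e01, e10, e11]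
  simp only [mob, horiz_ofCoords, height_ofCoords, Complex.ofReal_div, map_add, map_mul,
    map_div₀, Complex.conj_ofReal] at hN hc ⊢
  have key : ∀ X Y X' Y' n n' D t : ℂ, D ≠ 0 →
      ((X * (n / D) + Y) * (X' * (n' / D) + Y') + X * X' * (t / D) ^ 2) * D =
        X * X' * ((n * n' + t ^ 2) / D) + X * Y' * n + X' * Y * n' + Y * Y' * D := by
    intro X Y X' Y' n n' D t h
    field_simp
    ring
  rw [key _ _ _ _ _ _ _ _ hD, hN, mul_div_cancel_left₀ _ hD, hc]
  simp only [mobNum, map_add, map_mul, map_pow, Complex.conj_conj, Complex.conj_ofReal]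
  ring

theorem mob_mul (A B : SL(2, ℂ)) (p : H3) : mob (A * B) p = mob A (mob B p) := by
  have hD := (mobDenom_pos B p).ne'
  have hA := (mobDenom_pos A (mob B p)).ne'
  have hDc : (mobDenom B p : ℂ) ≠ 0 := by exact_mod_cast hD
  have hAc : (mobDenom A (mob B p) : ℂ) ≠ 0 := by exact_mod_cast hA
  apply H3.ext_coords
  · have h1 : horiz (mob (A * B) p) = mobNum (A * B) p / (mobDenom (A * B) p : ℂ) := by
      simp [mob]
    have h2 : horiz (mob A (mob B p)) =
        mobNum A (mob B p) / (mobDenom A (mob B p) : ℂ) := by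
      conv_lhs => rw [mob, horiz_ofCoords]
    rw [h1, h2, mobDenom_mul, mobNum_mul, Complex.ofReal_mul]
    field_simp
  · have h1 : height (mob (A * B) p) = height p / mobDenom (A * B) p := by simp [mob]
    have h2 : height (mob A (mob B p)) = height (mob B p) / mobDenom A (mob B p) := by
      conv_lhs => rw [mob, height_ofCoords]
    have h3 : height (mob B p) = height p / mobDenom B p := by simp [mob]
    rw [h1, h2, h3, mobDenom_mul]
    field_simp

/-- The action of `SL(2, ℂ)` as a homomorphism to the permutations of `H3`. -/
def slPerm : SL(2, ℂ) →* Equiv.Perm H3 where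
  toFun A :=
    { toFun := mob A
      invFun := mob A⁻¹
      left_inv := fun p => by rw [← mob_mul, inv_mul_cancel, mob_one]
      right_inv := fun p => by rw [← mob_mul, mul_inv_cancel, mob_one] }
  map_one' := Equiv.ext mob_one
  map_mul' A B := Equiv.ext (mob_mul A B)

theorem slPerm_center (A : SL(2, ℂ)) (hA : A ∈ Subgroup.center SL(2, ℂ)) : slPerm A = 1 := by
  obtain ⟨r, hr, hs⟩ := Matrix.SpecialLinearGroup.mem_center_iff.1 hA
  have h00 : A 0 0 = r := by rw [← hs]; simp
  have h11 : A 1 1 = r := by rw [← hs]; simp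
  have h01 : A 0 1 = 0 := by rw [← hs]; simp
  have h10 : A 1 0 = 0 := by rw [← hs]; simp
  have hr2 : r ^ 2 = 1 := by simpa using hr
  have hn : Complex.normSq r = 1 := by
    have h := congrArg Complex.normSq hr2
    rw [map_pow, map_one] at h
    nlinarith [Complex.normSq_nonneg r]
  have hm : r * (starRingEnd ℂ) r = 1 := by rw [Complex.mul_conj, hn, Complex.ofReal_one]
  apply Equiv.ext
  intro p
  change mob A p = p
  apply H3.ext_coords
  · simp only [mob, horiz_ofCoords, mobNum, mobDenom, h00, h11, h01, h10]
    simp only [zero_mul, zero_add, add_zero, map_zero, mul_zero, hn, Complex.ofReal_one, div_one]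
    rw [mul_right_comm, hm, one_mul]
  · simp [mob, mobDenom, h10, h11, hn]

/-- The action of `PSL(2, ℂ)` as a homomorphism to the permutations of `H3`. -/
def pslPerm : PSL(2, ℂ) →* Equiv.Perm H3 :=
  QuotientGroup.lift (Subgroup.center SL(2, ℂ)) slPerm slPerm_center

instance : MulAction PSL(2, ℂ) H3 := MulAction.compHom H3 pslPerm

theorem mk_smul (A : SL(2, ℂ)) (p : H3) : (A : PSL(2, ℂ)) • p = mob A p := rfl

/-- The stabilizer of the boundary point `∞`: classes of upper triangular matrices. -/
def FixesInfty (h : PSL(2, ℂ)) : Prop := ∃ A : SL(2, ℂ), (A : PSL(2, ℂ)) = h ∧ A 1 0 = 0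

/-- The parabolic element `z ↦ z + w`. -/
def translation (w : ℂ) : PSL(2, ℂ) :=
  QuotientGroup.mk (⟨!![1, w; 0, 1], by simp [Matrix.det_fin_two]⟩ : SL(2, ℂ))

/-! ### Cusped hyperbolic three-manifolds -/

/-- The hyperbolic volume `dx dy dt / t ^ 3`. -/
def hypVolume : Measure H3 :=
  (Measure.comap (Subtype.val : H3 → E3) volume).withDensity fun p => ENNReal.ofReal (1 / height p ^ 3)

/-- The quotient `M = H3 / Γ`. -/
abbrev Quot3 (Γ : Subgroup PSL(2, ℂ)) : Type := Quotient (MulAction.orbitRel Γ H3)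

/-- The projection `H3 → M`. -/
def proj (Γ : Subgroup PSL(2, ℂ)) (p : H3) : Quot3 Γ := Quotient.mk _ p

/-- `H3 / Γ` is a complete non-compact oriented hyperbolic three-manifold of finite volume. -/
structure IsCusped (Γ : Subgroup PSL(2, ℂ)) : Prop where
  properlyDiscontinuous : ProperlyDiscontinuousSMul Γ H3
  free : ∀ γ ∈ Γ, ∀ p : H3, γ • p = p → γ = 1
  finiteVolume : ∃ F : Set H3, IsFundamentalDomain Γ F hypVolume ∧ hypVolume F < ⊤
  noncompact : ¬ CompactSpace (Quot3 Γ)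

/-- The image of a set under an element of `PSL(2, ℂ)`. -/
def translate (h : PSL(2, ℂ)) (s : Set H3) : Set H3 := (fun p => h • p) '' s

/-- The closed horoball `t ≥ e ^ τ` centred at `∞`. -/
def horoball (τ : ℝ) : Set H3 := {p | Real.exp τ ≤ height p}

/-- The open horoball `t > e ^ τ` centred at `∞`. -/
def openHoroball (τ : ℝ) : Set H3 := {p | Real.exp τ < height p}

/-- The `k` cusps of `H3 / Γ` with their normalizations. For each `i`, the element `frame i`
moves a parabolic fixed point representing the `i`-th cusp to `∞`, in such a way that the
horoball `t ≥ 1` becomes the lift of the maximal cusped region of that cusp. -/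
structure CuspData (Γ : Subgroup PSL(2, ℂ)) (k : ℕ) where
  frame : Fin k → PSL(2, ℂ)
  μ : Fin k → ℂ
  ν : Fin k → ℂ
  /-- The generators are not real multiples of each other. -/
  indep : ∀ i, LinearIndependent ℝ ![μ i, ν i]
  /-- After conjugation by `frame i`, the stabilizer of `∞` is generated by `z ↦ z + μ i` and
  `z ↦ z + ν i`. -/
  stabilizer : ∀ (i : Fin k) (h : PSL(2, ℂ)),
    ((frame i)⁻¹ * h * frame i ∈ Γ ∧ FixesInfty h) ↔
      ∃ m n : ℤ, h = translation (m * μ i + n * ν i)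
  /-- Distinct translates of the open horoball `t > 1` are disjoint. -/
  disjoint : ∀ (i : Fin k) (h : PSL(2, ℂ)), (frame i)⁻¹ * h * frame i ∈ Γ → ¬ FixesInfty h →
    Disjoint (openHoroball 0) (translate h (openHoroball 0))
  /-- Some two distinct translates of the horoball `t ≥ 1` are tangent. -/
  tangent : ∀ i : Fin k, ∃ h : PSL(2, ℂ), (frame i)⁻¹ * h * frame i ∈ Γ ∧ ¬ FixesInfty h ∧
    (horoball 0 ∩ translate h (horoball 0)).Nonempty
  /-- Every parabolic fixed point `h⁻¹ ∞` of `Γ` is equivalent under `Γ` to exactly one of the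
  points `(frame i)⁻¹ ∞`. -/
  complete : ∀ h : PSL(2, ℂ), (∃ w : ℂ, w ≠ 0 ∧ h⁻¹ * translation w * h ∈ Γ) →
    ∃! i : Fin k, ∃ γ ∈ Γ, FixesInfty (h * γ * (frame i)⁻¹)

namespace CuspData

variable {Γ : Subgroup PSL(2, ℂ)} {k : ℕ} (C : CuspData Γ k)

/-- The part `T_i × (τ, ∞)` of the `i`-th cusped region of `M`. -/
def cuspRegion (i : Fin k) (τ : ℝ) : Set (Quot3 Γ) :=
  proj Γ '' translate (C.frame i)⁻¹ (openHoroball τ)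

/-- The regions `T_i × (τ, ∞)` of the different cusps are pairwise disjoint. -/
def Separates (τ : ℝ) : Prop :=
  0 ≤ τ ∧ ∀ i j : Fin k, i ≠ j → Disjoint (C.cuspRegion i τ) (C.cuspRegion j τ)

/-- The constant `max (e ^ τ₀, |μ_1| + |ν_1|, …, |μ_k| + |ν_k|)`. -/
def L₀ (τ₀ : ℝ) : ℝ := max (Real.exp τ₀) (⨆ i : Fin k, (‖C.μ i‖ + ‖C.ν i‖))

/-- `τ_j = log (j L₀)`. -/
def level (τ₀ : ℝ) (j : ℕ) : ℝ := Real.log (j * C.L₀ τ₀)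

/-- The truncated hyperbolic space: all translates of the open horoballs are removed. -/
def Ω (τ : ℝ) : Set H3 :=
  (⋃ i : Fin k, ⋃ γ ∈ Γ, translate γ (translate (C.frame i)⁻¹ (openHoroball τ)))ᶜ

/-- The truncated manifold `M(τ)`, a subset of `M`. -/
def M (τ : ℝ) : Set (Quot3 Γ) := (⋃ i : Fin k, C.cuspRegion i τ)ᶜ

/-- `M(τ) = Ω(τ) / Γ`. -/
theorem proj_preimage_M (τ : ℝ) : proj Γ ⁻¹' C.M τ = C.Ω τ := by
  ext p
  simp only [M, Ω, mem_preimage, mem_compl_iff, mem_iUnion, not_iff_not, cuspRegion]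
  constructor
  · rintro ⟨i, q, hq, hqp⟩
    obtain ⟨γ, hγ⟩ := (MulAction.orbitRel_apply.1 (Quotient.exact hqp) : q ∈ MulAction.orbit Γ p)
    refine ⟨i, (γ : PSL(2, ℂ))⁻¹, Γ.inv_mem γ.2, q, hq, ?_⟩
    change (γ : PSL(2, ℂ))⁻¹ • q = p
    rw [← hγ]
    exact inv_smul_smul (γ : PSL(2, ℂ)) p
  · rintro ⟨i, γ, hγ, q, hq, rfl⟩
    refine ⟨i, q, hq, Quotient.sound (MulAction.orbitRel_apply.2 ⟨⟨γ⁻¹, Γ.inv_mem hγ⟩, ?_⟩)⟩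
    change γ⁻¹ • γ • q = q
    exact inv_smul_smul γ q

/-- The projection `Ω(τ) → M(τ)`. -/
def projΩ (τ : ℝ) (p : C.Ω τ) : C.M τ :=
  ⟨proj Γ p, (C.proj_preimage_M τ).symm.subset p.2⟩

end CuspData

/-! ### The modified metric -/

/-- A cut-off function `φ` on `(0, ∞)` and the solution `f` of `f' / f = φ` with `f(t) = t` for
small `t`. -/
structure IsCutoff (L₁ L₂ : ℝ) (φ f : ℝ → ℝ) : Prop where
  smooth_φ : ContDiffOn ℝ ∞ φ (Ioi 0)
  φ_eq_inv : ∀ t, 0 < t → t ≤ L₁ → φ t = 1 / t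
  deriv_φ_neg : ∀ t ∈ Ioo L₁ L₂, deriv φ t < 0
  φ_eq_zero : ∀ t, L₂ ≤ t → φ t = 0
  φ_bounds : ∀ t, 0 < t → 0 ≤ φ t ∧ φ t ≤ 1 / t
  smooth_f : ContDiffOn ℝ ∞ f (Ioi 0)
  f_pos : ∀ t, 0 < t → 0 < f t
  ode : ∀ t, 0 < t → deriv f t / f t = φ t
  f_eq_id : ∀ t, 0 < t → t ≤ L₁ → f t = t

/-- A field of bilinear forms on (the tangent spaces of) `H3`. -/
abbrev Tensor2 : Type := H3 → E3 →L[ℝ] E3 →L[ℝ] ℝ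

/-- The metric `(dx² + dy² + dt²) / f(t)²`. -/
def conformalMetric (f : ℝ → ℝ) : Tensor2 := fun p => (1 / f (height p) ^ 2) • innerSL ℝ

/-- The hyperbolic metric `(dx² + dy² + dt²) / t²`. -/
def hypMetric : Tensor2 := conformalMetric fun t => t

/-- The derivative at `p` of the action of `h` on `H3`. -/
def dsmul (h : PSL(2, ℂ)) (p : H3) : E3 →L[ℝ] E3 :=
  mfderiv (𝓡 3) (𝓡 3) (fun q : H3 => h • q) p

/-- The slab `a ≤ t ≤ b`. -/
def slab (a b : ℝ) : Set H3 := {p | a ≤ height p ∧ height p ≤ b}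

variable {Γ : Subgroup PSL(2, ℂ)} {k : ℕ}

/-- `b` is the modified metric on `Ω(τ₄)`: it is hyperbolic on `Ω(τ₃)`, and each component `U` of
the remaining part can be moved by a hyperbolic isometry to the slab `3 L₀ ≤ t ≤ 4 L₀` so that `b`
on `U` becomes `(dx² + dy² + dt²) / f(t)²`. The components `U` are the lifts
`γ (frame i)⁻¹ (slab)` of the regions `T_i × [τ₃, τ₄]`. -/
def IsModifiedMetric (C : CuspData Γ k) (τ₀ : ℝ) (f : ℝ → ℝ) (b : Tensor2) : Prop :=
  (∀ p ∈ C.Ω (C.level τ₀ 3), b p = hypMetric p) ∧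
  ∀ (i : Fin k), ∀ γ ∈ Γ, ∃ h : PSL(2, ℂ),
    let S := slab (3 * C.L₀ τ₀) (4 * C.L₀ τ₀)
    let U := translate γ (translate (C.frame i)⁻¹ S)
    translate h U = S ∧
      ∀ p ∈ U, ∀ v w : E3,
        b p v w = conformalMetric f (h • p) (dsmul h p v) (dsmul h p w)

/-- The length of a curve `c : [0, 1] → H3` with respect to `b`. -/
def curveLength (b : Tensor2) (c : ℝ → H3) : ENNReal :=
  ∫⁻ t in Icc (0 : ℝ) 1, ENNReal.ofReal (Real.sqrt
    (b (c t) (derivWithin (fun s => (c s : E3)) (Icc 0 1) t)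
      (derivWithin (fun s => (c s : E3)) (Icc 0 1) t)))

/-- The distance on `X ⊆ H3` with respect to `b`: the infimum of the lengths of the `C¹` curves in
`X` with the given end points. -/
def pathDist (b : Tensor2) (X : Set H3) (p q : X) : ENNReal :=
  ⨅ (c : ℝ → H3) (_ : ContDiffOn ℝ 1 (fun s => (c s : E3)) (Icc 0 1))
    (_ : ∀ t ∈ Icc (0 : ℝ) 1, c t ∈ X) (_ : c 0 = p) (_ : c 1 = q), curveLength b c

/-- The isometry group of `X` with the distance given by `b`. -/
def isomGroup (b : Tensor2) (X : Set H3) : Subgroup (Equiv.Perm X) where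
  carrier := {σ | ∀ p q, pathDist b X (σ p) (σ q) = pathDist b X p q}
  one_mem' := fun _ _ => rfl
  mul_mem' := fun {σ σ'} hσ hσ' p q => (hσ (σ' p) (σ' q)).trans (hσ' p q)
  inv_mem' := fun {σ} hσ p q => by
    have h := hσ (σ⁻¹ p) (σ⁻¹ q)
    simpa using h.symm

/-! ### Curvature of Riemannian three-manifolds with boundary -/

/-- The partial derivative of `F` in the `i`-th coordinate, within `s`. -/
def pderiv (s : Set E3) (i : Fin 3) (F : E3 → ℝ) (y : E3) : ℝ :=
  fderivWithin ℝ F s y (EuclideanSpace.single i 1)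

/-- The Christoffel symbol `Γ^l_{ij}` of the metric with coefficients `G`. -/
def christoffel (s : Set E3) (G : E3 → Matrix (Fin 3) (Fin 3) ℝ) (l i j : Fin 3) (y : E3) : ℝ :=
  (1 / 2) * ∑ m, (G y)⁻¹ l m *
    (pderiv s j (fun z => G z m i) y + pderiv s i (fun z => G z m j) y
      - pderiv s m (fun z => G z i j) y)

/-- The `l`-th component of `R(∂_i, ∂_j) ∂_k`, where
`R(X, Y) Z = ∇_X ∇_Y Z - ∇_Y ∇_X Z - ∇_[X, Y] Z`. -/
def riemann (s : Set E3) (G : E3 → Matrix (Fin 3) (Fin 3) ℝ) (l i j k : Fin 3) (y : E3) : ℝ :=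
  pderiv s i (christoffel s G l j k) y - pderiv s j (christoffel s G l i k) y
    + ∑ m, (christoffel s G m j k y * christoffel s G l i m y
      - christoffel s G m i k y * christoffel s G l j m y)

/-- The sectional curvature `⟨R(u, v) v, u⟩ / (|u|² |v|² - ⟨u, v⟩²)`. -/
def sectional (s : Set E3) (G : E3 → Matrix (Fin 3) (Fin 3) ℝ) (y u v : E3) : ℝ :=
  (∑ i, ∑ j, ∑ k, ∑ l, ∑ m, u i * v j * v k * u l * G y l m * riemann s G m i j k y) /
    ((∑ i, ∑ j, G y i j * u i * u j) * (∑ i, ∑ j, G y i j * v i * v j)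
      - (∑ i, ∑ j, G y i j * u i * v j) ^ 2)

section Manifold

variable {X : Type*} [TopologicalSpace X] [ChartedSpace (EuclideanHalfSpace 3) X]
  [IsManifold (𝓡∂ 3) ∞ X]

/-- Smooth Riemannian metrics on a three-manifold with boundary. -/
abbrev Metric3 (X : Type*) [TopologicalSpace X] [ChartedSpace (EuclideanHalfSpace 3) X]
    [IsManifold (𝓡∂ 3) ∞ X] : Type _ :=
  Bundle.ContMDiffRiemannianMetric (𝓡∂ 3) ∞ E3 (fun x : X => TangentSpace (𝓡∂ 3) x)

/-- The coefficients of the metric `g` in the preferred chart at `x`. -/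
def chartCoeff (g : Metric3 X) (x : X) (y : E3) : Matrix (Fin 3) (Fin 3) ℝ :=
  Matrix.of fun i j =>
    g.inner ((extChartAt (𝓡∂ 3) x).symm y)
      (mfderivWithin 𝓘(ℝ, E3) (𝓡∂ 3) (extChartAt (𝓡∂ 3) x).symm (range (𝓡∂ 3)) y
        (EuclideanSpace.single i (1 : ℝ) : E3))
      (mfderivWithin 𝓘(ℝ, E3) (𝓡∂ 3) (extChartAt (𝓡∂ 3) x).symm (range (𝓡∂ 3)) y
        (EuclideanSpace.single j (1 : ℝ) : E3))

/-- The sectional curvature of `g` at `x` in the plane spanned by `u` and `v`, which are given by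
their coordinates in the preferred chart at `x`. -/
def sectionalCurvature (g : Metric3 X) (x : X) (u v : E3) : ℝ :=
  sectional (range (𝓡∂ 3)) (chartCoeff g x) (extChartAt (𝓡∂ 3) x x) u v

/-- The boundary is totally geodesic. In a chart with values in the half-space `x⁰ ≥ 0` this says
that the vectors `∇_{∂_i} ∂_j` with `i, j ≠ 0` are tangent to the boundary, i.e. that the second
fundamental form of the boundary vanishes. -/
def HasTotallyGeodesicBoundary (g : Metric3 X) : Prop :=
  ∀ x ∈ (𝓡∂ 3).boundary X, ∀ i j : Fin 3, i ≠ 0 → j ≠ 0 →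
    christoffel (range (𝓡∂ 3)) (chartCoeff g x) 0 i j (extChartAt (𝓡∂ 3) x x) = 0

end Manifold

end CuspedHyperbolic

end

open CuspedHyperbolic

/-! The modified metric is governed by one function. Above the level `L₀` the horoball regions of
different cusps are disjoint, and two frames of the same cusp that show a point above this level
differ by a translation. The height of the point in its cusp is therefore well defined and
Γ-invariant; extended by the constant `L₀` it is `cuspHeight`. An isometry preserving a slab a ≤ t ≤
b preserves heights (`height_eq_of_translate_slab`), so on Ω(τ₄) the modified metric must be the
hyperbolic metric times (s / f(s))², where s is `cuspHeight` (`isModifiedMetric_iff`). Existence and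
Γ-invariance of the tensor, and hence of lengths and distances, follow from this formula; freeness
of the action gives injectivity.

Locally, in coordinates (a − t, x, y) with a = 4 L₀, the metric is the Euclidean one divided by
f(t)². Put φ = f′ / f. Planes containing the vertical direction have curvature f² φ′, horizontal
planes have curvature − f² φ², and any other plane has a weighted mean of the two
(`sectional_conformal`). For t < 4 L₀ both values are negative, for t ≤ 3 L₀ both are −1, and the
Christoffel symbols on t = 4 L₀ are multiples of φ(4 L₀) = 0. Horospherical charts exist around
every point of Ω(τ₄) (`exists_patch`). Their transition maps are Möbius maps, and the local metrics
agree because a chart shows the cusp height wherever f differs from the identity. The same charts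
serve Ω(τ₄) and M(τ₄).

Compactness and the description of the cusps come from a thick-thin decomposition. `disp A x` is the
squared Frobenius distance from 1 of A conjugated so that x becomes the base point. The commutator
of two short elements is shorter still (`disp_commutator_le`), so discreteness makes short elements
at a point commute (`commute_of_short`). Finite volume and a packing argument make the thick points
compact modulo Γ (`relCompact_thick`, `relCompact_Thick`), and on a compact set only finitely many
elements are short. Every tube about an axis and every cusp reaches the thick points, which gives
compactness of the loxodromic thin part (`relCompact_loxodromic`), finiteness of the cusps
(`exists_finite_cusps`) and cocompactness of their lattices (`exists_cocompact`). Truncation leaves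
a compact box of each cusp (`relCompact_Ω`). A cusp is normalized by scaling its smallest nonzero
lower left entry to modulus 1 (`exists_normalized_frame`). -/

noncomputable section

namespace CuspedHyperbolic

/-! ### The Poincaré extension as a map of Euclidean space -/

/-- The horizontal coordinate as a function on Euclidean space. -/
def horizE (x : E3) : ℂ := (x 0 : ℂ) + (x 1 : ℂ) * Complex.I

theorem horizE_coe (p : H3) : horizE p = horiz p := by
  apply Complex.ext <;> simp [horizE, horiz]

theorem contDiff_horizE : ContDiff ℝ ∞ horizE := by
  unfold horizE
  refine (Complex.ofRealCLM.contDiff.comp ?_).add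
    ((Complex.ofRealCLM.contDiff.comp ?_).mul contDiff_const) <;> fun_prop

/-- The denominator of the Poincaré extension on Euclidean space. -/
def denE (A : SL(2, ℂ)) (x : E3) : ℝ :=
  Complex.normSq (A 1 0 * horizE x + A 1 1) + Complex.normSq (A 1 0) * x 2 ^ 2

/-- The horizontal numerator of the Poincaré extension on Euclidean space. -/
def numE (A : SL(2, ℂ)) (x : E3) : ℂ :=
  (A 0 0 * horizE x + A 0 1) * (starRingEnd ℂ) (A 1 0 * horizE x + A 1 1)
    + A 0 0 * (starRingEnd ℂ) (A 1 0) * (x 2 : ℂ) ^ 2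

/-- The Poincaré extension on Euclidean space. -/
def mobE (A : SL(2, ℂ)) (x : E3) : E3 :=
  !₂[(denE A x)⁻¹ * (numE A x).re, (denE A x)⁻¹ * (numE A x).im, x 2 / denE A x]

theorem denE_coe (A : SL(2, ℂ)) (p : H3) : denE A p = mobDenom A p := by
  simp only [denE, mobDenom, horizE_coe, height]

theorem numE_coe (A : SL(2, ℂ)) (p : H3) : numE A p = mobNum A p := by
  simp only [numE, mobNum, horizE_coe, height]

theorem mobE_coe (A : SL(2, ℂ)) (p : H3) : mobE A p = (mob A p : E3) := by
  have h1 : (mobNum A p / (mobDenom A p : ℂ)) = ((mobDenom A p)⁻¹ : ℝ) * mobNum A p := by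
    push_cast; ring
  simp only [mobE, denE_coe, numE_coe, mob, ofCoords, h1, Complex.re_ofReal_mul,
    Complex.im_ofReal_mul]
  rfl

theorem contDiff_denE (A : SL(2, ℂ)) : ContDiff ℝ ∞ (denE A) := by
  have h := contDiff_horizE
  have h1 : ContDiff ℝ ∞ fun x : E3 => A 1 0 * horizE x + A 1 1 :=
    (contDiff_const.mul h).add contDiff_const
  have h2 : ContDiff ℝ ∞ fun x : E3 => (A 1 0 * horizE x + A 1 1).re :=
    Complex.reCLM.contDiff.comp h1
  have h3 : ContDiff ℝ ∞ fun x : E3 => (A 1 0 * horizE x + A 1 1).im :=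
    Complex.imCLM.contDiff.comp h1
  unfold denE
  simp only [Complex.normSq_apply]
  fun_prop

theorem contDiff_numE (A : SL(2, ℂ)) : ContDiff ℝ ∞ (numE A) := by
  have h := contDiff_horizE
  have h1 : ContDiff ℝ ∞ fun x : E3 => A 1 0 * horizE x + A 1 1 :=
    (contDiff_const.mul h).add contDiff_const
  have h2 : ContDiff ℝ ∞ fun x : E3 => (starRingEnd ℂ) (A 1 0 * horizE x + A 1 1) :=
    Complex.conjCLE.contDiff.comp h1
  have h3 : ContDiff ℝ ∞ fun x : E3 => (x 2 : ℂ) :=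
    Complex.ofRealCLM.contDiff.comp (by fun_prop)
  unfold numE
  exact (((contDiff_const.mul h).add contDiff_const).mul h2).add (contDiff_const.mul (h3.pow 2))

theorem denE_pos (A : SL(2, ℂ)) {x : E3} (hx : 0 < x 2) : 0 < denE A x := by
  have := denE_coe A ⟨x, hx⟩
  rw [this]; exact mobDenom_pos _ _

theorem contDiffAt_mobE (A : SL(2, ℂ)) {x : E3} (hx : 0 < x 2) : ContDiffAt ℝ ∞ (mobE A) x := by
  have hd := (contDiff_denE A).contDiffAt (x := x)
  have hi := hd.inv (denE_pos A hx).ne'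
  have hn := (contDiff_numE A).contDiffAt (x := x)
  have hr : ContDiffAt ℝ ∞ (fun x => (numE A x).re) x := Complex.reCLM.contDiff.contDiffAt.comp x hn
  have hm : ContDiffAt ℝ ∞ (fun x => (numE A x).im) x := Complex.imCLM.contDiff.contDiffAt.comp x hn
  have h2 : ContDiffAt ℝ ∞ (fun x : E3 => x 2) x := by fun_prop
  rw [contDiffAt_euclidean]
  intro i
  fin_cases i
  · exact hi.mul hr
  · exact hi.mul hm
  · exact h2.div hd (denE_pos A hx).ne'

theorem continuous_height : Continuous height := by
  unfold height; fun_prop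

theorem continuous_horiz : Continuous horiz := by
  have : horiz = fun p : H3 => horizE p := funext fun p => (horizE_coe p).symm
  rw [this]
  exact contDiff_horizE.continuous.comp continuous_subtype_val

theorem continuous_mob (A : SL(2, ℂ)) : Continuous (mob A) := by
  rw [continuous_induced_rng, continuous_iff_continuousAt]
  intro p
  have h := (contDiffAt_mobE A p.2).continuousAt
  have : (Subtype.val ∘ mob A) = mobE A ∘ (Subtype.val : H3 → E3) :=
    funext fun q => (mobE_coe A q).symm
  rw [this]
  exact ContinuousAt.comp h continuous_subtype_val.continuousAt

theorem exists_mk (h : PSL(2, ℂ)) : ∃ A : SL(2, ℂ), (A : PSL(2, ℂ)) = h :=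
  QuotientGroup.mk_surjective h

instance : ContinuousConstSMul PSL(2, ℂ) H3 := ⟨fun h => by
  obtain ⟨A, rfl⟩ := exists_mk h
  exact continuous_mob A⟩

theorem height_mob (A : SL(2, ℂ)) (p : H3) : height (mob A p) = height p / mobDenom A p := by
  simp [mob]

theorem horiz_mob (A : SL(2, ℂ)) (p : H3) :
    horiz (mob A p) = mobNum A p / (mobDenom A p : ℂ) := by
  simp [mob]

/-! ### The invariant `2 cosh d - 2` -/

/-- The Möbius invariant separation `|p - q|² / (t s)` of points of heights `t` and `s`, which
equals `2 cosh d(p, q) - 2`. -/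
def sep (p q : H3) : ℝ :=
  (Complex.normSq (horiz p - horiz q) + (height p - height q) ^ 2) / (height p * height q)

theorem norm_sub_sq (p q : H3) : ‖(p : E3) - q‖ ^ 2 =
    Complex.normSq (horiz p - horiz q) + (height p - height q) ^ 2 := by
  rw [EuclideanSpace.norm_sq_eq]
  simp [Fin.sum_univ_three, Complex.normSq_apply, horiz, height]
  ring

theorem sep_eq (p q : H3) : sep p q = ‖(p : E3) - q‖ ^ 2 / (height p * height q) := by
  rw [norm_sub_sq, sep]

theorem sep_comm (p q : H3) : sep p q = sep q p := by
  rw [sep_eq, sep_eq, norm_sub_rev, mul_comm]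

/-- The identity `mobNum_normSq` cancels the denominators. What remains is a polynomial identity
that holds modulo ad − bc = 1 and its conjugate. -/
theorem sep_mob (A : SL(2, ℂ)) (p q : H3) : sep (mob A p) (mob A q) = sep p q := by
  have hp := mobDenom_pos A p
  have hq := mobDenom_pos A q
  have htp := height_pos p
  have htq := height_pos q
  have hpc : (mobDenom A p : ℂ) ≠ 0 := by exact_mod_cast hp.ne'
  have hqc : (mobDenom A q : ℂ) ≠ 0 := by exact_mod_cast hq.ne'
  have h := det_eq A
  have h' := congrArg (starRingEnd ℂ) h
  simp only [map_sub, map_mul, map_one] at h'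
  have e1 := mobNum_normSq A p
  have e2 := mobNum_normSq A q
  have e3 := mobDenom_cast A p
  have e4 := mobDenom_cast A q
  have key : ((sep (mob A p) (mob A q) : ℝ) : ℂ) = (sep p q : ℝ) := by
    simp only [sep, height_mob, horiz_mob]
    push_cast
    simp only [← Complex.mul_conj, map_sub, map_div₀, Complex.conj_ofReal]
    have hx : ∀ n m n' m' t s D E : ℂ, D ≠ 0 → E ≠ 0 → t ≠ 0 → s ≠ 0 →
        ((n / D - m / E) * (n' / D - m' / E) + (t / D - s / E) ^ 2) / (t / D * (s / E)) =
        ((n * n' + t ^ 2) / D * E + (m * m' + s ^ 2) / E * D - n * m' - m * n' - 2 * t * s)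
          / (t * s) := by
      intro n m n' m' t s D E hD hE ht hs
      field_simp
      ring
    rw [hx _ _ _ _ _ _ _ _ hpc hqc (by exact_mod_cast htp.ne') (by exact_mod_cast htq.ne'),
      e1, e2, mul_div_cancel_left₀ _ hpc, mul_div_cancel_left₀ _ hqc, e3, e4]
    congr 1
    simp only [mobNum, map_add, map_mul, map_pow, Complex.conj_conj, Complex.conj_ofReal]
    generalize (starRingEnd ℂ) (A 0 0) = a' at *
    generalize (starRingEnd ℂ) (A 0 1) = b' at *
    generalize (starRingEnd ℂ) (A 1 0) = c' at *
    generalize (starRingEnd ℂ) (A 1 1) = d' at *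
    generalize (starRingEnd ℂ) (horiz p) = z' at *
    generalize (starRingEnd ℂ) (horiz q) = w' at *
    generalize A 0 0 = a at *
    generalize A 0 1 = b at *
    generalize A 1 0 = c at *
    generalize A 1 1 = d at *
    generalize horiz p = z at *
    generalize horiz q = w at *
    generalize (height p : ℂ) = t at *
    generalize (height q : ℂ) = s at *
    linear_combination ((a' * d' - b' * c') * (z * z' + t ^ 2 + w * w' + s ^ 2 - z * w' - w * z')) * h
      + (z * z' + t ^ 2 + w * w' + s ^ 2 - z * w' - w * z') * h'
  exact_mod_cast key

theorem sep_smul (h : PSL(2, ℂ)) (p q : H3) : sep (h • p) (h • q) = sep p q := by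
  obtain ⟨A, rfl⟩ := exists_mk h
  exact sep_mob A p q

theorem sep_self (p : H3) : sep p p = 0 := by simp [sep]

theorem sep_nonneg (p q : H3) : 0 ≤ sep p q := by
  rw [sep_eq]; exact div_nonneg (sq_nonneg _) (mul_pos (height_pos p) (height_pos q)).le

theorem continuous_sep : Continuous fun x : H3 × H3 => sep x.1 x.2 := by
  unfold sep
  have h1 := continuous_height
  have h2 := continuous_horiz
  have h3 := Complex.continuous_normSq
  refine Continuous.div (by fun_prop) (by fun_prop) fun x => ?_
  exact (mul_pos (height_pos _) (height_pos _)).ne'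

/-! ### Conformality -/

theorem denE_eq_div (A : SL(2, ℂ)) (p : H3) :
    (mobDenom A p)⁻¹ = height (mob A p) / height p := by
  rw [height_mob]
  field_simp [(height_pos p).ne', (mobDenom_pos A p).ne']

/-- Invariance of `sep` with the heights cleared. It yields conformality without differentiating the
formula for the map. -/
theorem norm_mobE_sub_sq (A : SL(2, ℂ)) (p q : H3) :
    ‖mobE A p - mobE A q‖ ^ 2 = ‖(p : E3) - q‖ ^ 2 / (denE A p * denE A q) := by
  have h := sep_mob A p q
  rw [sep_eq, sep_eq, height_mob, height_mob, ← mobE_coe, ← mobE_coe, ← denE_coe, ← denE_coe] at h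
  have h1 := denE_pos A p.2
  have h2 := denE_pos A q.2
  have h3 := height_pos p
  have h4 := height_pos q
  field_simp at h ⊢
  linarith

/-- By `norm_mobE_sub_sq` the squared norm of a difference quotient in direction v is ‖v‖² / (D(p +
s v) D(p)), with D the denominator. As s tends to 0 the scaling factor becomes 1 / D(p), which is
the ratio of heights. -/
theorem norm_fderiv_mobE (A : SL(2, ℂ)) (p : H3) (v : E3) :
    ‖fderiv ℝ (mobE A) p v‖ = height (mob A p) / height p * ‖v‖ := by
  have hd : HasFDerivAt (mobE A) (fderiv ℝ (mobE A) p) (p : E3) :=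
    ((contDiffAt_mobE A p.2).differentiableAt (by simp)).hasFDerivAt
  have hline : HasDerivAt (fun s : ℝ => (p : E3) + s • v) v 0 := by
    simpa using ((hasDerivAt_id (0 : ℝ)).smul_const v).const_add (p : E3)
  have hc : HasDerivAt (fun s : ℝ => mobE A ((p : E3) + s • v)) (fderiv ℝ (mobE A) p v) 0 := by
    have hd' : HasFDerivAt (mobE A) (fderiv ℝ (mobE A) p) ((p : E3) + (0 : ℝ) • v) := by
      simpa using hd
    exact hd'.comp_hasDerivAt (0 : ℝ) hline
  rw [hasDerivAt_iff_tendsto_slope_zero] at hc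
  have hn := (hc.norm.pow 2)
  have hcont : Filter.Tendsto (fun s : ℝ => ‖v‖ ^ 2 / (denE A ((p : E3) + s • v) * denE A p))
      (nhdsWithin 0 {0}ᶜ) (nhds (‖v‖ ^ 2 / (denE A p * denE A p))) := by
    have : ContinuousAt (fun s : ℝ => ‖v‖ ^ 2 / (denE A ((p : E3) + s • v) * denE A p)) 0 := by
      have hden : ContinuousAt (fun s : ℝ => denE A ((p : E3) + s • v)) 0 := by
        have := (contDiff_denE A).continuous
        fun_prop
      refine ContinuousAt.div continuousAt_const (hden.mul continuousAt_const) ?_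
      simpa using (mul_pos (denE_pos A p.2) (denE_pos A p.2)).ne'
    have h2 := this.tendsto.mono_left (nhdsWithin_le_nhds (s := {0}ᶜ))
    simpa using h2
  have hev : ∀ᶠ s in nhdsWithin (0 : ℝ) {0}ᶜ,
      ‖s⁻¹ • (mobE A ((p : E3) + (0 + s) • v) - mobE A ((p : E3) + (0 : ℝ) • v))‖ ^ 2 =
        ‖v‖ ^ 2 / (denE A ((p : E3) + s • v) * denE A p) := by
    have hpos : ∀ᶠ s in nhds (0 : ℝ), 0 < ((p : E3) + s • v) 2 := by
      have : ContinuousAt (fun s : ℝ => ((p : E3) + s • v) 2) 0 := by fun_prop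
      refine this.eventually (lt_mem_nhds ?_)
      change 0 < ((p : E3) + (0 : ℝ) • v) 2
      rw [zero_smul, add_zero]; exact p.2
    filter_upwards [hpos.filter_mono nhdsWithin_le_nhds, self_mem_nhdsWithin] with s hs hs0
    have hs0 : s ≠ 0 := hs0
    have := norm_mobE_sub_sq A ⟨_, hs⟩ p
    simp only [zero_add, zero_smul, add_zero]
    rw [norm_smul, mul_pow, this]
    simp only [add_sub_cancel_left, norm_smul, mul_pow, norm_inv]
    have : ‖s‖ ≠ 0 := by simpa using hs0
    field_simp
  simp only [zero_add] at hn hev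
  have hlim := tendsto_nhds_unique (hn.congr' hev) hcont
  have h1 := denE_pos A p.2
  have h3 : ‖fderiv ℝ (mobE A) p v‖ ^ 2 = ((denE A p)⁻¹ * ‖v‖) ^ 2 := by
    rw [hlim]; field_simp
  rw [← denE_eq_div, ← denE_coe]
  exact (sq_eq_sq₀ (norm_nonneg _) (by positivity)).1 h3

/-- A linear map multiplying all norms by `c` multiplies all inner products by `c ^ 2`. -/
theorem inner_map_of_norm_map {E F : Type*} [NormedAddCommGroup E] [InnerProductSpace ℝ E]
    [NormedAddCommGroup F] [InnerProductSpace ℝ F] (L : E →L[ℝ] F) (c : ℝ)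
    (h : ∀ v, ‖L v‖ = c * ‖v‖) (v w : E) :
    inner ℝ (L v) (L w) = c ^ 2 * inner ℝ v w := by
  have h1 := h (v + w)
  have h2 := norm_add_sq_real (L v) (L w)
  have h3 := norm_add_sq_real v w
  rw [← map_add, h1, h v, h w, mul_pow, h3] at h2
  linarith

theorem inner_fderiv_mobE (A : SL(2, ℂ)) (p : H3) (v w : E3) :
    inner ℝ (fderiv ℝ (mobE A) p v) (fderiv ℝ (mobE A) p w) =
      (height (mob A p) / height p) ^ 2 * inner ℝ v w :=
  inner_map_of_norm_map _ _ (norm_fderiv_mobE A p) v w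

theorem extChartAt_H3 (p q : H3) : extChartAt (𝓡 3) p q = (q : E3) := rfl

theorem extChartAt_symm_H3 (p q : H3) : (extChartAt (𝓡 3) p).symm (q : E3) = q := by
  have h : q ∈ (extChartAt (𝓡 3) p).source := by
    rw [extChartAt_source]
    change q ∈ ((chartAt E3 (p : E3)).subtypeRestr ⟨p⟩).source
    rw [OpenPartialHomeomorph.subtypeRestr_source]
    exact mem_univ _
  rw [← extChartAt_H3 p q]
  exact (extChartAt (𝓡 3) p).left_inv h

theorem hasMFDerivAt_mob (A : SL(2, ℂ)) (p : H3) :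
    HasMFDerivAt (𝓡 3) (𝓡 3) (mob A) p (fderiv ℝ (mobE A) (p : E3)) := by
  refine ⟨(continuous_mob A).continuousAt, ?_⟩
  have hd : HasFDerivAt (mobE A) (fderiv ℝ (mobE A) p) (p : E3) :=
    ((contDiffAt_mobE A p.2).differentiableAt (by simp)).hasFDerivAt
  refine (hd.congr_of_eventuallyEq ?_).hasFDerivWithinAt
  filter_upwards [upperHalfSpace.isOpen.mem_nhds p.2] with x hx
  change ((mob A ((extChartAt (𝓡 3) p).symm x) : H3) : E3) = mobE A x
  rw [extChartAt_symm_H3 p ⟨x, hx⟩, ← mobE_coe]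

theorem dsmul_mk (A : SL(2, ℂ)) (p : H3) : dsmul (A : PSL(2, ℂ)) p = fderiv ℝ (mobE A) (p : E3) :=
  (hasMFDerivAt_mob A p).mfderiv

theorem inner_dsmul (h : PSL(2, ℂ)) (p : H3) (v w : E3) :
    inner ℝ (dsmul h p v) (dsmul h p w) = (height (h • p) / height p) ^ 2 * inner ℝ v w := by
  obtain ⟨A, rfl⟩ := exists_mk h
  rw [dsmul_mk]
  exact inner_fderiv_mobE A p v w

theorem injective_mobE (A : SL(2, ℂ)) : InjOn (mobE A) {x | 0 < x 2} := by
  intro x hx y hy h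
  have := mobE_coe A ⟨x, hx⟩
  have h2 := mobE_coe A ⟨y, hy⟩
  simp only at this h2
  rw [this, h2] at h
  have h3 := (slPerm A).injective (Subtype.ext h)
  exact congrArg Subtype.val h3

/-! ### Invariance of the hyperbolic volume -/

/-- L / c is a linear isometry; it preserves the volume of the unit ball, so its determinant has
modulus 1. -/
theorem abs_det_of_norm_map (L : E3 →L[ℝ] E3) (c : ℝ) (hc : 0 < c)
    (h : ∀ v, ‖L v‖ = c * ‖v‖) : |L.det| = c ^ 3 := by
  let M : E3 →ₗᵢ[ℝ] E3 :=
    { toLinearMap := c⁻¹ • (L : E3 →ₗ[ℝ] E3)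
      norm_map' := fun v => by
        simp only [LinearMap.smul_apply, ContinuousLinearMap.coe_coe, norm_smul, h]
        rw [norm_inv, Real.norm_of_nonneg hc.le]
        field_simp }
  have hdet : |LinearMap.det M.toLinearMap| = 1 := by
    have h1 : (M.toLinearIsometryEquiv rfl : E3 →ₗ[ℝ] E3) = M.toLinearMap := by
      ext v; rfl
    have := LinearIsometryEquiv.measurePreserving (M.toLinearIsometryEquiv rfl : E3 ≃ₗᵢ[ℝ] E3)
    have h3 := Measure.addHaar_image_linearMap (volume : Measure E3) M.toLinearMap
      (Metric.ball 0 1)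
    have h4 : volume (M.toLinearMap '' Metric.ball 0 1) = volume (Metric.ball (0 : E3) 1) := by
      rw [← h1]
      have h5 := (M.toLinearIsometryEquiv rfl : E3 ≃ₗᵢ[ℝ] E3).image_ball 0 1
      rw [map_zero] at h5
      exact congrArg volume h5
    rw [h4] at h3
    have h6 : volume (Metric.ball (0 : E3) 1) ≠ 0 := (Metric.measure_ball_pos _ _ one_pos).ne'
    have h7 : volume (Metric.ball (0 : E3) 1) ≠ ⊤ := measure_ball_lt_top.ne
    have h8 : ENNReal.ofReal |LinearMap.det M.toLinearMap| = 1 := by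
      have : ENNReal.ofReal |LinearMap.det M.toLinearMap| * volume (Metric.ball (0 : E3) 1) =
        1 * volume (Metric.ball (0 : E3) 1) := by rw [one_mul]; exact h3.symm
      exact (ENNReal.mul_left_inj h6 h7).1 this
    simpa using h8
  have h9 : M.toLinearMap = c⁻¹ • (L : E3 →ₗ[ℝ] E3) := rfl
  rw [h9, LinearMap.det_smul, abs_mul, abs_of_pos (by positivity)] at hdet
  simp only [finrank_euclideanSpace, Fintype.card_fin] at hdet
  change |LinearMap.det (L : E3 →ₗ[ℝ] E3)| = c ^ 3
  field_simp at hdet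
  exact hdet

theorem hypVolume_apply {s : Set H3} (hs : MeasurableSet s) :
    hypVolume s = ∫⁻ x in Subtype.val '' s, ENNReal.ofReal (1 / (x 2) ^ 3) := by
  have hm : MeasurableSet (upperHalfSpace : Set E3) := upperHalfSpace.isOpen.measurableSet
  rw [hypVolume, withDensity_apply _ hs]
  exact setLIntegral_subtype hm s fun x : E3 => ENNReal.ofReal (1 / (x 2) ^ 3)

/-- The Jacobian is the cube of the ratio of heights and cancels the change of the density 1 / t³.
-/
theorem hypVolume_image (A : SL(2, ℂ)) {s : Set H3} (hs : MeasurableSet s) :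
    hypVolume (mob A '' s) = hypVolume s := by
  have hm : MeasurableSet (upperHalfSpace : Set E3) := upperHalfSpace.isOpen.measurableSet
  have hemb : MeasurableEmbedding (Subtype.val : H3 → E3) := MeasurableEmbedding.subtype_coe hm
  have himg : mob A '' s = mob A⁻¹ ⁻¹' s :=
    (slPerm A).image_eq_preimage_symm s
  have hms : MeasurableSet (mob A '' s) := by
    rw [himg]; exact (continuous_mob A⁻¹).measurable hs
  rw [hypVolume_apply hs, hypVolume_apply hms]
  have h1 : Subtype.val '' (mob A '' s) = mobE A '' (Subtype.val '' s) := by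
    rw [image_image, image_image]
    exact image_congr fun p _ => (mobE_coe A p).symm
  have hsub : Subtype.val '' s ⊆ {x : E3 | 0 < x 2} := by
    rintro _ ⟨p, _, rfl⟩; exact p.2
  rw [h1, lintegral_image_eq_lintegral_abs_det_fderiv_mul volume (hemb.measurableSet_image.2 hs)
    (f' := fun x => fderiv ℝ (mobE A) x)
    (fun x hx => ((contDiffAt_mobE A (hsub hx)).differentiableAt
      (by simp)).hasFDerivAt.hasFDerivWithinAt) ((injective_mobE A).mono hsub)]
  refine setLIntegral_congr_fun (hemb.measurableSet_image.2 hs) ?_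
  rintro _ ⟨p, _, rfl⟩
  have hp := height_pos p
  have hd := mobDenom_pos A p
  simp only
  rw [abs_det_of_norm_map _ _ (div_pos (height_pos (mob A p)) (height_pos p)) (norm_fderiv_mobE A p),
    mobE_coe, ← ENNReal.ofReal_mul (by have := height_pos (mob A p); positivity)]
  congr 1
  change (height (mob A p) / height p) ^ 3 * (1 / height (mob A p) ^ 3) = 1 / height p ^ 3
  have := height_pos (mob A p)
  field_simp

theorem hypVolume_smul (h : PSL(2, ℂ)) {s : Set H3} (hs : MeasurableSet s) :
    hypVolume ((fun p => h • p) '' s) = hypVolume s := by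
  obtain ⟨A, rfl⟩ := exists_mk h
  exact hypVolume_image A hs

theorem smulInvariantMeasure_hypVolume (Γ : Subgroup PSL(2, ℂ)) :
    SMulInvariantMeasure Γ H3 hypVolume := by
  refine ⟨fun c s hs => ?_⟩
  have : (fun x : H3 => c • x) ⁻¹' s = (fun p : H3 => (c : PSL(2, ℂ))⁻¹ • p) '' s := by
    ext x
    constructor
    · intro hx
      exact ⟨c • x, hx, inv_smul_smul (c : PSL(2, ℂ)) x⟩
    · rintro ⟨y, hy, rfl⟩
      change (c : PSL(2, ℂ)) • (c : PSL(2, ℂ))⁻¹ • y ∈ s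
      rwa [smul_inv_smul]
  rw [this, hypVolume_smul _ hs]

/-! ### Cut-off functions -/

theorem exists_isCutoff {a b : ℝ} (ha : 0 < a) (hab : a < b) : ∃ φ f : ℝ → ℝ, IsCutoff a b φ f := by
  have hba : 0 < b - a := sub_pos.2 hab
  set u : ℝ → ℝ := fun t => (b - t) / (b - a) with hu
  set φ : ℝ → ℝ := fun t => t⁻¹ * Real.smoothTransition (u t) with hφ
  have husm : ContDiff ℝ ∞ u := by fun_prop
  have hS : ContDiff ℝ ∞ fun t => Real.smoothTransition (u t) :=
    Real.smoothTransition.contDiff.comp husm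
  have hinv : ContDiffOn ℝ ∞ (fun t : ℝ => t⁻¹) (Ioi 0) := fun t ht =>
    (contDiffAt_inv ℝ (ne_of_gt ht)).contDiffWithinAt
  have hφsm : ContDiffOn ℝ ∞ φ (Ioi 0) := hinv.mul hS.contDiffOn
  have hφ1 : ∀ t, 0 < t → t ≤ a → φ t = 1 / t := by
    intro t _ hta
    have : 1 ≤ u t := by rw [hu]; simp only; rw [le_div_iff₀ hba]; linarith
    simp only [hφ, Real.smoothTransition.one_of_one_le this, mul_one, one_div]
  have hφ0 : ∀ t, b ≤ t → φ t = 0 := by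
    intro t htb
    have : u t ≤ 0 := div_nonpos_of_nonpos_of_nonneg (by linarith) hba.le
    simp only [hφ, Real.smoothTransition.zero_of_nonpos this, mul_zero]
  have hcont : ContinuousOn φ (Ioi 0) := hφsm.continuousOn
  have hint : ∀ s t, 0 < s → 0 < t → IntervalIntegrable φ volume s t := by
    intro s t hs ht
    refine (hcont.mono ?_).intervalIntegrable
    intro r hr
    exact lt_of_lt_of_le (lt_min hs ht) hr.1
  -- f will be a · exp I. Starting the integral at a gives I(t) = log (t / a), hence f(t) = t, for t
  -- ≤ a.
  set I : ℝ → ℝ := fun t => ∫ s in a..t, φ s with hI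
  have hIder : ∀ t, 0 < t → HasDerivAt I (φ t) t := by
    intro t ht
    refine intervalIntegral.integral_hasDerivAt_right (hint a t ha ht) ?_
      (hcont.continuousAt (Ioi_mem_nhds ht))
    exact hcont.stronglyMeasurableAtFilter isOpen_Ioi t ht
  have hIsm : ContDiffOn ℝ ∞ I (Ioi 0) := by
    rw [contDiffOn_infty_iff_deriv_of_isOpen isOpen_Ioi]
    refine ⟨fun t ht => (hIder t ht).differentiableAt.differentiableWithinAt, ?_⟩
    exact hφsm.congr fun t ht => (hIder t ht).deriv
  refine ⟨φ, fun t => a * Real.exp (I t), hφsm, hφ1, ?_, hφ0, ?_, ?_, ?_, ?_, ?_⟩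
  · intro t ht
    have ht0 : 0 < t := ha.trans ht.1
    have hd1 : HasDerivAt (fun t : ℝ => t⁻¹) (-(t ^ 2)⁻¹) t := hasDerivAt_inv ht0.ne'
    have hd2 : HasDerivAt u (-1 / (b - a)) t :=
      ((hasDerivAt_id t).const_sub b).div_const (b - a)
    have hd3 : HasDerivAt Real.smoothTransition (deriv Real.smoothTransition (u t)) (u t) :=
      ((Real.smoothTransition.contDiffAt (n := 1)).differentiableAt (by simp)).hasDerivAt
    -- In the product rule the term from 1 / t is strictly negative, because the transition function
    -- is still positive to the left of b; the other term is nonpositive by monotonicity.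
    have hd := hd1.mul (hd3.comp t hd2)
    have hmono : 0 ≤ deriv Real.smoothTransition (u t) :=
      Real.smoothTransition.monotone.deriv_nonneg
    have hpos : 0 < Real.smoothTransition (u t) :=
      Real.smoothTransition.pos_of_pos (div_pos (by linarith [ht.2]) hba)
    have : deriv φ t = _ := hd.deriv
    rw [this]
    have h1 : 0 < (t ^ 2)⁻¹ * Real.smoothTransition (u t) := by positivity
    have h2 : 0 ≤ t⁻¹ * (deriv Real.smoothTransition (u t) * (1 / (b - a))) := by positivity
    have h3 : (-1 : ℝ) / (b - a) = -(1 / (b - a)) := by ring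
    simp only [Function.comp_apply, h3]
    linarith
  · intro t ht
    have h0 := Real.smoothTransition.nonneg (u t)
    have h1 := Real.smoothTransition.le_one (u t)
    refine ⟨by simp only [hφ]; positivity, ?_⟩
    simp only [hφ, one_div]
    exact mul_le_of_le_one_right (by positivity) h1
  · exact contDiffOn_const.mul (Real.contDiff_exp.comp_contDiffOn hIsm)
  · intro t _; positivity
  · intro t ht
    have := ((hIder t ht).exp.const_mul a).deriv
    rw [this]
    have := Real.exp_pos (I t)
    field_simp
  · intro t ht hta
    have h1 : I t = Real.log (t / a) := by
      rw [hI]; simp only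
      rw [← integral_inv_of_pos ha ht]
      refine intervalIntegral.integral_congr fun s hs => ?_
      rw [uIcc_of_ge hta] at hs
      have := hφ1 s (ht.trans_le hs.1) hs.2
      simp only [this, one_div]
    simp only [h1]
    rw [Real.exp_log (by positivity)]
    field_simp

namespace IsCutoff

variable {a b : ℝ} {φ f : ℝ → ℝ} (h : IsCutoff a b φ f)

theorem hasDerivAt_f (h : IsCutoff a b φ f) {t : ℝ} (ht : 0 < t) : HasDerivAt f (f t * φ t) t := by
  have hd : DifferentiableAt ℝ f t :=
    (h.smooth_f.contDiffAt (Ioi_mem_nhds ht)).differentiableAt (by simp)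
  have := h.ode t ht
  rw [div_eq_iff (h.f_pos t ht).ne'] at this
  have h2 := hd.hasDerivAt
  rwa [this, mul_comm] at h2

theorem hasDerivAt_φ (h : IsCutoff a b φ f) {t : ℝ} (ht : 0 < t) : HasDerivAt φ (deriv φ t) t :=
  ((h.smooth_φ.contDiffAt (Ioi_mem_nhds ht)).differentiableAt (by simp)).hasDerivAt

/-- At t = a the formula 1 / t is only known to the left, so derivatives within `Iic t` are
compared. -/
theorem deriv_φ_eq (h : IsCutoff a b φ f) {t : ℝ} (ht : 0 < t) (hta : t ≤ a) : deriv φ t = -(t ^ 2)⁻¹ := by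
  have h1 : HasDerivWithinAt φ (deriv φ t) (Iic t) t := (h.hasDerivAt_φ ht).hasDerivWithinAt
  have h2 : HasDerivWithinAt φ (-(t ^ 2)⁻¹) (Iic t) t := by
    refine (hasDerivAt_inv ht.ne').hasDerivWithinAt.congr_of_eventuallyEq ?_ ?_
    · have : Ioi (0 : ℝ) ∈ nhdsWithin t (Iic t) := mem_nhdsWithin_of_mem_nhds (Ioi_mem_nhds ht)
      filter_upwards [this, self_mem_nhdsWithin] with s hs hst
      rw [h.φ_eq_inv s hs (le_trans hst hta), one_div]
    · rw [h.φ_eq_inv t ht hta, one_div]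
  exact (uniqueDiffWithinAt_Iic t).eq_deriv _ h1 h2

/-- Between a and b the function decreases strictly to φ(b) = 0. Positivity is what makes horizontal
planes negatively curved. -/
theorem φ_pos (h : IsCutoff a b φ f) {t : ℝ} (ht : 0 < t) (htb : t < b) : 0 < φ t := by
  rcases le_or_gt t a with hta | hta
  · rw [h.φ_eq_inv t ht hta]; positivity
  · have hcont : ContinuousOn φ (Icc t b) := fun s hs =>
      (h.hasDerivAt_φ (ht.trans_le hs.1)).continuousAt.continuousWithinAt
    have hanti : StrictAntiOn φ (Icc t b) := by
      refine strictAntiOn_of_deriv_neg (convex_Icc t b) hcont fun s hs => ?_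
      rw [interior_Icc] at hs
      exact h.deriv_φ_neg s ⟨hta.trans hs.1, hs.2⟩
    have := hanti (left_mem_Icc.2 htb.le) (right_mem_Icc.2 htb.le) htb
    rwa [h.φ_eq_zero b le_rfl] at this

theorem deriv_φ_neg' (h : IsCutoff a b φ f) {t : ℝ} (ht : 0 < t) (htb : t < b) : deriv φ t < 0 := by
  rcases le_or_gt t a with hta | hta
  · rw [h.deriv_φ_eq ht hta]; exact neg_neg_of_pos (by positivity)
  · exact h.deriv_φ_neg t ⟨hta, htb⟩

end IsCutoff

/-! ### Curvature of metrics `(dx₀² + dx₁² + dx₂²) / F(x₀)²` -/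

/-- Derivatives are taken within s because the charts below take values in a closed half-space. -/
theorem pderiv_comp_coord {s : Set E3} {y : E3} (hs : UniqueDiffWithinAt ℝ s y) {H : E3 → ℝ}
    {g : ℝ → ℝ} {g' : ℝ} (hg : HasDerivAt g g' (y 0))
    (hH : H =ᶠ[nhdsWithin y s] fun z => g (z 0)) (hy : y ∈ s) (i : Fin 3) :
    pderiv s i H y = if i = 0 then g' else 0 := by
  have h1 : HasFDerivAt (fun z : E3 => z 0) (EuclideanSpace.proj (0 : Fin 3) : E3 →L[ℝ] ℝ) y :=
    (EuclideanSpace.proj (0 : Fin 3) : E3 →L[ℝ] ℝ).hasFDerivAt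
  have h2 := (hg.comp_hasFDerivAt y h1).hasFDerivWithinAt (s := s)
  have h3 : HasFDerivWithinAt H (g' • (EuclideanSpace.proj (0 : Fin 3) : E3 →L[ℝ] ℝ)) s y :=
    h2.congr_of_eventuallyEq hH (hH.self_of_nhdsWithin hy)
  rw [pderiv, h3.fderivWithin hs]
  by_cases hi : i = 0
  · subst hi; simp
  · simp [hi, Ne.symm hi]

/-- The Christoffel symbols of `(dx₀² + dx₁² + dx₂²) / F(x₀)²` are `- F' / F` times these. -/
def conformalSymbol (l i j : Fin 3) : ℝ :=
  (if l = i ∧ j = 0 then 1 else 0) + (if l = j ∧ i = 0 then 1 else 0)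
    - (if i = j ∧ l = 0 then 1 else 0)

/-- Everything is expressed through the logarithmic derivative q of F, so that all symbols vanish
where q does; this is the source of the totally geodesic boundary. -/
theorem christoffel_conformal {s : Set E3} {y : E3} (hs : UniqueDiffWithinAt ℝ s y)
    {G : E3 → Matrix (Fin 3) (Fin 3) ℝ} {F : ℝ → ℝ} {q : ℝ}
    (hF : HasDerivAt F (F (y 0) * q) (y 0)) (h0 : F (y 0) ≠ 0)
    (hG : G =ᶠ[nhdsWithin y s] fun z => (1 / F (z 0) ^ 2) • (1 : Matrix (Fin 3) (Fin 3) ℝ))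
    (hy : y ∈ s) (l i j : Fin 3) :
    christoffel s G l i j y = -q * conformalSymbol l i j := by
  have hder : HasDerivAt (fun t => 1 / F t ^ 2) (-2 * q / F (y 0) ^ 2) (y 0) := by
    have := (hF.fun_pow 2).fun_inv (pow_ne_zero 2 h0)
    simp only [one_div]
    refine this.congr_deriv ?_
    field_simp
    norm_num
    ring
  have hp : ∀ m a b : Fin 3, pderiv s m (fun z => G z a b) y =
      if m = 0 ∧ a = b then -2 * q / F (y 0) ^ 2 else 0 := by
    intro m a b
    by_cases hab : a = b
    · subst hab
      rw [pderiv_comp_coord hs hder _ hy]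
      · simp
      · filter_upwards [hG] with z hz
        rw [hz]; simp
    · rw [pderiv_comp_coord hs (hasDerivAt_const (y 0) (0 : ℝ)) _ hy]
      · simp [hab]
      · filter_upwards [hG] with z hz
        rw [hz]; simp [hab]
  have hGy : G y = (1 / F (y 0) ^ 2) • (1 : Matrix (Fin 3) (Fin 3) ℝ) := hG.self_of_nhdsWithin hy
  have hinv : (G y)⁻¹ = (F (y 0) ^ 2) • (1 : Matrix (Fin 3) (Fin 3) ℝ) := by
    apply Matrix.inv_eq_right_inv
    rw [hGy, Matrix.smul_mul, Matrix.one_mul, smul_smul]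
    rw [one_div, inv_mul_cancel₀ (pow_ne_zero 2 h0), one_smul]
  simp only [christoffel, hp, hinv, Matrix.smul_apply, Matrix.one_apply, smul_eq_mul, mul_ite,
    mul_one, mul_zero, ite_mul, zero_mul, Finset.sum_ite_eq, Finset.mem_univ, if_true,
    conformalSymbol]
  by_cases h1 : l = i <;> by_cases h2 : l = j <;> by_cases h3 : i = j <;> by_cases h4 : j = 0 <;>
    by_cases h5 : i = 0 <;> by_cases h6 : l = 0 <;> simp_all <;> field_simp

theorem riemann_conformal {s : Set E3} {y : E3} (hs : UniqueDiffWithinAt ℝ s y)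
    {G : E3 → Matrix (Fin 3) (Fin 3) ℝ} {q : ℝ → ℝ} {q' : ℝ} (hq : HasDerivAt q q' (y 0))
    (hG : ∀ l i j, christoffel s G l i j =ᶠ[nhdsWithin y s] fun z => -q (z 0) * conformalSymbol l i j)
    (hy : y ∈ s) (l i j k : Fin 3) :
    riemann s G l i j k y =
      -q' * ((if i = 0 then conformalSymbol l j k else 0) - (if j = 0 then conformalSymbol l i k else 0))
      + q (y 0) ^ 2 * ∑ m, (conformalSymbol m j k * conformalSymbol l i m
        - conformalSymbol m i k * conformalSymbol l j m) := by
  have hp : ∀ m l i j : Fin 3, pderiv s m (christoffel s G l i j) y =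
      if m = 0 then -q' * conformalSymbol l i j else 0 := fun m l i j =>
    pderiv_comp_coord hs (hq.neg.mul_const _) (hG l i j) hy m
  have hv : ∀ l i j : Fin 3, christoffel s G l i j y = -q (y 0) * conformalSymbol l i j :=
    fun l i j => (hG l i j).self_of_nhdsWithin hy
  simp only [riemann, hp, hv, Finset.mul_sum]
  congr 1
  · split_ifs <;> ring
  · refine Finset.sum_congr rfl fun m _ => ?_
    ring

/-- On coordinate planes the curvature is F² q′ if the plane contains ∂₀ and − F² q² for the plane
of ∂₁ and ∂₂. The squared Plücker coordinates of u ∧ v are the weights with which the two values are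
averaged. -/
theorem sectional_conformal {s : Set E3} {y : E3} (hs : UniqueDiffOn ℝ s)
    {G : E3 → Matrix (Fin 3) (Fin 3) ℝ} {F q : ℝ → ℝ} {q' : ℝ} (hy : y ∈ s)
    (hF : ∀ᶠ z in nhdsWithin y s, HasDerivAt F (F (z 0) * q (z 0)) (z 0) ∧ F (z 0) ≠ 0)
    (hG : G =ᶠ[nhdsWithin y s] fun z => (1 / F (z 0) ^ 2) • (1 : Matrix (Fin 3) (Fin 3) ℝ))
    (hq : HasDerivAt q q' (y 0)) (u v : E3) :
    sectional s G y u v =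
      F (y 0) ^ 2 * (q' * ((u 0 * v 1 - u 1 * v 0) ^ 2 + (u 0 * v 2 - u 2 * v 0) ^ 2)
        - q (y 0) ^ 2 * (u 1 * v 2 - u 2 * v 1) ^ 2) /
      ((u 0 * v 1 - u 1 * v 0) ^ 2 + (u 0 * v 2 - u 2 * v 0) ^ 2 + (u 1 * v 2 - u 2 * v 1) ^ 2) := by
  have hch : ∀ l i j, christoffel s G l i j =ᶠ[nhdsWithin y s]
      fun z => -q (z 0) * conformalSymbol l i j := by
    intro l i j
    filter_upwards [hF, eventually_eventually_nhdsWithin.2 hG, self_mem_nhdsWithin] with z h1 h2 h3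
    exact christoffel_conformal (hs z h3) h1.1 h1.2 h2 h3 l i j
  have h0 : F (y 0) ≠ 0 := (hF.self_of_nhdsWithin hy).2
  have hGy : G y = (1 / F (y 0) ^ 2) • (1 : Matrix (Fin 3) (Fin 3) ℝ) := hG.self_of_nhdsWithin hy
  have hnum : (∑ i, ∑ j, ∑ k, ∑ l, ∑ m, u i * v j * v k * u l * G y l m * riemann s G m i j k y) =
      (1 / F (y 0) ^ 2) * (q' * ((u 0 * v 1 - u 1 * v 0) ^ 2 + (u 0 * v 2 - u 2 * v 0) ^ 2)
        - q (y 0) ^ 2 * (u 1 * v 2 - u 2 * v 1) ^ 2) := by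
    simp only [riemann_conformal (hs y hy) hq hch hy, hGy, Matrix.smul_apply, Matrix.one_apply,
      smul_eq_mul, mul_ite, mul_one, mul_zero, ite_mul, zero_mul, Finset.sum_ite_eq,
      Finset.mem_univ, if_true]
    generalize q (y 0) = Q
    generalize 1 / F (y 0) ^ 2 = c
    simp only [Fin.sum_univ_three, conformalSymbol]
    norm_num [Fin.ext_iff]
    ring
  have hden : (∑ i, ∑ j, G y i j * u i * u j) * (∑ i, ∑ j, G y i j * v i * v j)
      - (∑ i, ∑ j, G y i j * u i * v j) ^ 2 = (1 / F (y 0) ^ 2) ^ 2 *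
      ((u 0 * v 1 - u 1 * v 0) ^ 2 + (u 0 * v 2 - u 2 * v 0) ^ 2 + (u 1 * v 2 - u 2 * v 1) ^ 2) := by
    simp only [hGy, Matrix.smul_apply, Matrix.one_apply,
      smul_eq_mul, mul_ite, mul_one, mul_zero, ite_mul, zero_mul, Finset.sum_ite_eq,
      Finset.mem_univ, if_true]
    simp only [Fin.sum_univ_three]
    ring
  rw [sectional, hnum, hden]
  field_simp

/-- If all three minors vanish, then v_i u = u_i v for every i, and independence forces u = 0. -/
theorem plucker_pos {u v : E3} (h : LinearIndependent ℝ ![u, v]) :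
    0 < (u 0 * v 1 - u 1 * v 0) ^ 2 + (u 0 * v 2 - u 2 * v 0) ^ 2 + (u 1 * v 2 - u 2 * v 1) ^ 2 := by
  by_contra hneg
  have h1 : u 0 * v 1 - u 1 * v 0 = 0 := by
    nlinarith [sq_nonneg (u 0 * v 1 - u 1 * v 0), sq_nonneg (u 0 * v 2 - u 2 * v 0), sq_nonneg (u 1 * v 2 - u 2 * v 1)]
  have h2 : u 0 * v 2 - u 2 * v 0 = 0 := by
    nlinarith [sq_nonneg (u 0 * v 1 - u 1 * v 0), sq_nonneg (u 0 * v 2 - u 2 * v 0), sq_nonneg (u 1 * v 2 - u 2 * v 1)]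
  have h3 : u 1 * v 2 - u 2 * v 1 = 0 := by
    nlinarith [sq_nonneg (u 0 * v 1 - u 1 * v 0), sq_nonneg (u 0 * v 2 - u 2 * v 0), sq_nonneg (u 1 * v 2 - u 2 * v 1)]
  rw [LinearIndependent.pair_iff] at h
  have hv : ∀ i : Fin 3, u i = 0 := by
    intro i
    have := h (v i) (-u i) (by
      ext j
      fin_cases i <;> fin_cases j <;> simp <;> linarith)
    linarith [this.2]
  have hu : u = 0 := by ext i; simpa using hv i
  have := h 1 0 (by simp [hu])
  simp at this

/-! ### The Frobenius norm of two-by-two matrices -/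

/-- The Frobenius norm. -/
def frob (M : Matrix (Fin 2) (Fin 2) ℂ) : ℝ :=
  @norm _ Matrix.frobeniusNormedAddCommGroup.toNorm M

theorem frob_sq (M : Matrix (Fin 2) (Fin 2) ℂ) : frob M ^ 2 =
    Complex.normSq (M 0 0) + Complex.normSq (M 0 1) + Complex.normSq (M 1 0)
      + Complex.normSq (M 1 1) := by
  have h : frob M = (∑ i, ∑ j, ‖M i j‖ ^ (2 : ℝ)) ^ (1 / 2 : ℝ) := Matrix.frobenius_norm_def M
  rw [h, ← Real.sqrt_eq_rpow, Real.sq_sqrt (by positivity)]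
  simp only [Fin.sum_univ_two, Complex.normSq_eq_norm_sq, Real.rpow_ofNat]
  ring

theorem frob_nonneg (M : Matrix (Fin 2) (Fin 2) ℂ) : 0 ≤ frob M :=
  @norm_nonneg _ Matrix.frobeniusNormedAddCommGroup.toSeminormedAddCommGroup.toSeminormedAddGroup M

theorem frob_mul_le (M N : Matrix (Fin 2) (Fin 2) ℂ) : frob (M * N) ≤ frob M * frob N :=
  Matrix.frobenius_norm_mul M N

theorem frob_add_le (M N : Matrix (Fin 2) (Fin 2) ℂ) : frob (M + N) ≤ frob M + frob N :=
  @norm_add_le _ Matrix.frobeniusNormedAddCommGroup.toSeminormedAddCommGroup.toSeminormedAddGroup M N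

theorem frob_sub_le (M N : Matrix (Fin 2) (Fin 2) ℂ) : frob (M - N) ≤ frob M + frob N :=
  @norm_sub_le _ Matrix.frobeniusNormedAddCommGroup.toSeminormedAddCommGroup.toSeminormedAddGroup M N

theorem continuous_frob : Continuous frob := by
  have h : frob = fun M => Real.sqrt (Complex.normSq (M 0 0) + Complex.normSq (M 0 1) +
      Complex.normSq (M 1 0) + Complex.normSq (M 1 1)) := by
    funext M
    rw [← frob_sq, Real.sqrt_sq (frob_nonneg M)]
  rw [h]
  have := Complex.continuous_normSq
  fun_prop

theorem frob_eq_zero {M : Matrix (Fin 2) (Fin 2) ℂ} (h : frob M = 0) : M = 0 := by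
  have h2 := frob_sq M
  rw [h] at h2
  have a := Complex.normSq_nonneg (M 0 0)
  have b := Complex.normSq_nonneg (M 0 1)
  have c := Complex.normSq_nonneg (M 1 0)
  have d := Complex.normSq_nonneg (M 1 1)
  have h00 : M 0 0 = 0 := Complex.normSq_eq_zero.1 (by linarith)
  have h01 : M 0 1 = 0 := Complex.normSq_eq_zero.1 (by linarith)
  have h10 : M 1 0 = 0 := Complex.normSq_eq_zero.1 (by linarith)
  have h11 : M 1 1 = 0 := Complex.normSq_eq_zero.1 (by linarith)
  ext i j
  fin_cases i <;> fin_cases j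
  exacts [h00, h01, h10, h11]

theorem coe_inv_apply (A : SL(2, ℂ)) : (A⁻¹ 0 0 = A 1 1) ∧ (A⁻¹ 0 1 = -A 0 1) ∧
    (A⁻¹ 1 0 = -A 1 0) ∧ (A⁻¹ 1 1 = A 0 0) := by
  rw [Matrix.SpecialLinearGroup.SL2_inv_expl]
  simp

theorem frob_inv (A : SL(2, ℂ)) : frob (A⁻¹ : SL(2, ℂ)) = frob A := by
  have h : frob (A⁻¹ : SL(2, ℂ)) ^ 2 = frob A ^ 2 := by
    obtain ⟨h1, h2, h3, h4⟩ := coe_inv_apply A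
    rw [frob_sq, frob_sq, h1, h2, h3, h4, Complex.normSq_neg, Complex.normSq_neg]
    ring
  exact (sq_eq_sq₀ (frob_nonneg _) (frob_nonneg _)).1 h

/-! ### Elements of `SL(2, ℂ)` -/

theorem SL2_ext {A B : SL(2, ℂ)} (h00 : A 0 0 = B 0 0) (h01 : A 0 1 = B 0 1) (h10 : A 1 0 = B 1 0)
    (h11 : A 1 1 = B 1 1) : A = B := by
  apply Subtype.ext
  ext i j
  fin_cases i <;> fin_cases j
  exacts [h00, h01, h10, h11]

theorem mul_apply00 (A B : SL(2, ℂ)) : (A * B) 0 0 = A 0 0 * B 0 0 + A 0 1 * B 1 0 := by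
  simp [Matrix.SpecialLinearGroup.coe_mul, Matrix.mul_apply, Fin.sum_univ_two]

theorem mul_apply01 (A B : SL(2, ℂ)) : (A * B) 0 1 = A 0 0 * B 0 1 + A 0 1 * B 1 1 := by
  simp [Matrix.SpecialLinearGroup.coe_mul, Matrix.mul_apply, Fin.sum_univ_two]

theorem mul_apply10 (A B : SL(2, ℂ)) : (A * B) 1 0 = A 1 0 * B 0 0 + A 1 1 * B 1 0 := by
  simp [Matrix.SpecialLinearGroup.coe_mul, Matrix.mul_apply, Fin.sum_univ_two]

theorem mul_apply11 (A B : SL(2, ℂ)) : (A * B) 1 1 = A 1 0 * B 0 1 + A 1 1 * B 1 1 := by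
  simp [Matrix.SpecialLinearGroup.coe_mul, Matrix.mul_apply, Fin.sum_univ_two]

theorem mk_eq_mk {A B : SL(2, ℂ)} : (A : PSL(2, ℂ)) = B ↔ A = B ∨ A = -B := by
  have key : (A : PSL(2, ℂ)) = B ↔ A⁻¹ * B ∈ Subgroup.center SL(2, ℂ) := QuotientGroup.eq
  rw [key, Matrix.SpecialLinearGroup.mem_center_iff]
  constructor
  · rintro ⟨r, hr, hs⟩
    have hr2 : r ^ 2 = 1 := by simpa using hr
    rcases mul_self_eq_one_iff.1 ((sq r).symm.trans hr2) with rfl | rfl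
    · left
      have : A⁻¹ * B = 1 := Subtype.ext (by rw [← hs]; simp)
      exact (inv_mul_eq_one.1 this)
    · right
      have : A⁻¹ * B = -1 := Subtype.ext (by
        rw [← hs]
        ext i j
        fin_cases i <;> fin_cases j <;> simp)
      have h2 : B = A * (-1) := by rw [← this, mul_inv_cancel_left]
      rw [h2]; simp
  · rintro (rfl | rfl)
    · exact ⟨1, by simp, by simp⟩
    · refine ⟨-1, by simp, ?_⟩
      have : (-B)⁻¹ * B = -1 := by
        rw [inv_mul_eq_iff_eq_mul]; simp
      rw [this]
      ext i j
      fin_cases i <;> fin_cases j <;> simp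

theorem mk_eq_one {A : SL(2, ℂ)} : (A : PSL(2, ℂ)) = 1 ↔ A = 1 ∨ A = -1 :=
  mk_eq_mk (A := A) (B := 1)

theorem mob_neg (A : SL(2, ℂ)) (p : H3) : mob (-A) p = mob A p := by
  have : ((-A : SL(2, ℂ)) : PSL(2, ℂ)) = A := mk_eq_mk.2 (Or.inr rfl)
  have h := congrArg (fun h : PSL(2, ℂ) => h • p) this
  exact h

theorem fixesInfty_mk {A : SL(2, ℂ)} : FixesInfty (A : PSL(2, ℂ)) ↔ A 1 0 = 0 := by
  constructor
  · rintro ⟨B, hB, h⟩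
    rcases mk_eq_mk.1 hB with rfl | rfl
    · exact h
    · simpa using h
  · exact fun h => ⟨A, rfl, h⟩

/-- The unipotent matrix of `z ↦ z + w`. -/
def transSL (w : ℂ) : SL(2, ℂ) := ⟨!![1, w; 0, 1], by simp [Matrix.det_fin_two]⟩

/-- The diagonal matrix with entries `u`, `u⁻¹`. -/
def diagSL (u : ℂˣ) : SL(2, ℂ) := ⟨!![(u : ℂ), 0; 0, (u⁻¹ : ℂˣ)], by simp [Matrix.det_fin_two]⟩

theorem mk_transSL (w : ℂ) : (transSL w : PSL(2, ℂ)) = translation w := rfl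

section entries
variable (w : ℂ) (u : ℂˣ)
@[simp] theorem transSL_00 : transSL w 0 0 = 1 := rfl
@[simp] theorem transSL_01 : transSL w 0 1 = w := rfl
@[simp] theorem transSL_10 : transSL w 1 0 = 0 := rfl
@[simp] theorem transSL_11 : transSL w 1 1 = 1 := rfl
@[simp] theorem diagSL_00 : diagSL u 0 0 = u := rfl
@[simp] theorem diagSL_01 : diagSL u 0 1 = 0 := rfl
@[simp] theorem diagSL_10 : diagSL u 1 0 = 0 := rfl
@[simp] theorem diagSL_11 : diagSL u 1 1 = (u⁻¹ : ℂˣ) := rfl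
end entries

theorem transSL_add (w v : ℂ) : transSL (w + v) = transSL w * transSL v := by
  apply SL2_ext <;> simp [mul_apply00, mul_apply01, mul_apply10, mul_apply11, add_comm]

theorem transSL_neg (w : ℂ) : transSL (-w) = (transSL w)⁻¹ := by
  rw [eq_inv_iff_mul_eq_one, ← transSL_add, neg_add_cancel]
  apply SL2_ext <;> simp

theorem diagSL_mul (u v : ℂˣ) : diagSL (u * v) = diagSL u * diagSL v := by
  apply SL2_ext <;> simp [mul_apply00, mul_apply01, mul_apply10, mul_apply11, mul_comm]

theorem diagSL_inv (u : ℂˣ) : diagSL u⁻¹ = (diagSL u)⁻¹ := by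
  rw [eq_inv_iff_mul_eq_one, ← diagSL_mul, inv_mul_cancel]
  apply SL2_ext <;> simp

theorem diagSL_pow (u : ℂˣ) (n : ℕ) : diagSL (u ^ n) = diagSL u ^ n := by
  induction n with
  | zero => apply SL2_ext <;> simp
  | succ n ih => rw [pow_succ, diagSL_mul, ih, pow_succ]

theorem diagSL_zpow (u : ℂˣ) (n : ℤ) : diagSL (u ^ n) = diagSL u ^ n := by
  cases n with
  | ofNat n => simpa using diagSL_pow u n
  | negSucc n => rw [zpow_negSucc, diagSL_inv, diagSL_pow, zpow_negSucc]

theorem height_transSL (w : ℂ) (p : H3) : height (mob (transSL w) p) = height p := by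
  simp [height_mob, mobDenom]

theorem horiz_transSL (w : ℂ) (p : H3) : horiz (mob (transSL w) p) = horiz p + w := by
  simp [horiz_mob, mobDenom, mobNum]

theorem mobDenom_upper {A : SL(2, ℂ)} (h : A 1 0 = 0) (p : H3) :
    mobDenom A p = Complex.normSq (A 1 1) := by
  simp [mobDenom, h]

theorem mul_eq_one_of_upper {A : SL(2, ℂ)} (h : A 1 0 = 0) : A 0 0 * A 1 1 = 1 := by
  have := det_eq A
  rwa [h, mul_zero, sub_zero] at this

theorem height_upper {A : SL(2, ℂ)} (h : A 1 0 = 0) (p : H3) :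
    height (mob A p) = Complex.normSq (A 0 0) * height p := by
  have h1 := congrArg Complex.normSq (mul_eq_one_of_upper h)
  rw [map_mul, map_one] at h1
  rw [height_mob, mobDenom_upper h, div_eq_iff (right_ne_zero_of_mul_eq_one h1)]
  linear_combination -(height p) * h1

theorem horiz_upper {A : SL(2, ℂ)} (h : A 1 0 = 0) (p : H3) :
    horiz (mob A p) = A 0 0 ^ 2 * horiz p + A 0 0 * A 0 1 := by
  have h1 := mul_eq_one_of_upper h
  have hd : A 1 1 ≠ 0 := right_ne_zero_of_mul_eq_one h1
  have hd' : (starRingEnd ℂ) (A 1 1) ≠ 0 := by simpa using hd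
  rw [horiz_mob, mobDenom_upper h, ← Complex.mul_conj, mobNum]
  simp only [h, zero_mul, zero_add, map_zero, mul_zero, add_zero]
  have ha : A 0 0 = (A 1 1)⁻¹ := eq_inv_of_mul_eq_one_left h1
  rw [ha]
  field_simp

theorem height_diagSL (u : ℂˣ) (p : H3) :
    height (mob (diagSL u) p) = Complex.normSq u * height p := by
  rw [height_upper (by simp), diagSL_00]

theorem horiz_diagSL (u : ℂˣ) (p : H3) : horiz (mob (diagSL u) p) = u ^ 2 * horiz p := by
  rw [horiz_upper (by simp)]; simp

/-- The base point `(0, 0, 1)`. -/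
def basePoint : H3 := ofCoords 0 1 one_pos

theorem exists_mob_basePoint (x : H3) : ∃ g : SL(2, ℂ), g 1 0 = 0 ∧ mob g basePoint = x := by
  have ht := height_pos x
  have hs : (Real.sqrt (height x) : ℂ) ≠ 0 := by
    exact_mod_cast (Real.sqrt_pos.2 ht).ne'
  refine ⟨transSL (horiz x) * diagSL (Units.mk0 _ hs), by simp [mul_apply10], ?_⟩
  rw [mob_mul]
  apply H3.ext_coords
  · simp [horiz_transSL, horiz_diagSL, basePoint]
  · simp [height_transSL, height_diagSL, basePoint, Complex.normSq_ofReal, Real.mul_self_sqrt ht.le]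

/-- In terms of the distance d from the base point to its image, both sides are 2 cosh d. Estimates
of distances thereby become estimates of a submultiplicative matrix norm. -/
theorem sep_basePoint (A : SL(2, ℂ)) : sep basePoint (mob A basePoint) + 2 = frob A ^ 2 := by
  have hN := mobNum_normSq A basePoint
  have hD := mobDenom_pos A basePoint
  have h1 : Complex.normSq (mobNum A basePoint) + 1 =
      mobDenom A basePoint * (Complex.normSq (A 0 1) + Complex.normSq (A 0 0)) := by
    apply Complex.ofReal_injective
    rw [Complex.ofReal_add, ← Complex.mul_conj]
    simpa [basePoint, Complex.mul_conj] using hN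
  have h2 : mobDenom A basePoint = Complex.normSq (A 1 1) + Complex.normSq (A 1 0) := by
    simp [mobDenom, basePoint]
  rw [frob_sq, sep, horiz_mob, height_mob]
  simp only [basePoint, horiz_ofCoords, height_ofCoords, zero_sub, Complex.normSq_neg,
    Complex.normSq_div, Complex.normSq_ofReal]
  change _ at h1
  simp only [basePoint] at h1 h2 hD
  have h3 : Complex.normSq (A 0 1) + Complex.normSq (A 0 0) =
    (Complex.normSq (mobNum A (ofCoords 0 1 one_pos)) + 1) / mobDenom A (ofCoords 0 1 one_pos) := by
    rw [h1, mul_div_cancel_left₀ _ hD.ne']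
  have h4 : Complex.normSq (A 0 0) + Complex.normSq (A 0 1) + Complex.normSq (A 1 0)
      + Complex.normSq (A 1 1) = (Complex.normSq (mobNum A (ofCoords 0 1 one_pos)) + 1) /
        mobDenom A (ofCoords 0 1 one_pos) + mobDenom A (ofCoords 0 1 one_pos) := by
    rw [← h3, h2]; ring
  rw [h4]
  field_simp
  ring

/-! ### Short elements -/

/-- The square of the Frobenius norm of `g⁻¹ A g - 1`, where `g` moves the base point to `x`. -/
def disp (A : SL(2, ℂ)) (x : H3) : ℝ := sep x (mob A x) + 4 - 2 * (A 0 0 + A 1 1).re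

theorem mob_inv_mob (g : SL(2, ℂ)) (x : H3) : mob g⁻¹ (mob g x) = x :=
  (slPerm g).left_inv x

theorem mob_mob_inv (g : SL(2, ℂ)) (x : H3) : mob g (mob g⁻¹ x) = x :=
  (slPerm g).right_inv x

theorem trace_conj (g A : SL(2, ℂ)) :
    (g * A * g⁻¹) 0 0 + (g * A * g⁻¹) 1 1 = A 0 0 + A 1 1 := by
  obtain ⟨h1, h2, h3, h4⟩ := coe_inv_apply g
  have := det_eq g
  simp only [mul_apply00, mul_apply01, mul_apply10, mul_apply11, h1, h2, h3, h4]
  linear_combination (A 0 0 + A 1 1) * this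

theorem disp_conj (g A : SL(2, ℂ)) (x : H3) : disp (g * A * g⁻¹) (mob g x) = disp A x := by
  rw [disp, disp, trace_conj, mob_mul, mob_inv_mob, mob_mul, sep_mob]

theorem disp_conj' (g A : SL(2, ℂ)) (x : H3) : disp (g⁻¹ * A * g) x = disp A (mob g x) := by
  rw [← disp_conj g]
  congr 1
  group

/-- This is `sep_basePoint` together with ‖A − 1‖² = ‖A‖² + 2 − 2 Re tr A. Unlike `sep`, the
quantity sees the rotational part of A and the sign of the lift. -/
theorem disp_basePoint (A : SL(2, ℂ)) :
    disp A basePoint = frob ((A : Matrix (Fin 2) (Fin 2) ℂ) - 1) ^ 2 := by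
  have h := sep_basePoint A
  rw [frob_sq] at h
  rw [disp, frob_sq]
  have : sep basePoint (mob A basePoint) = Complex.normSq (A 0 0) + Complex.normSq (A 0 1)
    + Complex.normSq (A 1 0) + Complex.normSq (A 1 1) - 2 := by linarith
  rw [this]
  simp [Complex.normSq_apply]
  ring

theorem disp_nonneg (A : SL(2, ℂ)) (x : H3) : 0 ≤ disp A x := by
  obtain ⟨g, _, rfl⟩ := exists_mob_basePoint x
  rw [← disp_conj', disp_basePoint]
  positivity

theorem disp_eq_zero {A : SL(2, ℂ)} {x : H3} (h : disp A x = 0) : A = 1 := by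
  obtain ⟨g, _, rfl⟩ := exists_mob_basePoint x
  rw [← disp_conj', disp_basePoint] at h
  have h1 := frob_eq_zero (pow_eq_zero_iff two_ne_zero |>.1 h)
  have h2 : g⁻¹ * A * g = 1 := Subtype.ext (sub_eq_zero.1 h1)
  have h3 : A = g * (g⁻¹ * A * g) * g⁻¹ := by group
  rw [h3, h2]; group

theorem disp_one (x : H3) : disp 1 x = 0 := by
  simp [disp, mob_one, sep_self]; norm_num

theorem disp_neg_one (x : H3) : disp (-1) x = 8 := by
  simp [disp, mob_neg, mob_one, sep_self]; norm_num

theorem continuous_disp (A : SL(2, ℂ)) : Continuous (disp A) := by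
  have h := continuous_sep.comp (continuous_id.prodMk (continuous_mob A))
  have h' : Continuous fun x => sep x (mob A x) := h
  unfold disp
  fun_prop

/-- The commutator of two short elements is shorter than the first one. -/
theorem disp_commutator_le {A B : SL(2, ℂ)} {x : H3} (hA : disp A x ≤ 1 / 100)
    (hB : disp B x ≤ 1 / 100) : disp (A * B * A⁻¹ * B⁻¹) x ≤ 1 / 2 * disp A x := by
  obtain ⟨g, _, rfl⟩ := exists_mob_basePoint x
  have e : g⁻¹ * (A * B * A⁻¹ * B⁻¹) * g = (g⁻¹ * A * g) * (g⁻¹ * B * g) * (g⁻¹ * A * g)⁻¹ *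
    (g⁻¹ * B * g)⁻¹ := by group
  rw [← disp_conj', e]
  rw [← disp_conj'] at hA hB ⊢
  generalize g⁻¹ * A * g = A at *
  generalize g⁻¹ * B * g = B at *
  simp only [disp_basePoint] at *
  set a := frob ((A : Matrix (Fin 2) (Fin 2) ℂ) - 1) with ha
  set b := frob ((B : Matrix (Fin 2) (Fin 2) ℂ) - 1) with hb
  have ha0 : 0 ≤ a := frob_nonneg _
  have hb0 : 0 ≤ b := frob_nonneg _
  have ha1 : a ≤ 1 / 10 := by nlinarith
  have hb1 : b ≤ 1 / 10 := by nlinarith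
  have hone : frob 1 ≤ 3 / 2 := by
    have := frob_sq 1
    simp at this
    have h0 := frob_nonneg 1
    nlinarith
  have hA' : frob A ≤ 8 / 5 := by
    have := frob_add_le ((A : Matrix (Fin 2) (Fin 2) ℂ) - 1) 1
    rw [sub_add_cancel] at this
    linarith
  have hB' : frob B ≤ 8 / 5 := by
    have := frob_add_le ((B : Matrix (Fin 2) (Fin 2) ℂ) - 1) 1
    rw [sub_add_cancel] at this
    linarith
  -- In this identity the first factor is a commutator of A − 1 and B − 1, hence of size at most
  -- 2ab.
  have e2 : ((A * B * A⁻¹ * B⁻¹ : SL(2, ℂ)) : Matrix (Fin 2) (Fin 2) ℂ) - 1 =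
      (((A : Matrix (Fin 2) (Fin 2) ℂ) - 1) * ((B : Matrix (Fin 2) (Fin 2) ℂ) - 1)
        - ((B : Matrix (Fin 2) (Fin 2) ℂ) - 1) * ((A : Matrix (Fin 2) (Fin 2) ℂ) - 1)) *
      ((A⁻¹ : SL(2, ℂ)) * (B⁻¹ : SL(2, ℂ)) : Matrix (Fin 2) (Fin 2) ℂ) := by
    have h1 : ((A : Matrix (Fin 2) (Fin 2) ℂ) - 1) * ((B : Matrix (Fin 2) (Fin 2) ℂ) - 1)
        - ((B : Matrix (Fin 2) (Fin 2) ℂ) - 1) * ((A : Matrix (Fin 2) (Fin 2) ℂ) - 1) =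
        (A : Matrix (Fin 2) (Fin 2) ℂ) * B - (B : Matrix (Fin 2) (Fin 2) ℂ) * A := by noncomm_ring
    have h2 : (B : Matrix (Fin 2) (Fin 2) ℂ) * A *
        ((A⁻¹ : SL(2, ℂ)) * (B⁻¹ : SL(2, ℂ)) : Matrix (Fin 2) (Fin 2) ℂ) = 1 := by
      rw [← Matrix.SpecialLinearGroup.coe_mul, ← Matrix.SpecialLinearGroup.coe_mul,
        ← Matrix.SpecialLinearGroup.coe_mul]
      have : B * A * (A⁻¹ * B⁻¹) = 1 := by group
      rw [this, Matrix.SpecialLinearGroup.coe_one]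
    rw [h1, sub_mul, h2]
    simp only [Matrix.SpecialLinearGroup.coe_mul, mul_assoc]
  have h3 : frob (((A * B * A⁻¹ * B⁻¹ : SL(2, ℂ)) : Matrix (Fin 2) (Fin 2) ℂ) - 1) ≤
      (2 * (a * b)) * (8 / 5 * (8 / 5)) := by
    rw [e2]
    refine (frob_mul_le _ _).trans (mul_le_mul ?_ ?_ (frob_nonneg _) (by positivity))
    · refine (frob_sub_le _ _).trans ?_
      have := frob_mul_le ((A : Matrix (Fin 2) (Fin 2) ℂ) - 1) ((B : Matrix (Fin 2) (Fin 2) ℂ) - 1)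
      have := frob_mul_le ((B : Matrix (Fin 2) (Fin 2) ℂ) - 1) ((A : Matrix (Fin 2) (Fin 2) ℂ) - 1)
      rw [← ha, ← hb] at *
      linarith
    · refine (frob_mul_le _ _).trans ?_
      rw [frob_inv, frob_inv]
      exact mul_le_mul hA' hB' (frob_nonneg _) (by norm_num)
  -- With b ≤ 1/10 the bound 2ab (8/5)² is at most 0.512 a; the constant 7/10 suffices because its
  -- square is below 1/2.
  have h4 : frob (((A * B * A⁻¹ * B⁻¹ : SL(2, ℂ)) : Matrix (Fin 2) (Fin 2) ℂ) - 1) ≤ 7 / 10 * a := by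
    refine h3.trans ?_
    nlinarith [mul_nonneg ha0 hb0]
  have h5 := frob_nonneg (((A * B * A⁻¹ * B⁻¹ : SL(2, ℂ)) : Matrix (Fin 2) (Fin 2) ℂ) - 1)
  nlinarith

theorem disp_transSL (w : ℂ) (x : H3) : disp (transSL w) x = Complex.normSq w / height x ^ 2 := by
  have := height_pos x
  rw [disp, sep, height_transSL, horiz_transSL]
  simp only [sub_add_cancel_left, Complex.normSq_neg, sub_self, transSL_00, transSL_11]
  norm_num
  ring

/-- The first summand grows with the distance from the axis over 0 and ∞; the other two are the
value on the axis. -/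
theorem disp_diagSL (u : ℂˣ) (x : H3) : disp (diagSL u) x =
    Complex.normSq (u - (u⁻¹ : ℂˣ)) * Complex.normSq (horiz x) / height x ^ 2
      + Complex.normSq (u - 1) + Complex.normSq ((u⁻¹ : ℂˣ) - 1) := by
  have ht := height_pos x
  have hu : Complex.normSq u ≠ 0 := by simp
  rw [disp, sep, height_diagSL, horiz_diagSL]
  have h1 : horiz x - u ^ 2 * horiz x = -(u * ((u - (u⁻¹ : ℂˣ)) * horiz x)) := by
    have : (u : ℂ) * (u⁻¹ : ℂˣ) = 1 := by simp
    linear_combination -horiz x * this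
  have h2 : Complex.normSq ((u⁻¹ : ℂˣ) : ℂ) = (Complex.normSq u)⁻¹ := by simp
  have h3 : ∀ v : ℂ, Complex.normSq (v - 1) = Complex.normSq v + 1 - 2 * v.re := by
    intro v; simp [Complex.normSq_apply]; ring
  rw [h1, Complex.normSq_neg, map_mul, map_mul, h3, h3, h2, diagSL_00, diagSL_11, Complex.add_re]
  field_simp
  ring

/-! ### Commuting elements -/

/-- Two matrices commute exactly when their traceless parts are linearly dependent: the equations
are the minors of the triples (b, c, a − d). -/
theorem commute_iff {A B : SL(2, ℂ)} : Commute A B ↔ A 0 1 * B 1 0 = A 1 0 * B 0 1 ∧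
    A 0 1 * (B 0 0 - B 1 1) = (A 0 0 - A 1 1) * B 0 1 ∧
    A 1 0 * (B 0 0 - B 1 1) = (A 0 0 - A 1 1) * B 1 0 := by
  constructor
  · intro h
    have h : A * B = B * A := h
    have h00 := congrArg (fun M : SL(2, ℂ) => M 0 0) h
    have h01 := congrArg (fun M : SL(2, ℂ) => M 0 1) h
    have h10 := congrArg (fun M : SL(2, ℂ) => M 1 0) h
    simp only [mul_apply00, mul_apply01, mul_apply10] at h00 h01 h10
    refine ⟨?_, ?_, ?_⟩
    · linear_combination h00
    · linear_combination -h01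
    · linear_combination h10
  · rintro ⟨h1, h2, h3⟩
    change A * B = B * A
    apply SL2_ext
    · simp only [mul_apply00]; linear_combination h1
    · simp only [mul_apply01]; linear_combination -h2
    · simp only [mul_apply10]; linear_combination h3
    · simp only [mul_apply11]; linear_combination -h1

theorem central_of_scalar {B : SL(2, ℂ)} (h01 : B 0 1 = 0) (h10 : B 1 0 = 0)
    (h : B 0 0 - B 1 1 = 0) : B = 1 ∨ B = -1 := by
  have hd := det_eq B
  rw [h01, zero_mul, sub_zero, ← sub_eq_zero.1 h] at hd
  rcases mul_self_eq_one_iff.1 hd with h1 | h1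
  · left
    apply SL2_ext <;> simp [h01, h10, h1, ← sub_eq_zero.1 h]
  · right
    apply SL2_ext <;> simp [h01, h10, h1, ← sub_eq_zero.1 h]

/-- Commuting is transitive on non-central elements. -/
theorem commute_trans {A B C : SL(2, ℂ)} (hB : (B : PSL(2, ℂ)) ≠ 1) (h1 : Commute A B)
    (h2 : Commute B C) : Commute A C := by
  rw [commute_iff] at *
  obtain ⟨a1, a2, a3⟩ := h1
  obtain ⟨c1, c2, c3⟩ := h2
  have hB' : ¬ (B 0 1 = 0 ∧ B 1 0 = 0 ∧ B 0 0 - B 1 1 = 0) := fun h =>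
    hB (mk_eq_one.2 (central_of_scalar h.1 h.2.1 h.2.2))
  generalize A 0 0 - A 1 1 = a at *
  generalize B 0 0 - B 1 1 = b at *
  generalize C 0 0 - C 1 1 = c at *
  generalize A 0 1 = a' at *
  generalize B 0 1 = b' at *
  generalize C 0 1 = c' at *
  generalize A 1 0 = a'' at *
  generalize B 1 0 = b'' at *
  generalize C 1 0 = c'' at *
  -- The traceless part of B is not zero, so one of its entries is nonzero and can be cancelled.
  by_cases h1 : b' = 0
  · by_cases h2 : b'' = 0
    · have h3 : b ≠ 0 := fun h => hB' ⟨h1, h2, h⟩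
      subst h1 h2
      simp only [mul_zero, zero_mul, mul_eq_zero, zero_eq_mul] at *
      simp_all
    · refine ⟨?_, ?_, ?_⟩ <;> apply mul_left_cancel₀ h2 <;> grind
  · refine ⟨?_, ?_, ?_⟩ <;> apply mul_left_cancel₀ h1 <;> grind

theorem commute_conj {g A B : SL(2, ℂ)} : Commute (g * A * g⁻¹) (g * B * g⁻¹) ↔ Commute A B :=
  SemiconjBy.conj_iff

/-! ### Normal forms -/

/-- The matrix g moves ∞ to a fixed point x of A, a root of the quadratic fixed point equation; if c
= 0, then ∞ is already fixed. -/
theorem exists_upper (A : SL(2, ℂ)) : ∃ g : SL(2, ℂ), (g⁻¹ * A * g) 1 0 = 0 := by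
  by_cases hc : A 1 0 = 0
  · exact ⟨1, by simpa using hc⟩
  obtain ⟨s, hs⟩ := IsAlgClosed.exists_pow_nat_eq
    ((A 0 0 - A 1 1) ^ 2 + 4 * A 0 1 * A 1 0) two_pos
  set x : ℂ := (A 0 0 - A 1 1 + s) / (2 * A 1 0) with hx
  have hroot : A 1 0 * x ^ 2 + (A 1 1 - A 0 0) * x - A 0 1 = 0 := by
    rw [hx]
    field_simp
    linear_combination hs
  let g : SL(2, ℂ) := ⟨!![x, -1; 1, 0], by simp [Matrix.det_fin_two]⟩
  have g00 : g 0 0 = x := rfl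
  have g01 : g 0 1 = -1 := rfl
  have g10 : g 1 0 = 1 := rfl
  have g11 : g 1 1 = 0 := rfl
  obtain ⟨h1, h2, h3, h4⟩ := coe_inv_apply g
  refine ⟨g, ?_⟩
  simp only [mul_apply10, mul_apply11, h3, h4, g00, g10]
  linear_combination hroot

/-- Once a fixed point is at ∞, equal eigenvalues leave a translation up to sign. Distinct
eigenvalues give a second fixed point b / (d − a), which is moved to 0. -/
theorem exists_normal_form {A : SL(2, ℂ)} (hA : (A : PSL(2, ℂ)) ≠ 1) :
    ∃ g : SL(2, ℂ), (∃ w : ℂ, w ≠ 0 ∧ (g⁻¹ * A * g = transSL w ∨ g⁻¹ * A * g = -transSL w)) ∨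
      ∃ u : ℂˣ, (u : ℂ) ≠ (u⁻¹ : ℂˣ) ∧ g⁻¹ * A * g = diagSL u := by
  obtain ⟨g, hg⟩ := exists_upper A
  have hne : ((g⁻¹ * A * g : SL(2, ℂ)) : PSL(2, ℂ)) ≠ 1 := by
    intro h
    apply hA
    have e : A = g * (g⁻¹ * A * g) * g⁻¹ := by group
    have h' := congrArg (fun x : PSL(2, ℂ) => (g : PSL(2, ℂ)) * x * (g : PSL(2, ℂ))⁻¹) h
    rw [e]
    simpa using h'
  have e : ∀ k, (g * k)⁻¹ * A * (g * k) = k⁻¹ * (g⁻¹ * A * g) * k := by intro k; group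
  generalize hB : g⁻¹ * A * g = B at *
  have h1 := mul_eq_one_of_upper hg
  have hB0 : B 0 0 ≠ 0 := left_ne_zero_of_mul_eq_one h1
  by_cases hd : B 0 0 = B 1 1
  · refine ⟨g, Or.inl ?_⟩
    rw [hB]
    have h2 := h1
    rw [← hd] at h2
    have h01 : B 0 1 ≠ 0 := fun h => hne (mk_eq_one.2 (central_of_scalar h hg (sub_eq_zero.2 hd)))
    rcases mul_self_eq_one_iff.1 h2 with h3 | h3
    · exact ⟨B 0 1, h01, Or.inl (by apply SL2_ext <;> simp [hg, h3, ← hd])⟩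
    · exact ⟨-B 0 1, by simpa using h01, Or.inr (by apply SL2_ext <;> simp [hg, h3, ← hd])⟩
  · refine ⟨g * transSL (B 0 1 / (B 1 1 - B 0 0)), Or.inr ⟨Units.mk0 _ hB0, ?_, ?_⟩⟩
    · simp only [Units.val_mk0, Units.val_inv_eq_inv_val]
      rwa [← eq_inv_of_mul_eq_one_right h1]
    · have hd' : B 1 1 - B 0 0 ≠ 0 := sub_ne_zero.2 (Ne.symm hd)
      rw [e, mul_assoc, inv_mul_eq_iff_eq_mul]
      have h4 := eq_inv_of_mul_eq_one_right h1
      apply SL2_ext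
      · simp [mul_apply00]
      · simp only [mul_apply01, transSL_00, transSL_01, transSL_11, diagSL_01, diagSL_11,
          Units.val_inv_eq_inv_val, Units.val_mk0, ← h4]
        field_simp
        ring
      · simp [mul_apply10, hg]
      · simp [mul_apply11, hg, h4]

/-! ### Hyperbolic balls -/

/-- With o the base point, the condition reads ‖o − x‖² ≤ R t, which is closed and bounded on t ≥ 0.
It excludes t = 0, where it would force x = o, a point of height 1. -/
theorem isCompact_ball_basePoint (R : ℝ) : IsCompact {p : H3 | sep basePoint p ≤ R} := by
  have hiff : ∀ p : H3, sep basePoint p ≤ R ↔ ‖(basePoint : E3) - p‖ ^ 2 ≤ R * (p : E3) 2 := by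
    intro p
    rw [sep_eq, div_le_iff₀ (mul_pos (height_pos _) (height_pos _))]
    have h1 : height basePoint = 1 := by simp [basePoint]
    rw [h1, one_mul]; rfl
  rw [Topology.IsEmbedding.subtypeVal.isCompact_iff]
  have himg : (Subtype.val '' {p : H3 | sep basePoint p ≤ R} : Set E3) =
      {x : E3 | ‖(basePoint : E3) - x‖ ^ 2 ≤ R * x 2 ∧ 0 ≤ x 2} := by
    ext x
    constructor
    · rintro ⟨p, hp, rfl⟩
      exact ⟨(hiff p).1 hp, p.2.le⟩
    · rintro ⟨hx, h0⟩
      have hpos : 0 < x 2 := by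
        refine lt_of_le_of_ne h0 fun h => ?_
        rw [← h, mul_zero] at hx
        have h1 : ‖(basePoint : E3) - x‖ = 0 := by
          have := sq_nonneg ‖(basePoint : E3) - x‖
          exact pow_eq_zero_iff two_ne_zero |>.1 (le_antisymm hx this)
        rw [norm_eq_zero, sub_eq_zero] at h1
        have h2 : (basePoint : E3) 2 = 1 := by simp [basePoint, ofCoords]
        rw [h1, ← h] at h2
        exact zero_ne_one h2
      exact ⟨⟨x, hpos⟩, (hiff ⟨x, hpos⟩).2 hx, rfl⟩
  rw [himg]
  refine Metric.isCompact_of_isClosed_isBounded ?_ ?_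
  · have h1 : Continuous fun x : E3 => ‖(basePoint : E3) - x‖ ^ 2 := by fun_prop
    have h2 : Continuous fun x : E3 => R * x 2 := by fun_prop
    have h3 : Continuous fun x : E3 => x 2 := by fun_prop
    exact (isClosed_le h1 h2).inter (isClosed_le continuous_const h3)
  · rw [Metric.isBounded_iff_subset_closedBall (basePoint : E3)]
    refine ⟨|R| + 1 + |R|, fun x hx => ?_⟩
    rw [mem_closedBall_iff_norm, norm_sub_rev]
    have h1 := hx.1
    set s := ‖(basePoint : E3) - x‖ with hs
    have h2 : x 2 ≤ 1 + s := by
      have h3 := norm_le_norm_add_norm_sub (basePoint : E3) x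
      have h4 : ‖x 2 - (basePoint : E3) 2‖ ≤ ‖x - (basePoint : E3)‖ :=
        PiLp.norm_apply_le (x - (basePoint : E3)) 2
      have h5 : (basePoint : E3) 2 = 1 := by simp [basePoint, ofCoords]
      rw [h5, norm_sub_rev x, Real.norm_eq_abs] at h4
      linarith [le_abs_self (x 2 - 1)]
    have h3 : s ^ 2 ≤ |R| * (1 + s) := by
      refine h1.trans ((mul_le_mul_of_nonneg_right (le_abs_self R) hx.2).trans ?_)
      exact mul_le_mul_of_nonneg_left h2 (abs_nonneg R)
    by_contra hcon
    push Not at hcon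
    have := abs_nonneg R
    nlinarith

theorem isCompact_ball (x : H3) (R : ℝ) : IsCompact {p : H3 | sep x p ≤ R} := by
  obtain ⟨g, _, rfl⟩ := exists_mob_basePoint x
  have : {p : H3 | sep (mob g basePoint) p ≤ R} = mob g '' {p | sep basePoint p ≤ R} := by
    ext p
    constructor
    · intro hp
      refine ⟨mob g⁻¹ p, ?_, mob_mob_inv g p⟩
      change sep _ _ ≤ R
      rw [← sep_mob g, mob_mob_inv]; exact hp
    · rintro ⟨q, hq, rfl⟩
      change sep _ _ ≤ R
      rw [sep_mob]; exact hq
  rw [this]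
  exact (isCompact_ball_basePoint R).image (continuous_mob g)

theorem isCompact_box {a : ℝ} (ha : 0 < a) (b R : ℝ) :
    IsCompact {p : H3 | a ≤ height p ∧ height p ≤ b ∧ Complex.normSq (horiz p) ≤ R} := by
  refine (isCompact_ball basePoint ((|R| + (b + 1) ^ 2) / a)).of_isClosed_subset ?_ ?_
  · have h1 := continuous_height
    have h2 : Continuous fun p => Complex.normSq (horiz p) :=
      Complex.continuous_normSq.comp continuous_horiz
    exact (isClosed_le continuous_const h1).inter
      ((isClosed_le h1 continuous_const).inter (isClosed_le h2 continuous_const))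
  · rintro p ⟨h1, h2, h3⟩
    have hp := height_pos p
    change sep _ _ ≤ _
    simp only [sep, basePoint, horiz_ofCoords, height_ofCoords, zero_sub,
      Complex.normSq_neg, one_mul]
    refine div_le_div₀ (by positivity) ?_ ha h1
    have : (1 - height p) ^ 2 ≤ (b + 1) ^ 2 := by nlinarith
    linarith [le_abs_self R]

/-- A substitute for the triangle inequality at small scale. With q moved to the base point, r ≤ 1/2
confines both heights to [1/2, 2], where `sep` is comparable with the squared Euclidean distance. -/
theorem sep_le_of_sep_le {p q s : H3} {r : ℝ} (hr : r ≤ 1 / 2) (h1 : sep q p ≤ r)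
    (h2 : sep q s ≤ r) : sep p s ≤ 8 * r := by
  obtain ⟨g, _, rfl⟩ := exists_mob_basePoint q
  have e1 : sep (mob g basePoint) p = sep basePoint (mob g⁻¹ p) := by
    rw [← sep_mob g basePoint, mob_mob_inv]
  have e2 : sep (mob g basePoint) s = sep basePoint (mob g⁻¹ s) := by
    rw [← sep_mob g basePoint, mob_mob_inv]
  rw [e1] at h1
  rw [e2] at h2
  rw [← sep_mob g⁻¹ p s]
  generalize mob g⁻¹ p = p at *
  generalize mob g⁻¹ s = s at *
  have key : ∀ x : H3, sep basePoint x ≤ r →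
      ‖(basePoint : E3) - x‖ ^ 2 ≤ r * height x ∧ 1 / 2 ≤ height x ∧ height x ≤ 2 := by
    intro x hx
    have hpos := height_pos x
    have h3 : ‖(basePoint : E3) - x‖ ^ 2 ≤ r * height x := by
      rw [sep_eq, div_le_iff₀ (mul_pos (height_pos _) (height_pos _))] at hx
      simpa [basePoint] using hx
    have h4 := h3
    rw [norm_sub_sq] at h4
    have h5 := Complex.normSq_nonneg (horiz basePoint - horiz x)
    simp only [basePoint, height_ofCoords] at h4 h5
    have h6 : (1 - height x) ^ 2 ≤ 1 / 2 * height x := by nlinarith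
    exact ⟨h3, by nlinarith, by nlinarith⟩
  obtain ⟨p1, p2, p3⟩ := key p h1
  obtain ⟨s1, s2, s3⟩ := key s h2
  have hr0 : 0 ≤ r := (sep_nonneg _ _).trans h1
  rw [sep_eq, div_le_iff₀ (mul_pos (height_pos _) (height_pos _))]
  have h3 : ‖(p : E3) - s‖ ≤ ‖(basePoint : E3) - p‖ + ‖(basePoint : E3) - s‖ := by
    have := norm_sub_le_norm_sub_add_norm_sub (p : E3) (basePoint : E3) (s : E3)
    rwa [norm_sub_rev (p : E3) (basePoint : E3)] at this
  have h4 : ‖(p : E3) - s‖ ^ 2 ≤ 2 * (‖(basePoint : E3) - p‖ ^ 2 + ‖(basePoint : E3) - s‖ ^ 2) := by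
    have := norm_nonneg ((p : E3) - s)
    nlinarith [sq_nonneg (‖(basePoint : E3) - p‖ - ‖(basePoint : E3) - s‖)]
  have h5 : height p + height s ≤ 4 * (height p * height s) := by nlinarith
  nlinarith

/-- Through `sep_basePoint` this is submultiplicativity of the Frobenius norm. It serves as a
triangle inequality at large scale. -/
theorem sep_add_two_le (p q s : H3) : sep p s + 2 ≤ (sep p q + 2) * (sep q s + 2) := by
  obtain ⟨k, _, rfl⟩ := exists_mob_basePoint p
  have e : ∀ y, sep (mob k basePoint) y = sep basePoint (mob k⁻¹ y) := fun y => by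
    rw [← sep_mob k basePoint, mob_mob_inv]
  rw [e q, e s, ← sep_mob k⁻¹ q s]
  generalize mob k⁻¹ s = s
  obtain ⟨g, _, hg⟩ := exists_mob_basePoint (mob k⁻¹ q)
  rw [← hg]
  obtain ⟨h, _, rfl⟩ := exists_mob_basePoint s
  have e2 : sep (mob g basePoint) (mob h basePoint) = sep basePoint (mob (g⁻¹ * h) basePoint) := by
    rw [← sep_mob g basePoint, mob_mul, mob_mob_inv]
  rw [e2, sep_basePoint, sep_basePoint, sep_basePoint, ← mul_pow]
  have h1 := frob_mul_le g (g⁻¹ * h : SL(2, ℂ))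
  rw [← Matrix.SpecialLinearGroup.coe_mul, mul_inv_cancel_left] at h1
  exact pow_le_pow_left₀ (frob_nonneg _) h1 2

/-! ### Discreteness -/

theorem finite_mk_preimage {S : Set PSL(2, ℂ)} (hS : S.Finite) :
    {A : SL(2, ℂ) | (A : PSL(2, ℂ)) ∈ S}.Finite := by
  refine hS.preimage' fun h _ => ?_
  obtain ⟨B, rfl⟩ := exists_mk h
  refine (Set.toFinite {B, -B}).subset ?_
  intro A hA
  exact mk_eq_mk.1 hA

section

variable {Γ : Subgroup PSL(2, ℂ)}

theorem finite_smul_mem (hΓ : ProperlyDiscontinuousSMul Γ H3) {K L : Set H3} (hK : IsCompact K)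
    (hL : IsCompact L) : {h : PSL(2, ℂ) | h ∈ Γ ∧ ∃ x ∈ K, h • x ∈ L}.Finite := by
  have h := (hΓ.finite_disjoint_inter_image hK hL).image (fun γ : Γ => (γ : PSL(2, ℂ)))
  refine h.subset ?_
  rintro γ ⟨hγ, x, hx, hxL⟩
  refine ⟨⟨γ, hγ⟩, ?_, rfl⟩
  exact ⟨γ • x, ⟨x, hx, rfl⟩, hxL⟩

theorem finite_mob_mem (hΓ : ProperlyDiscontinuousSMul Γ H3) {K L : Set H3} (hK : IsCompact K)
    (hL : IsCompact L) : {A : SL(2, ℂ) | (A : PSL(2, ℂ)) ∈ Γ ∧ ∃ x ∈ K, mob A x ∈ L}.Finite :=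
  finite_mk_preimage (finite_smul_mem hΓ hK hL)

/-- At the base point, ‖A‖² ≤ 2 (‖A − 1‖² + ‖1‖²) with ‖1‖² = 2. -/
theorem sep_le_of_disp (A : SL(2, ℂ)) (x : H3) {r : ℝ} (h : disp A x ≤ r) :
    sep x (mob A x) ≤ 2 * (r + 2) := by
  obtain ⟨g, _, rfl⟩ := exists_mob_basePoint x
  rw [← disp_conj', disp_basePoint] at h
  have e : sep (mob g basePoint) (mob A (mob g basePoint)) =
      sep basePoint (mob (g⁻¹ * A * g) basePoint) := by
    rw [← sep_mob g basePoint, mob_mul, mob_mul, mob_mob_inv]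
  rw [e]
  generalize g⁻¹ * A * g = A at *
  have h1 := sep_basePoint A
  have h2 := frob_add_le ((A : Matrix (Fin 2) (Fin 2) ℂ) - 1) 1
  rw [sub_add_cancel] at h2
  have h3 : frob 1 ^ 2 = 2 := by rw [frob_sq]; simp; norm_num
  have h4 := frob_nonneg (A : Matrix (Fin 2) (Fin 2) ℂ)
  have h5 : frob A ^ 2 ≤ (frob ((A : Matrix (Fin 2) (Fin 2) ℂ) - 1) + frob 1) ^ 2 :=
    pow_le_pow_left₀ h4 h2 2
  nlinarith [sq_nonneg (frob ((A : Matrix (Fin 2) (Fin 2) ℂ) - 1) - frob 1)]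

/-- Bounded displacement keeps the image of a point of K in a fixed ball, and proper discontinuity
applies. The compactness arguments below draw their finiteness from here. -/
theorem finite_disp_le (hΓ : ProperlyDiscontinuousSMul Γ H3) {K : Set H3} (hK : IsCompact K)
    (r : ℝ) : {A : SL(2, ℂ) | (A : PSL(2, ℂ)) ∈ Γ ∧ ∃ x ∈ K, disp A x ≤ r}.Finite := by
  have hc : ContinuousOn (fun x => sep basePoint x) K :=
    (continuous_sep.comp (continuous_const.prodMk continuous_id)).continuousOn
  obtain ⟨C, hC⟩ := hK.exists_bound_of_continuousOn hc
  refine (finite_mob_mem hΓ hK (isCompact_ball basePoint ((C + 2) * (2 * (r + 2) + 2)))).subset ?_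
  rintro A ⟨hA, x, hx, hd⟩
  refine ⟨hA, x, hx, ?_⟩
  have h1 := sep_add_two_le basePoint x (mob A x)
  have h2 := sep_le_of_disp A x hd
  have h3 := (Real.norm_eq_abs _ ▸ hC x hx : |sep basePoint x| ≤ C)
  have h4 := sep_nonneg x (mob A x)
  have h5 := sep_nonneg basePoint x
  rw [abs_of_nonneg h5] at h3
  change sep basePoint (mob A x) ≤ _
  have : (sep basePoint x + 2) * (sep x (mob A x) + 2) ≤ (C + 2) * (2 * (r + 2) + 2) :=
    mul_le_mul (by linarith) (by linarith) (by linarith) (by linarith)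
  linarith

/-! ### Compactness of the thick part -/

/-- The open hyperbolic ball of radius `arccosh (1 + r / 2)`. -/
def hball (x : H3) (r : ℝ) : Set H3 := {p | sep x p < r}

theorem isOpen_hball (x : H3) (r : ℝ) : IsOpen (hball x r) :=
  isOpen_lt (continuous_sep.comp (continuous_const.prodMk continuous_id)) continuous_const

theorem hypVolume_hball (x : H3) (r : ℝ) : hypVolume (hball x r) = hypVolume (hball basePoint r) := by
  obtain ⟨g, _, rfl⟩ := exists_mob_basePoint x
  have : hball (mob g basePoint) r = mob g '' hball basePoint r := by
    ext p
    constructor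
    · intro hp
      refine ⟨mob g⁻¹ p, ?_, mob_mob_inv g p⟩
      change sep _ _ < r
      rw [← sep_mob g, mob_mob_inv]; exact hp
    · rintro ⟨q, hq, rfl⟩
      change sep _ _ < r
      rw [sep_mob]; exact hq
  rw [this, hypVolume_image _ (isOpen_hball _ _).measurableSet]

theorem hypVolume_hball_pos {r : ℝ} (hr : 0 < r) : 0 < hypVolume (hball basePoint r) := by
  have hopen := isOpen_hball basePoint r
  have hm : MeasurableSet (upperHalfSpace : Set E3) := upperHalfSpace.isOpen.measurableSet
  have hemb : MeasurableEmbedding (Subtype.val : H3 → E3) := MeasurableEmbedding.subtype_coe hm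
  rw [hypVolume_apply hopen.measurableSet]
  have hsupp : (Subtype.val '' hball basePoint r : Set E3) ⊆
      Function.support fun x : E3 => ENNReal.ofReal (1 / (x 2) ^ 3) := by
    rintro _ ⟨p, _, rfl⟩
    have := height_pos p
    change ENNReal.ofReal (1 / height p ^ 3) ≠ 0
    simpa using by positivity
  rw [setLIntegral_pos_iff (by fun_prop), inter_eq_right.2 hsupp]
  refine (upperHalfSpace.isOpen.isOpenMap_subtype_val _ hopen).measure_pos _ ?_
  exact ⟨_, basePoint, by simpa [hball, sep_self] using hr, rfl⟩

theorem countable_of_properlyDiscontinuous (hΓ : ProperlyDiscontinuousSMul Γ H3) :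
    Countable Γ := by
  have h : (⋃ n : ℕ, {h : PSL(2, ℂ) | h ∈ Γ ∧ ∃ x ∈ ({basePoint} : Set H3),
      h • x ∈ {p : H3 | sep basePoint p ≤ n}}).Countable :=
    countable_iUnion fun n =>
      (finite_smul_mem hΓ isCompact_singleton (isCompact_ball basePoint n)).countable
  have h2 : (Γ : Set PSL(2, ℂ)).Countable := by
    refine h.mono fun γ hγ => ?_
    obtain ⟨n, hn⟩ := exists_nat_ge (sep basePoint (γ • basePoint))
    exact mem_iUnion.2 ⟨n, hγ, basePoint, rfl, hn⟩
  exact h2.to_subtype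

/-- A set is covered modulo `Γ` by a compact set. -/
def RelCompact (Γ : Subgroup PSL(2, ℂ)) (X : Set H3) : Prop :=
  ∃ K : Set H3, IsCompact K ∧ ∀ x ∈ X, ∃ γ ∈ Γ, γ • x ∈ K

/-- A packing argument. If no compact set suffices, arbitrarily many points of the set have orbits
that stay more than 8r apart. The balls of size r about them embed disjointly in the quotient and
all have the same volume, which contradicts finite volume. -/
theorem relCompact_thick (hΓ : IsCusped Γ) {η : ℝ} (hη : 0 < η) :
    RelCompact Γ {x | ∀ γ ∈ Γ, γ ≠ 1 → η ≤ sep x (γ • x)} := by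
  have hpd := hΓ.properlyDiscontinuous
  have := countable_of_properlyDiscontinuous hpd
  have := smulInvariantMeasure_hypVolume Γ
  obtain ⟨F, hF, hFfin⟩ := hΓ.finiteVolume
  -- The comparison `sep_le_of_sep_le` needs r ≤ 1/2, and 8r ≤ η makes each single ball embed in the
  -- quotient.
  set r : ℝ := min η 4 / 8 with hr
  have hr0 : 0 < r := by positivity
  have hr1 : r ≤ 1 / 2 := by rw [hr]; linarith [min_le_right η 4]
  have hrη : 8 * r ≤ η := by rw [hr]; linarith [min_le_left η 4]
  set T : Set H3 := {x | ∀ γ ∈ Γ, γ ≠ 1 → η ≤ sep x (γ • x)} with hT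
  by_contra hcon
  have hstep : ∀ S : Finset H3, ∃ x ∈ T, ∀ γ ∈ Γ, ∀ s ∈ S, 8 * r < sep s (γ • x) := by
    intro S
    by_contra h
    push Not at h
    refine hcon ⟨⋃ s ∈ S, {p | sep s p ≤ 8 * r}, S.isCompact_biUnion fun s _ => isCompact_ball s _,
      fun x hx => ?_⟩
    obtain ⟨γ, hγ, s, hs, hle⟩ := h x hx
    exact ⟨γ, hγ, mem_iUnion₂.2 ⟨s, hs, hle⟩⟩
  have hseq : ∀ n : ℕ, ∃ S : Finset H3, S.card = n ∧ (∀ s ∈ S, s ∈ T) ∧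
      ∀ s ∈ S, ∀ t ∈ S, s ≠ t → ∀ γ ∈ Γ, 8 * r < sep s (γ • t) := by
    intro n
    induction n with
    | zero => exact ⟨∅, by simp⟩
    | succ n ih =>
      classical
      obtain ⟨S, hcard, hST, hS⟩ := ih
      obtain ⟨x, hx, hxS⟩ := hstep S
      have hxn : x ∉ S := fun h => by
        have := hxS 1 Γ.one_mem x h
        rw [one_smul, sep_self] at this
        linarith
      refine ⟨insert x S, by rw [Finset.card_insert_of_notMem hxn, hcard], ?_, ?_⟩
      · intro s hs
        rcases Finset.mem_insert.1 hs with rfl | hs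
        exacts [hx, hST s hs]
      · intro s hs t ht hst γ hγ
        rcases Finset.mem_insert.1 hs with hs' | hs'
        · rcases Finset.mem_insert.1 ht with ht' | ht'
          · exact absurd (hs'.trans ht'.symm) hst
          · have := hxS γ⁻¹ (Γ.inv_mem hγ) t ht'
            rwa [← sep_smul γ, smul_inv_smul, sep_comm, ← hs'] at this
        · rcases Finset.mem_insert.1 ht with ht' | ht'
          · rw [ht']; exact hxS γ hγ s hs'
          · exact hS s hs' t ht' hst γ hγ
  have hbound : ∀ n : ℕ, n * hypVolume (hball basePoint r) ≤ hypVolume F := by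
    intro n
    obtain ⟨S, hcard, hST, hS⟩ := hseq n
    set U : Set H3 := ⋃ s ∈ S, hball s r with hU
    have hUm : MeasurableSet U :=
      S.measurableSet_biUnion fun s _ => (isOpen_hball s r).measurableSet
    have hmeet : ∀ s ∈ S, ∀ t ∈ S, ∀ γ ∈ Γ, ∀ q, q ∈ hball s r → γ • q ∈ hball t r →
        s = t ∧ γ = 1 := by
      intro s hs t ht γ hγ q hq hq'
      have h1 : sep t (γ • s) ≤ 8 * r := by
        refine sep_le_of_sep_le (q := γ • q) hr1 ?_ ?_
        · rw [sep_comm]; exact le_of_lt hq'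
        · rw [sep_smul, sep_comm]; exact le_of_lt hq
      have hst : s = t := by
        by_contra hne
        exact absurd (hS t ht s hs (Ne.symm hne) γ hγ) (not_lt.2 h1)
      subst hst
      refine ⟨rfl, ?_⟩
      by_contra hne
      -- The hypothesis on s is only η ≤ sep s (γ • s), so a strict inequality is needed; it holds
      -- because both points of the open ball lie in a smaller ball of size ρ < r.
      have h2 : sep s (γ • s) < 8 * r := by
        obtain ⟨ρ, hρ1, hρ2⟩ : ∃ ρ < r, sep s (γ • q) ≤ ρ ∧ sep s q ≤ ρ :=
          ⟨max (sep s (γ • q)) (sep s q), max_lt hq' hq, le_max_left _ _, le_max_right _ _⟩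
        have : sep s (γ • s) ≤ 8 * ρ := by
          refine sep_le_of_sep_le (q := γ • q) (by linarith) ?_ ?_
          · rw [sep_comm]; exact hρ2.1
          · rw [sep_smul, sep_comm]; exact hρ2.2
        linarith
      linarith [hST s hs γ hγ hne]
    have hvol : hypVolume U = n * hypVolume (hball basePoint r) := by
      rw [hU, measure_biUnion_finset _ fun s _ => (isOpen_hball s r).measurableSet]
      · rw [Finset.sum_congr rfl fun s _ => hypVolume_hball s r, Finset.sum_const, hcard,
          nsmul_eq_mul]
      · intro s hs t ht hst
        refine Set.disjoint_left.2 fun q hq hq' => hst ?_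
        exact (hmeet s hs t ht 1 Γ.one_mem q hq (by rwa [one_smul])).1
    rw [← hvol]
    refine hF.measure_le_of_pairwise_disjoint hUm.nullMeasurableSet ?_
    intro g g' hgg'
    refine Disjoint.aedisjoint (Set.disjoint_left.2 ?_)
    rintro p ⟨⟨q, hq, hqp⟩, -⟩ ⟨⟨q', hq', hqp'⟩, -⟩
    obtain ⟨s, hs, hqs⟩ := mem_iUnion₂.1 hq
    obtain ⟨t, ht, hqt⟩ := mem_iUnion₂.1 hq'
    have e : ((g'⁻¹ * g : Γ) : PSL(2, ℂ)) • q = q' := by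
      have h1 : (g : PSL(2, ℂ)) • q = p := hqp
      have h2 : (g' : PSL(2, ℂ)) • q' = p := hqp'
      rw [Subgroup.coe_mul, Subgroup.coe_inv, mul_smul, h1, ← h2, inv_smul_smul]
    have := (hmeet s hs t ht _ (g'⁻¹ * g).2 q hqs (by rw [e]; exact hqt)).2
    exact hgg' (inv_mul_eq_one.1 (Subtype.ext this)).symm
  have hpos := hypVolume_hball_pos hr0
  obtain ⟨n, hn⟩ := ENNReal.exists_nat_mul_gt hpos.ne' hFfin.ne
  exact absurd (hbound n) (not_le.2 hn)

end

/-! ### Powers close to the identity -/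

theorem continuous_coe_SL : Continuous fun A : SL(2, ℂ) => (A : Matrix (Fin 2) (Fin 2) ℂ) :=
  continuous_induced_dom

theorem isCompact_frob_le (R : ℝ) : IsCompact {A : SL(2, ℂ) | frob A ≤ R} := by
  have hemb : Topology.IsEmbedding fun A : SL(2, ℂ) => (A : Matrix (Fin 2) (Fin 2) ℂ) :=
    Topology.IsEmbedding.subtypeVal
  rw [hemb.isCompact_iff]
  have himg : (fun A : SL(2, ℂ) => (A : Matrix (Fin 2) (Fin 2) ℂ)) '' {A | frob A ≤ R} =
      {M | M.det = 1 ∧ frob M ≤ R} := by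
    ext M
    constructor
    · rintro ⟨A, hA, rfl⟩
      exact ⟨A.2, hA⟩
    · rintro ⟨h1, h2⟩
      exact ⟨⟨M, h1⟩, h2, rfl⟩
  rw [himg]
  have hbox : IsCompact (Set.pi univ fun _ : Fin 2 => Set.pi univ fun _ : Fin 2 =>
      Metric.closedBall (0 : ℂ) R) :=
    isCompact_univ_pi fun _ => isCompact_univ_pi fun _ => isCompact_closedBall _ _
  refine hbox.of_isClosed_subset ?_ ?_
  · refine (isClosed_eq ?_ continuous_const).inter (isClosed_le continuous_frob continuous_const)
    exact continuous_id.matrix_det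
  · rintro M ⟨-, hM⟩ i - j -
    rw [mem_closedBall_zero_iff]
    refine le_trans ?_ hM
    have h := frob_sq M
    simp only [Complex.normSq_eq_norm_sq] at h
    refine (sq_le_sq₀ (norm_nonneg _) (frob_nonneg M)).1 ?_
    rw [h]
    fin_cases i <;> fin_cases j <;> simp only [Fin.zero_eta, Fin.mk_one, Fin.isValue] <;> nlinarith [sq_nonneg ‖M 0 0‖, sq_nonneg ‖M 0 1‖, sq_nonneg ‖M 1 0‖, sq_nonneg ‖M 1 1‖]

theorem continuous_disp_basePoint : Continuous fun A : SL(2, ℂ) => disp A basePoint := by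
  simp only [disp_basePoint]
  exact (continuous_frob.comp (continuous_coe_SL.sub continuous_const)).pow 2

theorem mob_pow_fix {A : SL(2, ℂ)} {x : H3} (h : mob A x = x) (n : ℕ) : mob (A ^ n) x = x := by
  induction n with
  | zero => rw [pow_zero, mob_one]
  | succ n ih => rw [pow_succ, mob_mul, h, ih]

theorem eq_of_sep_eq_zero {p q : H3} (h : sep p q = 0) : p = q := by
  rw [sep_eq, div_eq_zero_iff] at h
  rcases h with h | h
  · exact Subtype.ext (sub_eq_zero.1 (norm_eq_zero.1 (pow_eq_zero_iff two_ne_zero |>.1 h)))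
  · exact absurd h (mul_pos (height_pos _) (height_pos _)).ne'

/-- The stabilizer of the base point lies in a compact set, so the powers of A accumulate, and the
quotient of two powers close to each other is a power close to 1. -/
theorem exists_pow_disp_lt_of_fix {A : SL(2, ℂ)} (hA : mob A basePoint = basePoint) {ε : ℝ}
    (hε : 0 < ε) : ∃ m : ℕ, 1 ≤ m ∧ disp (A ^ m) basePoint < ε := by
  have hmem : ∀ n : ℕ, A ^ n ∈ {A : SL(2, ℂ) | frob A ≤ 2} := by
    intro n
    have h := sep_basePoint (A ^ n)
    rw [mob_pow_fix hA, sep_self] at h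
    have := frob_nonneg (A ^ n : SL(2, ℂ))
    change frob _ ≤ 2
    nlinarith
  obtain ⟨B, -, hB⟩ := (isCompact_frob_le 2).exists_mapClusterPt (f := Filter.atTop)
    (u := fun n : ℕ => A ^ n) (by
      rw [Filter.le_principal_iff]; exact Filter.mem_map.2 (Filter.univ_mem' hmem))
  have hcont : ContinuousAt (fun x : SL(2, ℂ) × SL(2, ℂ) => disp (x.1⁻¹ * x.2) basePoint) (B, B) := by
    have := continuous_disp_basePoint.comp
      ((continuous_fst.inv : Continuous fun x : SL(2, ℂ) × SL(2, ℂ) => x.1⁻¹).mul continuous_snd)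
    exact this.continuousAt
  have hlt : ∀ᶠ x in nhds (B, B), disp (x.1⁻¹ * x.2) basePoint < ε := by
    refine hcont.eventually (gt_mem_nhds ?_)
    simpa [disp_one] using hε
  rw [nhds_prod_eq] at hlt
  obtain ⟨W, hW, hWlt⟩ := (Filter.eventually_prod_self_iff
    (r := fun x y : SL(2, ℂ) => disp (x⁻¹ * y) basePoint < ε)).1 hlt
  have hfreq := hB.frequently hW
  obtain ⟨n, -, hn⟩ := Filter.frequently_atTop.1 hfreq 0
  obtain ⟨k, hk, hkW⟩ := Filter.frequently_atTop.1 hfreq (n + 1)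
  refine ⟨k - n, by omega, ?_⟩
  have := hWlt _ hn _ hkW
  have e : (A ^ n)⁻¹ * A ^ k = A ^ (k - n) := by
    rw [inv_mul_eq_iff_eq_mul, ← pow_add]; congr 1; omega
  rwa [e] at this

/-- A matrix that hardly moves the base point may rotate about it, so its `disp` need not be small;
a power makes up for the rotation. The bound η is uniform because displacement has a positive
minimum on the compact set of matrices of norm at most 2 having no such power. -/
theorem exists_pow_disp_lt {ε : ℝ} (hε : 0 < ε) : ∃ η : ℝ, 0 < η ∧ ∀ A : SL(2, ℂ),
    sep basePoint (mob A basePoint) < η → ∃ m : ℕ, 1 ≤ m ∧ disp (A ^ m) basePoint < ε := by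
  set V : Set SL(2, ℂ) := ⋃ m : ℕ, {A | 1 ≤ m ∧ disp (A ^ m) basePoint < ε} with hV
  have hVopen : IsOpen V := by
    refine isOpen_iUnion fun m => ?_
    by_cases hm : 1 ≤ m
    · simp only [hm, true_and]
      exact isOpen_lt (continuous_disp_basePoint.comp (continuous_pow m)) continuous_const
    · simp [hm]
  have hK : IsCompact ({A : SL(2, ℂ) | frob A ≤ 2} \ V) := (isCompact_frob_le 2).diff hVopen
  have hfix : ∀ A : SL(2, ℂ), sep basePoint (mob A basePoint) = 0 → A ∈ V := by
    intro A hA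
    obtain ⟨m, hm⟩ := exists_pow_disp_lt_of_fix (eq_of_sep_eq_zero hA).symm hε
    exact mem_iUnion.2 ⟨m, hm⟩
  have hcont : Continuous fun A : SL(2, ℂ) => frob A := continuous_frob.comp continuous_coe_SL
  obtain ⟨η, hη, hηK⟩ : ∃ η : ℝ, 0 < η ∧ ∀ A ∈ {A : SL(2, ℂ) | frob A ≤ 2} \ V,
      η ≤ sep basePoint (mob A basePoint) := by
    rcases ({A : SL(2, ℂ) | frob A ≤ 2} \ V).eq_empty_or_nonempty with he | hne
    · exact ⟨1, one_pos, by simp [he]⟩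
    · obtain ⟨B, hB, hmin⟩ := hK.exists_isMinOn hne hcont.continuousOn
      refine ⟨sep basePoint (mob B basePoint), ?_, fun A hA => ?_⟩
      · exact lt_of_le_of_ne (sep_nonneg _ _) fun h => hB.2 (hfix B h.symm)
      · have h1 := sep_basePoint A
        have h2 := sep_basePoint B
        have h3 := pow_le_pow_left₀ (frob_nonneg _) (hmin hA) 2
        simp only at h3
        linarith
  -- A value of `sep` below 2 gives ‖A‖² = sep + 2 < 4, which places A in the compact set.
  refine ⟨min η 2, by positivity, fun A hA => ?_⟩
  have h1 := sep_basePoint A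
  have h2 : A ∈ V := by
    by_contra h
    have h3 : frob A ≤ 2 := by
      have := frob_nonneg A
      have := hA.trans_le (min_le_right η 2)
      nlinarith
    have := hηK A ⟨h3, h⟩
    exact absurd (hA.trans_le (min_le_left _ _)) (not_lt.2 this)
  exact mem_iUnion.1 h2

/-! ### Thick points, commuting short elements and tubes about axes. -/

section

variable {Γ : Subgroup PSL(2, ℂ)}

/-- Nontrivial elements of `Γ` lifted to `SL(2, ℂ)`. -/
def NontrivialLift (Γ : Subgroup PSL(2, ℂ)) (A : SL(2, ℂ)) : Prop :=
  (A : PSL(2, ℂ)) ∈ Γ ∧ (A : PSL(2, ℂ)) ≠ 1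

theorem NontrivialLift.conj {A G : SL(2, ℂ)} (hA : NontrivialLift Γ A) (hG : (G : PSL(2, ℂ)) ∈ Γ) :
    NontrivialLift Γ (G * A * G⁻¹) := by
  have e : ((G * A * G⁻¹ : SL(2, ℂ)) : PSL(2, ℂ)) = (G : PSL(2, ℂ)) * A * (G : PSL(2, ℂ))⁻¹ := rfl
  refine ⟨?_, ?_⟩
  · rw [e]; exact Γ.mul_mem (Γ.mul_mem hG hA.1) (Γ.inv_mem hG)
  · rw [e]; intro h
    exact hA.2 (conj_eq_one_iff.1 h)

theorem mob_ne (hΓ : IsCusped Γ) {A : SL(2, ℂ)} (hA : NontrivialLift Γ A) (x : H3) :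
    mob A x ≠ x := fun h => hA.2 (hΓ.free _ hA.1 x h)

/-- For |u| = 1 the element would be a rotation and fix the points of its axis, against freeness. -/
theorem normSq_ne_one (hΓ : IsCusped Γ) {A g : SL(2, ℂ)} {u : ℂˣ} (hA : NontrivialLift Γ A)
    (h : g⁻¹ * A * g = diagSL u) : Complex.normSq u ≠ 1 := by
  intro h1
  have e : A = g * diagSL u * g⁻¹ := by rw [← h]; group
  refine mob_ne hΓ hA (mob g basePoint) ?_
  rw [e, mob_mul, mob_inv_mob, mob_mul]
  congr 1
  apply H3.ext_coords
  · rw [horiz_diagSL]; simp [basePoint]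
  · rw [height_diagSL, h1, one_mul]

/-- Γ has no torsion: powers of a translation are translations by nonzero multiples, and a power of
a diagonal matrix can be ±1 only if |u| = 1, which `normSq_ne_one` excludes. -/
theorem NontrivialLift.pow (hΓ : IsCusped Γ) {A : SL(2, ℂ)} (hA : NontrivialLift Γ A) {m : ℕ}
    (hm : 1 ≤ m) : NontrivialLift Γ (A ^ m) := by
  have e : ((A ^ m : SL(2, ℂ)) : PSL(2, ℂ)) = (A : PSL(2, ℂ)) ^ m := rfl
  refine ⟨by rw [e]; exact Γ.pow_mem hA.1 m, ?_⟩
  intro h1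
  obtain ⟨g, hg⟩ := exists_normal_form hA.2
  have hpow : ((g⁻¹ * A * g : SL(2, ℂ)) ^ m : SL(2, ℂ)) = g⁻¹ * A ^ m * g := by
    have := conj_pow (i := m) (a := g⁻¹) (b := A)
    rwa [inv_inv] at this
  have hone : (((g⁻¹ * A * g) ^ m : SL(2, ℂ)) : PSL(2, ℂ)) = 1 := by
    rw [hpow]
    have : ((g⁻¹ * A ^ m * g : SL(2, ℂ)) : PSL(2, ℂ)) =
      (g : PSL(2, ℂ))⁻¹ * ((A ^ m : SL(2, ℂ)) : PSL(2, ℂ)) * g := rfl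
    rw [this, h1, mul_one, inv_mul_cancel]
  have htr : ∀ w : ℂ, transSL w ^ m = transSL (m * w) := by
    intro w
    clear hm h1 hpow hone e
    induction m with
    | zero => apply SL2_ext <;> simp
    | succ n ih => rw [pow_succ, ih, ← transSL_add]; congr 1; push_cast; ring
  rcases hg with ⟨w, hw, hgw⟩ | ⟨u, hu, hgu⟩
  · have h2 : ((transSL w ^ m : SL(2, ℂ)) : PSL(2, ℂ)) = 1 := by
      have h3 : ((g⁻¹ * A * g : SL(2, ℂ)) : PSL(2, ℂ)) = transSL w := by
        rcases hgw with h | h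
        · rw [h]
        · exact mk_eq_mk.2 (Or.inr h)
      have h4 : (((g⁻¹ * A * g) ^ m : SL(2, ℂ)) : PSL(2, ℂ)) =
        ((g⁻¹ * A * g : SL(2, ℂ)) : PSL(2, ℂ)) ^ m := rfl
      rw [h4, h3] at hone
      exact hone
    rw [htr, mk_eq_one] at h2
    have hm' : (m : ℂ) ≠ 0 := by exact_mod_cast (by omega : m ≠ 0)
    rcases h2 with h | h
    · have := congrArg (fun M : SL(2, ℂ) => M 0 1) h
      simp [hw, hm'] at this
    · have := congrArg (fun M : SL(2, ℂ) => M 0 1) h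
      simp [hw, hm'] at this
  · rw [hgu, ← diagSL_pow, mk_eq_one] at hone
    have h2 : Complex.normSq ((u ^ m : ℂˣ) : ℂ) = 1 := by
      rcases hone with h | h
      · have := congrArg (fun M : SL(2, ℂ) => M 0 0) h
        simp only [diagSL_00] at this
        rw [this]; simp
      · have := congrArg (fun M : SL(2, ℂ) => M 0 0) h
        simp only [diagSL_00] at this
        rw [this]; simp
    refine normSq_ne_one hΓ hA hgu ?_
    rw [Units.val_pow_eq_pow_val, map_pow] at h2
    exact (pow_eq_one_iff_of_nonneg (Complex.normSq_nonneg _) (by omega)).1 h2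

/-- No nontrivial element of `Γ` is shorter than `1 / 10` at `x`. -/
def Thick (Γ : Subgroup PSL(2, ℂ)) (x : H3) : Prop :=
  ∀ A : SL(2, ℂ), NontrivialLift Γ A → 1 / 100 ≤ disp A x

/-- A nontrivial element with `sep` displacement below η would have a power with `disp` below 1/100.
Thick points therefore satisfy the hypothesis of the packing argument. -/
theorem relCompact_Thick (hΓ : IsCusped Γ) : RelCompact Γ {x | Thick Γ x} := by
  obtain ⟨η, hη, h⟩ := exists_pow_disp_lt (ε := 1 / 100) (by norm_num)
  obtain ⟨K, hK, hcov⟩ := relCompact_thick hΓ hη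
  refine ⟨K, hK, fun x hx => hcov x ?_⟩
  intro γ hγ hγ1
  by_contra hlt
  push Not at hlt
  obtain ⟨A, rfl⟩ := exists_mk γ
  obtain ⟨g, _, rfl⟩ := exists_mob_basePoint x
  have e : sep basePoint (mob (g⁻¹ * A * g) basePoint) < η := by
    rw [← sep_mob g, mob_mul, mob_mul, mob_mob_inv]; exact hlt
  obtain ⟨m, hm, hd⟩ := h _ e
  have hpow : ((g⁻¹ * A * g : SL(2, ℂ)) ^ m : SL(2, ℂ)) = g⁻¹ * A ^ m * g := by
    have := conj_pow (i := m) (a := g⁻¹) (b := A)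
    rwa [inv_inv] at this
  rw [hpow, disp_conj'] at hd
  exact absurd (hx (A ^ m) (NontrivialLift.pow hΓ ⟨hγ, hγ1⟩ hm)) (not_le.2 hd)

/-- Short elements at a point commute. -/
theorem commute_of_short (hΓ : IsCusped Γ) {A B : SL(2, ℂ)} {x : H3} (hA : NontrivialLift Γ A)
    (hB : NontrivialLift Γ B) (hAx : disp A x < 1 / 100) (hBx : disp B x < 1 / 100) :
    Commute A B := by
  have hfin := finite_disp_le hΓ.properlyDiscontinuous (isCompact_singleton (x := x)) (1 / 100)
  have hfin' : {C : SL(2, ℂ) | NontrivialLift Γ C ∧ disp C x < 1 / 100}.Finite :=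
    hfin.subset fun C hC => ⟨hC.1.1, x, rfl, hC.2.le⟩
  -- C is a shortest nontrivial element at x. Its commutator with a short D is shorter than C, hence
  -- trivial in PSL, and the lift −1 is excluded because its `disp` is 8. All short elements thus
  -- commute with C, and commuting is transitive.
  obtain ⟨C, ⟨hC, hCx⟩, hmin⟩ := Set.exists_min_image _ (fun C => disp C x) hfin' ⟨A, hA, hAx⟩
  have hpos : 0 < disp C x := by
    refine lt_of_le_of_ne (disp_nonneg C x) fun h => hC.2 ?_
    rw [disp_eq_zero h.symm]; rfl
  have key : ∀ D, NontrivialLift Γ D → disp D x < 1 / 100 → Commute C D := by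
    intro D hD hDx
    have h1 := disp_commutator_le hCx.le hDx.le
    have h2 : ((C * D * C⁻¹ * D⁻¹ : SL(2, ℂ)) : PSL(2, ℂ)) = 1 := by
      by_contra hne
      have hmem : ((C * D * C⁻¹ * D⁻¹ : SL(2, ℂ)) : PSL(2, ℂ)) ∈ Γ :=
        Γ.mul_mem (Γ.mul_mem (Γ.mul_mem hC.1 hD.1) (Γ.inv_mem hC.1)) (Γ.inv_mem hD.1)
      have := hmin _ ⟨⟨hmem, hne⟩, by linarith⟩
      linarith
    rcases mk_eq_one.1 h2 with h | h
    · exact commutatorElement_eq_one_iff_commute.1 h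
    · rw [h, disp_neg_one] at h1
      linarith
  exact commute_trans hC.2 (key A hA hAx).symm (key B hB hBx)

theorem eq_diagSL_of_commute {B : SL(2, ℂ)} {u : ℂˣ} (hu : (u : ℂ) ≠ (u⁻¹ : ℂˣ))
    (h : Commute (diagSL u) B) : ∃ v : ℂˣ, B = diagSL v := by
  obtain ⟨-, h2, h3⟩ := commute_iff.1 h
  simp only [diagSL_01, diagSL_00, diagSL_11, diagSL_10, zero_mul] at h2 h3
  have hne : (u : ℂ) - (u⁻¹ : ℂˣ) ≠ 0 := sub_ne_zero.2 hu
  have h01 : B 0 1 = 0 := (mul_eq_zero.1 h2.symm).resolve_left hne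
  have h10 : B 1 0 = 0 := (mul_eq_zero.1 h3.symm).resolve_left hne
  have hd := mul_eq_one_of_upper h10
  refine ⟨Units.mk0 (B 0 0) (left_ne_zero_of_mul_eq_one hd), ?_⟩
  apply SL2_ext
  · simp
  · simp [h01]
  · simp [h10]
  · simpa using eq_inv_of_mul_eq_one_right hd

theorem diagSL_ne {g A : SL(2, ℂ)} {v : ℂˣ} (hA : (A : PSL(2, ℂ)) ≠ 1)
    (h : g⁻¹ * A * g = diagSL v) : (v : ℂ) ≠ (v⁻¹ : ℂˣ) := by
  intro hv
  apply hA
  have h1 : diagSL v = 1 ∨ diagSL v = -1 := central_of_scalar rfl rfl (by simpa using sub_eq_zero.2 hv)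
  have e : A = g * diagSL v * g⁻¹ := by rw [← h]; group
  rw [mk_eq_one, e]
  rcases h1 with h1 | h1 <;> rw [h1] <;> simp

theorem commute_conj' {g A B : SL(2, ℂ)} : Commute (g⁻¹ * A * g) (g⁻¹ * B * g) ↔ Commute A B := by
  have := commute_conj (g := g⁻¹) (A := A) (B := B)
  rwa [inv_inv] at this

/-- Leaving the tube around the axis of a short loxodromic element, one meets a thick point at which
an element with the same axis is short. -/
theorem exists_thick_of_short (hΓ : IsCusped Γ) {A g : SL(2, ℂ)} {u : ℂˣ} {x : H3}
    (hA : NontrivialLift Γ A) (hg : g⁻¹ * A * g = diagSL u) (hAx : disp A x < 1 / 100) :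
    ∃ y, Thick Γ y ∧ ∃ B, NontrivialLift Γ B ∧ Commute A B ∧ disp B y ≤ 1 / 100 := by
  set p := mob g⁻¹ x with hp
  have hxp : x = mob g p := (mob_mob_inv g x).symm
  have ht := height_pos p
  -- In the coordinates given by g the axis of A lies over 0 and ∞, and the path leaves x
  -- horizontally at constant height.
  set c : ℝ → H3 := fun s => mob g (mob (transSL (s : ℂ)) p) with hc
  have hc0 : c 0 = x := by
    have h1 : transSL ((0 : ℝ) : ℂ) = 1 := by apply SL2_ext <;> simp
    simp only [hc, h1, mob_one, hxp]
  have hccont : Continuous c := by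
    refine (continuous_mob g).comp ?_
    rw [continuous_induced_rng]
    have : (Subtype.val ∘ fun s : ℝ => mob (transSL (s : ℂ)) p) =
        fun s : ℝ => (p : E3) + s • EuclideanSpace.single 0 1 := by
      funext s
      have hh : mob (transSL (s : ℂ)) p = ofCoords (horiz p + s) (height p) ht := by
        apply H3.ext_coords
        · rw [horiz_transSL, horiz_ofCoords]
        · rw [height_transSL, height_ofCoords]
      simp only [Function.comp_apply, hh]
      ext i
      fin_cases i <;> simp [ofCoords, horiz, height]
    rw [this]
    fun_prop
  set P : ℝ → Prop := fun s => ∃ B, NontrivialLift Γ B ∧ Commute A B ∧ disp B (c s) < 1 / 100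
    with hP
  have hune := diagSL_ne hA.2 hg
  have hdisp : ∀ B, NontrivialLift Γ B → Commute A B → ∃ v : ℂˣ, (v : ℂ) ≠ (v⁻¹ : ℂˣ) ∧
      ∀ s : ℝ, disp B (c s) = Complex.normSq (v - (v⁻¹ : ℂˣ)) * Complex.normSq (horiz p + s) /
        height p ^ 2 + Complex.normSq (v - 1) + Complex.normSq ((v⁻¹ : ℂˣ) - 1) := by
    intro B hB hAB
    obtain ⟨v, hv⟩ := eq_diagSL_of_commute hune (hg ▸ commute_conj'.2 hAB)
    refine ⟨v, diagSL_ne hB.2 hv, fun s => ?_⟩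
    rw [hc]
    simp only
    rw [← disp_conj', hv, disp_diagSL, horiz_transSL, height_transSL]
  have hopen : IsOpen {s | P s} := by
    have : {s | P s} = ⋃ B ∈ {B : SL(2, ℂ) | NontrivialLift Γ B ∧ Commute A B},
        {s | disp B (c s) < 1 / 100} := by
      ext s
      simp only [mem_iUnion, exists_prop]
      exact ⟨fun ⟨B, h1, h2, h3⟩ => ⟨B, ⟨h1, h2⟩, h3⟩, fun ⟨B, ⟨h1, h2⟩, h3⟩ => ⟨B, h1, h2, h3⟩⟩
    rw [this]
    exact isOpen_biUnion fun B _ => isOpen_lt ((continuous_disp B).comp hccont) continuous_const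
  -- far out on the path nothing is short
  have hfar : ∃ s : ℝ, 0 ≤ s ∧ ¬ P s := by
    have hfin : {B : SL(2, ℂ) | NontrivialLift Γ B ∧ Commute A B ∧ disp B x ≤ 1 / 100}.Finite :=
      (finite_disp_le hΓ.properlyDiscontinuous (isCompact_singleton (x := x)) (1 / 100)).subset
        fun B hB => ⟨hB.1.1, x, rfl, hB.2.2⟩
    have hev : ∀ᶠ s : ℝ in Filter.atTop, ∀ B ∈ {B : SL(2, ℂ) | NontrivialLift Γ B ∧ Commute A B ∧
        disp B x ≤ 1 / 100}, 1 / 100 ≤ disp B (c s) := by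
      rw [Filter.eventually_all_finite hfin]
      rintro B ⟨hB, hAB, -⟩
      obtain ⟨v, hv, hd⟩ := hdisp B hB hAB
      have hk : 0 < Complex.normSq (v - (v⁻¹ : ℂˣ)) := Complex.normSq_pos.2 (sub_ne_zero.2 hv)
      have h1 : Filter.Tendsto (fun s : ℝ => (horiz p).re + s) Filter.atTop Filter.atTop :=
        Filter.tendsto_atTop_add_const_left _ _ Filter.tendsto_id
      filter_upwards [h1.eventually_ge_atTop (height p / Complex.normSq (v - (v⁻¹ : ℂˣ)) + height p)]
        with s hs
      rw [hd]
      have h2 : (height p / Complex.normSq (v - (v⁻¹ : ℂˣ)) + height p) ^ 2 ≤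
          Complex.normSq (horiz p + s) := by
        rw [Complex.normSq_apply (horiz p + (s : ℂ))]
        have h4 : (horiz p + (s : ℂ)).re = (horiz p).re + s := by simp
        rw [h4]
        have h5 : 0 ≤ height p / Complex.normSq (v - (v⁻¹ : ℂˣ)) + height p := by positivity
        nlinarith [mul_self_nonneg (horiz p + (s : ℂ)).im]
      have h3 : 1 ≤ Complex.normSq (v - (v⁻¹ : ℂˣ)) * Complex.normSq (horiz p + s) /
          height p ^ 2 := by
        rw [le_div_iff₀ (by positivity), one_mul]
        have h6 : height p ^ 2 ≤ Complex.normSq (v - (v⁻¹ : ℂˣ)) *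
            (height p / Complex.normSq (v - (v⁻¹ : ℂˣ)) + height p) ^ 2 := by
          have : Complex.normSq (v - (v⁻¹ : ℂˣ)) *
            (height p / Complex.normSq (v - (v⁻¹ : ℂˣ)) + height p) ^ 2 = height p ^ 2 *
              (1 / Complex.normSq (v - (v⁻¹ : ℂˣ)) + 2 + Complex.normSq (v - (v⁻¹ : ℂˣ))) := by
            field_simp; ring
          rw [this]
          have h7 : 0 < 1 / Complex.normSq (v - (v⁻¹ : ℂˣ)) := by positivity
          nlinarith [sq_nonneg (height p)]
        exact h6.trans (mul_le_mul_of_nonneg_left h2 hk.le)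
      have := Complex.normSq_nonneg ((v : ℂ) - 1)
      have := Complex.normSq_nonneg (((v⁻¹ : ℂˣ) : ℂ) - 1)
      linarith
    -- Beyond 2‖z‖ the path is at least as far from the axis as x is. An element with this axis that
    -- is short at c s is then short at x, so it is one of the finitely many elements treated in
    -- `hev`.
    obtain ⟨s, hs, hs'⟩ := (hev.and (Filter.eventually_ge_atTop (2 * ‖horiz p‖))).exists
    have hs0 : 0 ≤ s := (by positivity : (0 : ℝ) ≤ 2 * ‖horiz p‖).trans hs'
    refine ⟨s, hs0, ?_⟩
    rintro ⟨B, hB, hAB, hBs⟩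
    refine absurd (hs B ⟨hB, hAB, ?_⟩) (not_le.2 hBs)
    obtain ⟨v, hv, hd⟩ := hdisp B hB hAB
    refine le_trans ?_ hBs.le
    rw [← hc0, hd, hd]
    have hle : Complex.normSq (horiz p + (0 : ℝ)) ≤ Complex.normSq (horiz p + s) := by
      rw [Complex.normSq_eq_norm_sq, Complex.normSq_eq_norm_sq]
      refine pow_le_pow_left₀ (norm_nonneg _) ?_ 2
      have h1 : ‖(s : ℂ)‖ ≤ ‖horiz p + s‖ + ‖horiz p‖ := by
        have := norm_sub_le (horiz p + s) (horiz p)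
        rwa [add_sub_cancel_left] at this
      rw [Complex.norm_real, Real.norm_of_nonneg hs0] at h1
      simp only [Complex.ofReal_zero, add_zero]
      linarith
    have := Complex.normSq_nonneg ((v : ℂ) - (v⁻¹ : ℂˣ))
    gcongr
  set N : Set ℝ := {s | 0 ≤ s ∧ ¬ P s} with hN
  have hNclosed : IsClosed N := (isClosed_Ici (a := (0 : ℝ))).inter hopen.isClosed_compl
  have hNbdd : BddBelow N := ⟨0, fun s hs => hs.1⟩
  set m := sInf N with hm
  have hmN : m ∈ N := hNclosed.csInf_mem hfar hNbdd
  have hlt : ∀ s, 0 ≤ s → s < m → P s := by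
    intro s hs hsm
    by_contra h
    exact absurd (csInf_le hNbdd (show s ∈ N from ⟨hs, h⟩)) (not_le.2 hsm)
  have hm0 : 0 < m := by
    refine lt_of_le_of_ne hmN.1 fun h => hmN.2 ?_
    rw [← h]
    exact ⟨A, hA, Commute.refl A, by rw [hc0]; exact hAx⟩
  have hIio : ∀ᶠ s in nhdsWithin m (Iio m), 0 ≤ s ∧ s < m := by
    filter_upwards [mem_nhdsWithin_of_mem_nhds (Ioi_mem_nhds hm0), self_mem_nhdsWithin] with s h1 h2
    exact ⟨le_of_lt h1, h2⟩
  -- A short B at c m is short slightly earlier too, together with some D having the axis of A.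
  -- These commute, so B has that axis, against the choice of m. Conversely, if all elements with
  -- that axis exceeded 1/100 at c m, finiteness would carry this to slightly earlier times.
  refine ⟨c m, ?_, ?_⟩
  · intro B hB
    by_contra hBm
    push Not at hBm
    have hev : ∀ᶠ s in nhdsWithin m (Iio m), disp B (c s) < 1 / 100 :=
      (((continuous_disp B).comp hccont).continuousAt.eventually (gt_mem_nhds hBm)).filter_mono
        nhdsWithin_le_nhds
    obtain ⟨s, ⟨hs0, hsm⟩, hs⟩ := (hIio.and hev).exists
    obtain ⟨D, hD, hAD, hDs⟩ := hlt s hs0 hsm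
    exact hmN.2 ⟨B, hB, commute_trans hD.2 hAD (commute_of_short hΓ hD hB hDs hs), hBm⟩
  · by_contra hcon
    push Not at hcon
    have hK : IsCompact (c '' Icc 0 m) := isCompact_Icc.image hccont
    have hfin : {B : SL(2, ℂ) | NontrivialLift Γ B ∧ Commute A B ∧
        ∃ y ∈ c '' Icc 0 m, disp B y ≤ 1 / 100}.Finite :=
      (finite_disp_le hΓ.properlyDiscontinuous hK (1 / 100)).subset
        fun B hB => ⟨hB.1.1, hB.2.2⟩
    have hev : ∀ᶠ s in nhdsWithin m (Iio m), ∀ B ∈ {B : SL(2, ℂ) | NontrivialLift Γ B ∧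
        Commute A B ∧ ∃ y ∈ c '' Icc 0 m, disp B y ≤ 1 / 100}, 1 / 100 < disp B (c s) := by
      rw [Filter.eventually_all_finite hfin]
      rintro B ⟨hB, hAB, -⟩
      exact (((continuous_disp B).comp hccont).continuousAt.eventually
        (lt_mem_nhds (hcon B hB hAB))).filter_mono nhdsWithin_le_nhds
    obtain ⟨s, ⟨hs0, hsm⟩, hs⟩ := (hIio.and hev).exists
    obtain ⟨D, hD, hAD, hDs⟩ := hlt s hs0 hsm
    exact absurd (hs D ⟨hD, hAD, c s, ⟨s, ⟨hs0, hsm.le⟩, rfl⟩, hDs.le⟩) (not_lt.2 hDs.le)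

/-- The tube around an axis is compact modulo `Γ`. -/
theorem relCompact_tube (hΓ : IsCusped Γ) {B g : SL(2, ℂ)} {u : ℂˣ} (hB : NontrivialLift Γ B)
    (hg : g⁻¹ * B * g = diagSL u) : RelCompact Γ {x | ∃ A, NontrivialLift Γ A ∧ Commute A B ∧
      disp A x < 1 / 100} := by
  have hune := diagSL_ne hB.2 hg
  have hu1 := normSq_ne_one hΓ hB hg
  have hupos : 0 < Complex.normSq u := Complex.normSq_pos.2 u.ne_zero
  have hdiag : ∀ A, NontrivialLift Γ A → Commute A B → ∃ v : ℂˣ, (v : ℂ) ≠ (v⁻¹ : ℂˣ) ∧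
      g⁻¹ * A * g = diagSL v := by
    intro A hA hAB
    obtain ⟨v, hv⟩ := eq_diagSL_of_commute hune (hg ▸ commute_conj'.2 hAB.symm)
    exact ⟨v, diagSL_ne hA.2 hv, hv⟩
  have hfin : {A : SL(2, ℂ) | NontrivialLift Γ A ∧ Commute A B ∧
      disp A (mob g basePoint) ≤ 1 / 100}.Finite :=
    (finite_disp_le hΓ.properlyDiscontinuous (isCompact_singleton (x := mob g basePoint))
      (1 / 100)).subset fun A hA => ⟨hA.1.1, _, rfl, hA.2.2⟩
  -- An element with this axis that is short anywhere is short on the axis, so only finitely many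
  -- occur. A common lower bound κ for |v − v⁻¹|² bounds the width of the tube.
  obtain ⟨κ, hκ, hκmin⟩ : ∃ κ : ℝ, 0 < κ ∧ ∀ A ∈ {A : SL(2, ℂ) | NontrivialLift Γ A ∧ Commute A B ∧
      disp A (mob g basePoint) ≤ 1 / 100}, ∀ v, g⁻¹ * A * g = diagSL v →
        κ ≤ Complex.normSq (v - (v⁻¹ : ℂˣ)) := by
    have hpos : ∀ A ∈ {A : SL(2, ℂ) | NontrivialLift Γ A ∧ Commute A B ∧
        disp A (mob g basePoint) ≤ 1 / 100},
        0 < Complex.normSq ((g⁻¹ * A * g) 0 0 - (g⁻¹ * A * g) 1 1) := by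
      rintro A ⟨hA, hAB, -⟩
      obtain ⟨v, hv, hgv⟩ := hdiag A hA hAB
      rw [hgv, diagSL_00, diagSL_11]
      exact Complex.normSq_pos.2 (sub_ne_zero.2 hv)
    rcases Set.eq_empty_or_nonempty {A : SL(2, ℂ) | NontrivialLift Γ A ∧ Commute A B ∧
        disp A (mob g basePoint) ≤ 1 / 100} with he | hne
    · refine ⟨1, one_pos, fun A hA => ?_⟩
      rw [he] at hA
      exact absurd hA (notMem_empty A)
    · obtain ⟨A, hA, hmin⟩ := Set.exists_min_image _
        (fun A => Complex.normSq ((g⁻¹ * A * g) 0 0 - (g⁻¹ * A * g) 1 1)) hfin hne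
      refine ⟨_, hpos A hA, fun D hD v hv => ?_⟩
      have := hmin D hD
      change _ ≤ Complex.normSq ((g⁻¹ * D * g) 0 0 - (g⁻¹ * D * g) 1 1) at this
      rw [hv] at this
      exact this
  set U : ℝ := max (Complex.normSq u) (Complex.normSq u)⁻¹ with hU
  refine ⟨mob g '' {p | 1 ≤ height p ∧ height p ≤ U ∧
    Complex.normSq (horiz p) ≤ 1 / (100 * κ) * U ^ 2},
    (isCompact_box one_pos U _).image (continuous_mob g), ?_⟩
  rintro x ⟨A, hA, hAB, hAx⟩
  obtain ⟨v, hv, hgv⟩ := hdiag A hA hAB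
  set p := mob g⁻¹ x with hp
  have hxp : x = mob g p := (mob_mob_inv g x).symm
  have ht := height_pos p
  rw [hxp, ← disp_conj', hgv, disp_diagSL] at hAx
  have hv0 : disp A (mob g basePoint) ≤ 1 / 100 := by
    rw [← disp_conj', hgv, disp_diagSL]
    have h1 : 0 ≤ Complex.normSq (v - (v⁻¹ : ℂˣ)) * Complex.normSq (horiz p) / height p ^ 2 :=
      div_nonneg (mul_nonneg (Complex.normSq_nonneg _) (Complex.normSq_nonneg _)) (sq_nonneg _)
    simp only [basePoint, horiz_ofCoords, map_zero, mul_zero, zero_div]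
    linarith
  have hκv := hκmin A ⟨hA, hAB, hv0⟩ v hgv
  have hz : Complex.normSq (horiz p) ≤ 1 / (100 * κ) * height p ^ 2 := by
    have h1 := Complex.normSq_nonneg ((v : ℂ) - 1)
    have h2 := Complex.normSq_nonneg (((v⁻¹ : ℂˣ) : ℂ) - 1)
    have h3 : Complex.normSq (v - (v⁻¹ : ℂˣ)) * Complex.normSq (horiz p) / height p ^ 2 < 1 / 100 := by
      linarith
    rw [div_lt_iff₀ (by positivity)] at h3
    have h4 : κ * Complex.normSq (horiz p) ≤ 1 / 100 * height p ^ 2 :=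
      (mul_le_mul_of_nonneg_right hκv (Complex.normSq_nonneg _)).trans h3.le
    have h5 : 1 / (100 * κ) * height p ^ 2 = (1 / 100 * height p ^ 2) / κ := by field_simp
    rw [h5, le_div_iff₀ hκ]
    linarith
  -- Since |u| ≠ 1, a power of B brings the height along the axis into a fixed fundamental interval.
  obtain ⟨n, hn1, hn2⟩ : ∃ n : ℤ, 1 ≤ Complex.normSq u ^ n * height p ∧
      Complex.normSq u ^ n * height p ≤ U := by
    have hgen : ∀ y : ℝ, 1 < y → ∃ n : ℤ, 1 ≤ y ^ n * height p ∧ y ^ n * height p ≤ y := by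
      intro y hy
      obtain ⟨n, hn1, hn2⟩ := exists_mem_Ico_zpow ht hy
      have hyn : 0 < y ^ n := zpow_pos (by linarith) n
      refine ⟨-n, ?_, ?_⟩
      · rw [zpow_neg, ← div_eq_inv_mul, le_div_iff₀ hyn]; linarith
      · rw [zpow_neg, ← div_eq_inv_mul, div_le_iff₀ hyn]
        rw [zpow_add_one₀ (by linarith)] at hn2
        linarith
    rcases lt_or_gt_of_ne hu1 with h | h
    · obtain ⟨n, hn1, hn2⟩ := hgen (Complex.normSq u)⁻¹ ((one_lt_inv₀ hupos).2 h)
      refine ⟨-n, ?_, ?_⟩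
      · rwa [zpow_neg, ← inv_zpow]
      · rw [zpow_neg, ← inv_zpow]; exact hn2.trans (le_max_right _ _)
    · obtain ⟨n, hn1, hn2⟩ := hgen _ h
      exact ⟨n, hn1, hn2.trans (le_max_left _ _)⟩
  refine ⟨((B ^ n : SL(2, ℂ)) : PSL(2, ℂ)), ?_, mob (diagSL (u ^ n)) p, ?_, ?_⟩
  · exact Γ.zpow_mem hB.1 n
  · have hh : height (mob (diagSL (u ^ n)) p) = Complex.normSq u ^ n * height p := by
      rw [height_diagSL, Units.val_zpow_eq_zpow_val, map_zpow₀]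
    have hz' : Complex.normSq (horiz (mob (diagSL (u ^ n)) p)) =
        (Complex.normSq u ^ n) ^ 2 * Complex.normSq (horiz p) := by
      rw [horiz_diagSL, map_mul, map_pow, Units.val_zpow_eq_zpow_val, map_zpow₀]
    refine ⟨by rw [hh]; exact hn1, by rw [hh]; exact hn2, ?_⟩
    rw [hz']
    have h1 : (Complex.normSq u ^ n * height p) ^ 2 ≤ U ^ 2 :=
      pow_le_pow_left₀ (by linarith) hn2 2
    calc (Complex.normSq u ^ n) ^ 2 * Complex.normSq (horiz p)
        ≤ (Complex.normSq u ^ n) ^ 2 * (1 / (100 * κ) * height p ^ 2) :=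
          mul_le_mul_of_nonneg_left hz (sq_nonneg _)
      _ = 1 / (100 * κ) * (Complex.normSq u ^ n * height p) ^ 2 := by ring
      _ ≤ 1 / (100 * κ) * U ^ 2 := mul_le_mul_of_nonneg_left h1 (by positivity)
  · change _ = mob (B ^ n) x
    have e : B ^ n = g * diagSL (u ^ n) * g⁻¹ := by
      rw [diagSL_zpow, ← hg]
      have := conj_zpow (i := n) (a := g⁻¹) (b := B)
      rw [inv_inv] at this
      rw [this]; group
    rw [e, hxp, mob_mul, mob_inv_mob, mob_mul]

/-- The loxodromic part of the thin part is compact modulo `Γ`. -/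
theorem relCompact_loxodromic (hΓ : IsCusped Γ) : RelCompact Γ {x | ∃ A g : SL(2, ℂ), ∃ u : ℂˣ,
    NontrivialLift Γ A ∧ g⁻¹ * A * g = diagSL u ∧ disp A x < 1 / 100} := by
  obtain ⟨K, hK, hcov⟩ := relCompact_Thick hΓ
  -- Each tube meets the thick points where some element with the same axis has `disp` at most
  -- 1/100. After a translation by Γ this happens in K, so finitely many tubes suffice.
  have hfin : {B : SL(2, ℂ) | (NontrivialLift Γ B ∧ ∃ g : SL(2, ℂ), ∃ u : ℂˣ,
      g⁻¹ * B * g = diagSL u) ∧ ∃ y ∈ K, disp B y ≤ 1 / 100}.Finite :=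
    (finite_disp_le hΓ.properlyDiscontinuous hK (1 / 100)).subset fun B hB => ⟨hB.1.1.1, hB.2⟩
  have htube : ∀ B : SL(2, ℂ), ∃ L : Set H3, IsCompact L ∧ ((NontrivialLift Γ B ∧
      ∃ g : SL(2, ℂ), ∃ u : ℂˣ, g⁻¹ * B * g = diagSL u) → ∀ x, (∃ A, NontrivialLift Γ A ∧
        Commute A B ∧ disp A x < 1 / 100) → ∃ γ ∈ Γ, γ • x ∈ L) := by
    intro B
    by_cases h : NontrivialLift Γ B ∧ ∃ g : SL(2, ℂ), ∃ u : ℂˣ, g⁻¹ * B * g = diagSL u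
    · obtain ⟨hB, g, u, hg⟩ := h
      obtain ⟨L, hL, hcov⟩ := relCompact_tube hΓ hB hg
      exact ⟨L, hL, fun _ x hx => hcov x hx⟩
    · exact ⟨∅, isCompact_empty, fun h' => absurd h' h⟩
  choose L hL hLcov using htube
  refine ⟨_, hfin.isCompact_biUnion fun B _ => hL B, ?_⟩
  rintro x ⟨A, g, u, hA, hg, hAx⟩
  obtain ⟨y, hy, B, hB, hAB, hBy⟩ := exists_thick_of_short hΓ hA hg hAx
  obtain ⟨v, hv⟩ := eq_diagSL_of_commute (diagSL_ne hA.2 hg) (hg ▸ commute_conj'.2 hAB)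
  obtain ⟨γ, hγ, hγy⟩ := hcov y hy
  obtain ⟨G, rfl⟩ := exists_mk γ
  have hB' : NontrivialLift Γ (G * B * G⁻¹) ∧ ∃ g : SL(2, ℂ), ∃ u : ℂˣ,
      g⁻¹ * (G * B * G⁻¹) * g = diagSL u :=
    ⟨hB.conj hγ, G * g, v, by rw [← hv]; group⟩
  obtain ⟨γ', hγ', h⟩ := hLcov (G * B * G⁻¹) hB' (mob G x) ⟨G * A * G⁻¹, hA.conj hγ,
    commute_conj.2 hAB, by rwa [disp_conj]⟩
  refine ⟨γ' * (G : PSL(2, ℂ)), Γ.mul_mem hγ' hγ, mem_iUnion₂.2 ⟨G * B * G⁻¹, ⟨hB', mob G y, hγy,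
    by rwa [disp_conj]⟩, ?_⟩⟩
  rw [mul_smul]; exact h

end

section

variable {Γ : Subgroup PSL(2, ℂ)}

/-! ### Cusps -/

/-- `B` lies in `h Γ h⁻¹`. -/
def InConj (Γ : Subgroup PSL(2, ℂ)) (h B : SL(2, ℂ)) : Prop :=
  ((h⁻¹ * B * h : SL(2, ℂ)) : PSL(2, ℂ)) ∈ Γ

theorem InConj.mul {h A B : SL(2, ℂ)} (hA : InConj Γ h A) (hB : InConj Γ h B) :
    InConj Γ h (A * B) := by
  have : h⁻¹ * (A * B) * h = (h⁻¹ * A * h) * (h⁻¹ * B * h) := by group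
  rw [InConj, this]
  exact Γ.mul_mem hA hB

theorem InConj.inv {h A : SL(2, ℂ)} (hA : InConj Γ h A) : InConj Γ h A⁻¹ := by
  have : h⁻¹ * A⁻¹ * h = (h⁻¹ * A * h)⁻¹ := by group
  rw [InConj, this]
  exact Γ.inv_mem hA

theorem InConj.nontrivial {h A : SL(2, ℂ)} (hA : InConj Γ h A) (hne : (A : PSL(2, ℂ)) ≠ 1) :
    NontrivialLift Γ (h⁻¹ * A * h) := by
  refine ⟨hA, fun h1 => hne ?_⟩
  have e : ((h⁻¹ * A * h : SL(2, ℂ)) : PSL(2, ℂ)) =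
    (h : PSL(2, ℂ))⁻¹ * (A : PSL(2, ℂ)) * ((h : PSL(2, ℂ))⁻¹)⁻¹ := by rw [inv_inv]; rfl
  rw [e] at h1
  exact conj_eq_one_iff.1 h1

theorem mk_transSL_ne_one {w : ℂ} (hw : w ≠ 0) : (transSL w : PSL(2, ℂ)) ≠ 1 := by
  rw [Ne, mk_eq_one]
  rintro (h | h)
  · exact hw (by simpa using congrArg (fun M : SL(2, ℂ) => M 0 1) h)
  · exact hw (by simpa using congrArg (fun M : SL(2, ℂ) => M 0 1) h)

/-- The translations in `h Γ h⁻¹`. -/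
def cuspLattice (Γ : Subgroup PSL(2, ℂ)) (h : SL(2, ℂ)) : AddSubgroup ℂ where
  carrier := {w | InConj Γ h (transSL w)}
  zero_mem' := by
    have : transSL 0 = 1 := by apply SL2_ext <;> simp
    change InConj Γ h (transSL 0)
    rw [this, InConj]
    simp
  add_mem' := fun {a b} ha hb => by
    change InConj Γ h (transSL (a + b))
    rw [transSL_add]; exact InConj.mul ha hb
  neg_mem' := fun {a} ha => by
    change InConj Γ h (transSL (-a))
    rw [transSL_neg]; exact InConj.inv ha

theorem mem_cuspLattice {h : SL(2, ℂ)} {w : ℂ} : w ∈ cuspLattice Γ h ↔ InConj Γ h (transSL w) :=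
  Iff.rfl

theorem finite_conj_disp_le (hΓ : IsCusped Γ) (h : SL(2, ℂ)) {K : Set H3} (hK : IsCompact K)
    (r : ℝ) : {B : SL(2, ℂ) | InConj Γ h B ∧ ∃ x ∈ K, disp B x ≤ r}.Finite := by
  have hfin := finite_disp_le hΓ.properlyDiscontinuous
    (hK.image (continuous_mob h⁻¹)) r
  refine Set.Finite.subset (hfin.image fun A => h * A * h⁻¹) ?_
  rintro B ⟨hB, x, hx, hd⟩
  refine ⟨h⁻¹ * B * h, ⟨hB, mob h⁻¹ x, ⟨x, hx, rfl⟩, ?_⟩, by group⟩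
  rw [disp_conj', mob_mob_inv]; exact hd

/-- Translations of bounded length have bounded `disp` at the base point, so only finitely many
compete. -/
theorem exists_shortest (hΓ : IsCusped Γ) {h : SL(2, ℂ)} (hc : ∃ w ∈ cuspLattice Γ h, w ≠ 0) :
    ∃ w ∈ cuspLattice Γ h, w ≠ 0 ∧ ∀ v ∈ cuspLattice Γ h, v ≠ 0 → ‖w‖ ≤ ‖v‖ := by
  obtain ⟨w₀, hw₀, hne⟩ := hc
  have hfin : {w : ℂ | w ∈ cuspLattice Γ h ∧ w ≠ 0 ∧ ‖w‖ ≤ ‖w₀‖}.Finite := by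
    have hfin := finite_conj_disp_le hΓ h (isCompact_singleton (x := basePoint)) (‖w₀‖ ^ 2)
    refine (hfin.image fun B : SL(2, ℂ) => B 0 1).subset ?_
    rintro w ⟨hw, -, hle⟩
    refine ⟨transSL w, ⟨hw, _, rfl, ?_⟩, rfl⟩
    rw [disp_transSL, Complex.normSq_eq_norm_sq]
    simpa [basePoint] using pow_le_pow_left₀ (norm_nonneg w) hle 2
  obtain ⟨w, ⟨hw, hw0, hle⟩, hmin⟩ := Set.exists_min_image _ (fun w : ℂ => ‖w‖) hfin
    ⟨w₀, hw₀, hne, le_rfl⟩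
  refine ⟨w, hw, hw0, fun v hv hv0 => ?_⟩
  rcases le_or_gt ‖v‖ ‖w₀‖ with h1 | h1
  · exact hmin v ⟨hv, hv0, h1⟩
  · exact hle.trans h1.le

theorem upper_conj_transSL {A : SL(2, ℂ)} (hA : A 1 0 = 0) (w : ℂ) :
    A * transSL w * A⁻¹ = transSL (A 0 0 ^ 2 * w) := by
  rw [mul_inv_eq_iff_eq_mul]
  have h := mul_eq_one_of_upper hA
  apply SL2_ext
  · simp [mul_apply00, hA]
  · simp only [mul_apply01, transSL_00, transSL_01, transSL_11]
    linear_combination -A 0 0 * w * h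
  · simp [mul_apply10, hA]
  · simp [mul_apply11, hA]

/-- The stabilizer of a cusp consists of translations. -/
theorem exists_eq_translation (hΓ : IsCusped Γ) {h : SL(2, ℂ)}
    (hc : ∃ w ∈ cuspLattice Γ h, w ≠ 0) {B : SL(2, ℂ)} (hB : InConj Γ h B) (h10 : B 1 0 = 0) :
    ∃ v ∈ cuspLattice Γ h, (B = transSL v ∨ B = -transSL v) := by
  obtain ⟨w, hw, hw0, hmin⟩ := exists_shortest hΓ hc
  have hdet := mul_eq_one_of_upper h10
  have ha0 : B 0 0 ≠ 0 := left_ne_zero_of_mul_eq_one hdet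
  have hwpos : 0 < ‖w‖ := norm_pos_iff.2 hw0
  -- Conjugation by B multiplies the lattice by a², and w is shortest, so |a| ≥ 1. The same for B⁻¹
  -- gives |d| ≥ 1, and ad = 1.
  have h1 : 1 ≤ ‖B 0 0‖ := by
    have hmem : B 0 0 ^ 2 * w ∈ cuspLattice Γ h := by
      rw [mem_cuspLattice, ← upper_conj_transSL h10]
      exact (hB.mul hw).mul hB.inv
    have := hmin _ hmem (mul_ne_zero (pow_ne_zero 2 ha0) hw0)
    rw [norm_mul, norm_pow] at this
    by_contra hlt
    push Not at hlt
    nlinarith [norm_nonneg (B 0 0), pow_lt_one₀ (norm_nonneg (B 0 0)) hlt two_ne_zero]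
  obtain ⟨i00, i01, i10, i11⟩ := coe_inv_apply B
  have h2 : 1 ≤ ‖B 1 1‖ := by
    have h10' : B⁻¹ 1 0 = 0 := by rw [i10, h10, neg_zero]
    have hmem : B⁻¹ 0 0 ^ 2 * w ∈ cuspLattice Γ h := by
      rw [mem_cuspLattice, ← upper_conj_transSL h10']
      exact (hB.inv.mul hw).mul hB.inv.inv
    rw [i00] at hmem
    have := hmin _ hmem (mul_ne_zero (pow_ne_zero 2 (right_ne_zero_of_mul_eq_one hdet)) hw0)
    rw [norm_mul, norm_pow] at this
    by_contra hlt
    push Not at hlt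
    nlinarith [norm_nonneg (B 1 1), pow_lt_one₀ (norm_nonneg (B 1 1)) hlt two_ne_zero]
  have hprod : ‖B 0 0‖ * ‖B 1 1‖ = 1 := by rw [← norm_mul, hdet, norm_one]
  have hn : ‖B 0 0‖ = 1 := by nlinarith
  have hsq : Complex.normSq (B 0 0) = 1 := by rw [Complex.normSq_eq_norm_sq, hn, one_pow]
  by_cases ha : B 0 0 ^ 2 = 1
  · have hval : ∀ v, (B = transSL v ∨ B = -transSL v) → v ∈ cuspLattice Γ h := by
      rintro v (h3 | h3)
      · rw [mem_cuspLattice, ← h3]; exact hB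
      · have : (h⁻¹ * transSL v * h) = -(h⁻¹ * B * h) := by rw [h3]; simp
        rw [mem_cuspLattice, InConj, this, mk_eq_mk.2 (Or.inr rfl : -(h⁻¹ * B * h) = _ ∨ _)]
        exact hB
    have h11 : ∀ ε : ℂ, ε * ε = 1 → B 0 0 = ε → B 1 1 = ε := by
      rintro ε hε rfl
      exact mul_left_cancel₀ ha0 (hdet.trans hε.symm)
    rcases mul_self_eq_one_iff.1 ((sq _).symm.trans ha) with h3 | h3
    · have h4 : B = transSL (B 0 1) := by
        apply SL2_ext <;> simp [h3, h10, h11 1 (by norm_num) h3]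
      exact ⟨_, hval _ (Or.inl h4), Or.inl h4⟩
    · have h4 : B = -transSL (-B 0 1) := by
        apply SL2_ext <;> simp [h3, h10, h11 (-1) (by norm_num) h3]
      exact ⟨_, hval _ (Or.inr h4), Or.inr h4⟩
  · exfalso
    have hne : (B : PSL(2, ℂ)) ≠ 1 := by
      intro h3
      apply ha
      rcases mk_eq_one.1 h3 with h3 | h3 <;> rw [h3] <;> simp
    have ha' : 1 - B 0 0 ^ 2 ≠ 0 := sub_ne_zero.2 (Ne.symm ha)
    -- If a² ≠ 1, then z ↦ a² z + ab rotates about its finite fixed point, and B fixes the points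
    -- over it, against freeness.
    set p : H3 := ofCoords (B 0 0 * B 0 1 / (1 - B 0 0 ^ 2)) 1 one_pos with hp
    have hfix : mob B p = p := by
      apply H3.ext_coords
      · rw [horiz_upper h10, hp, horiz_ofCoords]
        field_simp
        ring
      · rw [height_upper h10, hsq, one_mul]
    refine mob_ne hΓ (hB.nontrivial hne) (mob h⁻¹ p) ?_
    rw [mob_mul, mob_mob_inv, mob_mul, hfix]

theorem disp_neg_transSL (w : ℂ) (x : H3) : 8 ≤ disp (-transSL w) x := by
  have h := sep_nonneg x (mob (transSL w) x)
  have h1 : (-transSL w) 0 0 = -1 := by simp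
  have h2 : (-transSL w) 1 1 = -1 := by simp
  rw [disp, mob_neg, h1, h2]
  norm_num
  linarith

theorem commute_transSL {w : ℂ} (hw : w ≠ 0) {B : SL(2, ℂ)} (h : Commute (transSL w) B) :
    B 1 0 = 0 := by
  obtain ⟨h1, -, -⟩ := commute_iff.1 h
  simpa [hw] using h1

theorem exists_higher {U : Set H3} (hU : IsOpen U) {p : H3} (hp : p ∈ U) :
    ∃ q ∈ U, height p < height q := by
  have ho : IsOpen (Subtype.val '' U : Set E3) := upperHalfSpace.isOpen.isOpenMap_subtype_val U hU
  have hc : Continuous fun s : ℝ => (p : E3) + s • EuclideanSpace.single (2 : Fin 3) (1 : ℝ) := by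
    fun_prop
  have h0 : (0 : ℝ) ∈ (fun s : ℝ => (p : E3) + s • EuclideanSpace.single (2 : Fin 3) (1 : ℝ)) ⁻¹'
      (Subtype.val '' U) := ⟨p, hp, by simp⟩
  have hev : ∀ᶠ s : ℝ in nhdsWithin 0 (Ioi 0), s ∈ (fun s : ℝ => (p : E3) +
      s • EuclideanSpace.single (2 : Fin 3) (1 : ℝ)) ⁻¹' (Subtype.val '' U) :=
    mem_nhdsWithin_of_mem_nhds ((ho.preimage hc).mem_nhds h0)
  obtain ⟨s, ⟨q, hq, hqs⟩, hs⟩ := (hev.and self_mem_nhdsWithin).exists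
  have hs : 0 < s := hs
  refine ⟨q, hq, ?_⟩
  have h2 := congrArg (fun x : E3 => x 2) hqs
  simp only [PiLp.add_apply, PiLp.smul_apply, PiLp.single_apply, if_true, smul_eq_mul,
    mul_one] at h2
  change (p : E3) 2 < (q : E3) 2
  linarith

/-- Points at height `10 ‖w‖` over a cusp with shortest translation `w` are thick. -/
theorem thick_of_height_le (hΓ : IsCusped Γ) {h : SL(2, ℂ)} {w : ℂ} (hw : w ∈ cuspLattice Γ h)
    (hw0 : w ≠ 0) (hmin : ∀ v ∈ cuspLattice Γ h, v ≠ 0 → ‖w‖ ≤ ‖v‖) (p : H3)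
    (hp : height p = 10 * ‖w‖) : Thick Γ (mob h⁻¹ p) := by
  have hc : ∃ w ∈ cuspLattice Γ h, w ≠ 0 := ⟨w, hw, hw0⟩
  have hwpos : 0 < ‖w‖ := norm_pos_iff.2 hw0
  intro A hA
  by_contra hlt
  push Not at hlt
  set B := h * A * h⁻¹ with hB
  have hAB : A = h⁻¹ * B * h := by rw [hB]; group
  have hBΓ : InConj Γ h B := by rw [InConj, ← hAB]; exact hA.1
  have hBp : disp B p < 1 / 100 := by
    rw [hAB, disp_conj', mob_mob_inv] at hlt; exact hlt
  -- At p the translation by w has `disp` exactly 1/100. A slightly higher point makes it strictly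
  -- short while B stays short.
  obtain ⟨q, hq, hpq⟩ := exists_higher (isOpen_lt (continuous_disp B) continuous_const) hBp
  have hTq : disp (transSL w) q < 1 / 100 := by
    rw [disp_transSL, Complex.normSq_eq_norm_sq, div_lt_iff₀ (pow_pos (height_pos q) 2)]
    rw [hp] at hpq
    nlinarith
  have hBne : (B : PSL(2, ℂ)) ≠ 1 := by
    intro h1
    have := hA.2
    apply this
    rw [hAB]
    change (h : PSL(2, ℂ))⁻¹ * (B : PSL(2, ℂ)) * h = 1
    rw [h1, mul_one, inv_mul_cancel]
  have hcomm : Commute (transSL w) B := by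
    rw [← commute_conj' (g := h)]
    refine commute_of_short hΓ (x := mob h⁻¹ q) (InConj.nontrivial hw (mk_transSL_ne_one hw0))
      (hBΓ.nontrivial hBne) ?_ ?_
    · rwa [disp_conj', mob_mob_inv]
    · rw [disp_conj', mob_mob_inv]; exact hq
  obtain ⟨v, hv, hBv | hBv⟩ := exists_eq_translation hΓ hc hBΓ (commute_transSL hw0 hcomm)
  · have hv0 : v ≠ 0 := by
      rintro rfl
      exact hBne (mk_eq_one.2 (Or.inl (by rw [hBv]; apply SL2_ext <;> simp)))
    have := hmin v hv hv0
    rw [hBv, disp_transSL, Complex.normSq_eq_norm_sq, div_lt_iff₀ (pow_pos (height_pos p) 2)] at hBp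
    nlinarith
  · rw [hBv] at hBp
    linarith [disp_neg_transSL v p]

/-- The horizontal displacements by the lattice of a cusp have bounded fundamental domains. -/
theorem exists_cocompact (hΓ : IsCusped Γ) {h : SL(2, ℂ)} (hc : ∃ w ∈ cuspLattice Γ h, w ≠ 0) :
    ∃ R : ℝ, ∀ z : ℂ, ∃ v ∈ cuspLattice Γ h, ‖z + v‖ ≤ R := by
  obtain ⟨w, hw, hw0, hmin⟩ := exists_shortest hΓ hc
  have hwpos : 0 < 10 * ‖w‖ := by have := norm_pos_iff.2 hw0; positivity
  obtain ⟨K, hK, hcov⟩ := relCompact_Thick hΓ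
  have hfin := finite_disp_le hΓ.properlyDiscontinuous hK (1 / 100)
  have hz : ∀ z : ℂ, ∃ G : SL(2, ℂ), (G : PSL(2, ℂ)) ∈ Γ ∧
      mob G (mob h⁻¹ (ofCoords z _ hwpos)) ∈ K := by
    intro z
    obtain ⟨γ, hγ, hγK⟩ := hcov _ (thick_of_height_le hΓ hw hw0 hmin (ofCoords z _ hwpos)
      (height_ofCoords _ _ _))
    obtain ⟨G, rfl⟩ := exists_mk γ
    exact ⟨G, hγ, hγK⟩
  choose G hG hGK using hz
  -- T z is a conjugate of the translation by w with `disp` 1/100 at a point of K, so it takes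
  -- finitely many values.
  set T : ℂ → SL(2, ℂ) := fun z => G z * (h⁻¹ * transSL w * h) * (G z)⁻¹ with hT
  have hTfin : (range T).Finite := by
    refine hfin.subset ?_
    rintro _ ⟨z, rfl⟩
    refine ⟨((InConj.nontrivial hw (mk_transSL_ne_one hw0)).conj (hG z)).1, _, hGK z, ?_⟩
    simp only [hT]
    rw [disp_conj, disp_conj', mob_mob_inv, disp_transSL, height_ofCoords,
      Complex.normSq_eq_norm_sq, div_le_iff₀ (by positivity)]
    linarith [sq_nonneg ‖w‖]
  have hbd : ∀ z₀ : ℂ, ∃ R : ℝ, ∀ p ∈ (fun x => mob h (mob (G z₀)⁻¹ x)) '' K, ‖horiz p‖ ≤ R := by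
    intro z₀
    have hK' := hK.image ((continuous_mob h).comp (continuous_mob (G z₀)⁻¹))
    exact hK'.exists_bound_of_continuousOn continuous_horiz.continuousOn
  choose R hR using hbd
  have hrep : ∀ B ∈ range T, ∃ z₀, T z₀ = B := fun B hB => hB
  choose! rep hrep using hrep
  obtain ⟨M, hM⟩ := (hTfin.image fun B => R (rep B)).bddAbove
  refine ⟨M, fun z => ?_⟩
  set z₀ := rep (T z) with hz₀
  have hTz : T z₀ = T z := hrep (T z) ⟨z, rfl⟩
  -- Equality of T z₀ and T z means that S commutes with the translation by w, so S is itself a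
  -- translation of the lattice. It moves z into the horizontal shadow of a compact set depending on
  -- z₀ only.
  set S := h * ((G z₀)⁻¹ * G z) * h⁻¹ with hS
  have hSΓ : InConj Γ h S := by
    have : h⁻¹ * S * h = (G z₀)⁻¹ * G z := by rw [hS]; group
    rw [InConj, this]
    exact Γ.mul_mem (Γ.inv_mem (hG z₀)) (hG z)
  have hcomm : Commute (transSL w) S := by
    have h1 : G z₀ * (h⁻¹ * transSL w * h) * (G z₀)⁻¹ = G z * (h⁻¹ * transSL w * h) * (G z)⁻¹ := hTz
    have h2 : transSL w * S = h * (G z₀)⁻¹ * (G z₀ * (h⁻¹ * transSL w * h) * (G z₀)⁻¹) * G z * h⁻¹ := by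
      rw [hS]; group
    have h3 : S * transSL w = h * (G z₀)⁻¹ * (G z * (h⁻¹ * transSL w * h) * (G z)⁻¹) * G z * h⁻¹ := by
      rw [hS]; group
    change transSL w * S = S * transSL w
    rw [h2, h3, h1]
  obtain ⟨v, hv, hSv⟩ := exists_eq_translation hΓ hc hSΓ (commute_transSL hw0 hcomm)
  refine ⟨v, hv, ?_⟩
  have hmob : mob S (ofCoords z _ hwpos) = mob (transSL v) (ofCoords z _ hwpos) := by
    rcases hSv with h1 | h1 <;> rw [h1]
    rw [mob_neg]
  have h4 := hR z₀ (mob S (ofCoords z _ hwpos)) ⟨_, hGK z, by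
    simp only [← mob_mul]
    congr 1
    rw [hS]; group⟩
  rw [hmob, horiz_transSL, horiz_ofCoords] at h4
  exact h4.trans (hM ⟨T z, ⟨z, rfl⟩, rfl⟩)

/-- There are only finitely many cusps modulo `Γ`. -/
theorem exists_finite_cusps (hΓ : IsCusped Γ) : ∃ F : Set SL(2, ℂ), F.Finite ∧
    ∀ h : SL(2, ℂ), (∃ w ∈ cuspLattice Γ h, w ≠ 0) → ∃ B ∈ F, ∃ G : SL(2, ℂ), ∃ w : ℂ, w ≠ 0 ∧
      (G : PSL(2, ℂ)) ∈ Γ ∧ G * (h⁻¹ * transSL w * h) * G⁻¹ = B := by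
  obtain ⟨K, hK, hcov⟩ := relCompact_Thick hΓ
  refine ⟨_, finite_disp_le hΓ.properlyDiscontinuous hK (1 / 100), fun h hc => ?_⟩
  obtain ⟨w, hw, hw0, hmin⟩ := exists_shortest hΓ hc
  have hwpos : 0 < 10 * ‖w‖ := by have := norm_pos_iff.2 hw0; positivity
  -- A point at height 10‖w‖ is thick, and the translation by w has `disp` 1/100 there; a conjugate
  -- by Γ then belongs to the finite set attached to K.
  obtain ⟨γ, hγ, hγK⟩ := hcov _ (thick_of_height_le hΓ hw hw0 hmin (ofCoords 0 _ hwpos)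
    (height_ofCoords _ _ _))
  obtain ⟨G, rfl⟩ := exists_mk γ
  refine ⟨_, ⟨?_, _, hγK, ?_⟩, G, w, hw0, hγ, rfl⟩
  · exact ((InConj.nontrivial hw (mk_transSL_ne_one hw0)).conj hγ).1
  · change disp _ (mob G _) ≤ _
    rw [disp_conj, disp_conj', mob_mob_inv, disp_transSL, height_ofCoords,
      Complex.normSq_eq_norm_sq, div_le_iff₀ (by positivity)]
    linarith [sq_nonneg ‖w‖]

/-- A nontrivial translation fixes only ∞ on the boundary, and S carries the fixed point of one to
that of the other. -/
theorem upper_of_conj_transSL {S : SL(2, ℂ)} {w w' : ℂ} (hw' : w' ≠ 0)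
    (h : S * transSL w' * S⁻¹ = transSL w) : S 1 0 = 0 := by
  rw [mul_inv_eq_iff_eq_mul] at h
  have h10 := congrArg (fun M : SL(2, ℂ) => M 1 0) h
  have h11 := congrArg (fun M : SL(2, ℂ) => M 1 1) h
  simp only [mul_apply11, transSL_01, transSL_11, transSL_10] at h11
  have : S 1 0 * w' = 0 := by linear_combination h11
  exact (mul_eq_zero.1 this).resolve_right hw'

/-! ### Lower left entries -/

/-- Otherwise the conjugated group acts by translations only and preserves heights. Then all points
at height at most 10‖w‖ are thick, and arbitrarily low ones cannot be moved into a compact set. -/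
theorem exists_not_upper (hΓ : IsCusped Γ) {h : SL(2, ℂ)} (hc : ∃ w ∈ cuspLattice Γ h, w ≠ 0) :
    ∃ B : SL(2, ℂ), InConj Γ h B ∧ B 1 0 ≠ 0 := by
  by_contra hcon
  push Not at hcon
  obtain ⟨w, hw, hw0, hmin⟩ := exists_shortest hΓ hc
  have hwpos : 0 < ‖w‖ := norm_pos_iff.2 hw0
  obtain ⟨K, hK, hcov⟩ := relCompact_Thick hΓ
  have hK' := hK.image (continuous_mob h)
  have hinv : ContinuousOn (fun p => (height p)⁻¹) (mob h '' K) :=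
    (continuous_height.inv₀ fun p => (height_pos p).ne').continuousOn
  obtain ⟨R, hR⟩ := hK'.exists_bound_of_continuousOn hinv
  -- The first bound makes the point thick; the second puts it below every point of the compact set,
  -- on which 1 / t is at most R.
  have htpos : 0 < min (10 * ‖w‖) (1 / (|R| + 1)) := by positivity
  set p : H3 := ofCoords 0 _ htpos with hp
  have hheight : ∀ B, InConj Γ h B → ∃ v ∈ cuspLattice Γ h, (B = transSL v ∨ B = -transSL v) :=
    fun B hB => exists_eq_translation hΓ hc hB (hcon B hB)
  have hthick : Thick Γ (mob h⁻¹ p) := by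
    intro A hA
    have hAB : A = h⁻¹ * (h * A * h⁻¹) * h := by group
    have hBΓ : InConj Γ h (h * A * h⁻¹) := by rw [InConj, ← hAB]; exact hA.1
    obtain ⟨v, hv, hBv⟩ := hheight _ hBΓ
    rw [hAB, disp_conj', mob_mob_inv]
    rcases hBv with hBv | hBv
    · have hv0 : v ≠ 0 := by
        rintro rfl
        apply hA.2
        have h1 : transSL 0 = 1 := by apply SL2_ext <;> simp
        rw [hAB, hBv, h1]
        exact mk_eq_one.2 (Or.inl (by group))
      have h1 := hmin v hv hv0
      rw [hBv, disp_transSL, Complex.normSq_eq_norm_sq, le_div_iff₀ (pow_pos (height_pos p) 2)]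
      have h2 : height p ≤ 10 * ‖w‖ := by rw [hp, height_ofCoords]; exact min_le_left _ _
      have h3 := height_pos p
      nlinarith
    · rw [hBv]; linarith [disp_neg_transSL v p]
  obtain ⟨γ, hγ, hγK⟩ := hcov _ hthick
  obtain ⟨G, rfl⟩ := exists_mk γ
  have hBΓ : InConj Γ h (h * G * h⁻¹) := by
    have : h⁻¹ * (h * G * h⁻¹) * h = G := by group
    rw [InConj, this]; exact hγ
  obtain ⟨v, hv, hBv⟩ := hheight _ hBΓ
  have hmob : mob h (mob G (mob h⁻¹ p)) = mob (transSL v) p := by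
    rw [← mob_mul, ← mob_mul]
    rcases hBv with h1 | h1 <;> rw [h1]
    rw [mob_neg]
  have h5 := hR _ ⟨_, hγK, hmob⟩
  rw [height_transSL, hp, height_ofCoords, Real.norm_of_nonneg (by positivity),
    inv_le_comm₀ htpos (lt_of_lt_of_le (by positivity) h5)] at h5
  have h6 : 1 / (|R| + 1) < R⁻¹ := by
    have hRpos : 0 < R := by
      have := hR _ ⟨_, hγK, hmob⟩
      rw [height_transSL, hp, height_ofCoords, Real.norm_of_nonneg (by positivity)] at this
      exact lt_of_lt_of_le (by positivity) this
    rw [one_div, abs_of_pos hRpos]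
    exact inv_strictAnti₀ hRpos (by linarith)
  exact absurd (h5.trans (min_le_right _ _)) (not_le.2 h6)

/-- The image of the point over the pole of `B`. -/
theorem mob_pole {B : SL(2, ℂ)} (hc : B 1 0 ≠ 0) {s : ℝ} (hs : 0 < s) :
    horiz (mob B (ofCoords (-(B 1 1) / B 1 0) s hs)) = B 0 0 / B 1 0 ∧
    height (mob B (ofCoords (-(B 1 1) / B 1 0) s hs)) = 1 / (Complex.normSq (B 1 0) * s) := by
  have hz : B 1 0 * (-(B 1 1) / B 1 0) + B 1 1 = 0 := by field_simp; ring
  have hn : Complex.normSq (B 1 0) ≠ 0 := (Complex.normSq_pos.2 hc).ne'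
  have hsc : (s : ℂ) ≠ 0 := by exact_mod_cast hs.ne'
  constructor
  · rw [horiz_mob, mobDenom, mobNum, horiz_ofCoords, hz, height_ofCoords]
    simp only [map_zero, mul_zero, zero_add, Complex.ofReal_mul, Complex.ofReal_pow,
      ← Complex.mul_conj]
    have hcc : (starRingEnd ℂ) (B 1 0) ≠ 0 := by simpa using hc
    field_simp
  · rw [height_mob, mobDenom, horiz_ofCoords, hz, height_ofCoords]
    simp only [map_zero, zero_add]
    field_simp

/-- A form of Shimizu's lemma. If |c| were smaller, the point at height 1 / |c| over B∞ and its
preimage under B would both lie above 10‖w‖. The translation by w and its conjugate by B would be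
short there and commute, so B would fix ∞. -/
theorem normSq_lower_left_ge (hΓ : IsCusped Γ) {h : SL(2, ℂ)} {w : ℂ} (hw : w ∈ cuspLattice Γ h)
    (hw0 : w ≠ 0) {B : SL(2, ℂ)} (hB : InConj Γ h B) (hc : B 1 0 ≠ 0) :
    1 ≤ 10 * ‖w‖ * ‖B 1 0‖ := by
  by_contra hlt
  push Not at hlt
  have hwpos : 0 < ‖w‖ := norm_pos_iff.2 hw0
  have hcpos : 0 < ‖B 1 0‖ := norm_pos_iff.2 hc
  set s : ℝ := 1 / ‖B 1 0‖ with hs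
  have hspos : 0 < s := by positivity
  have hs1 : 10 * ‖w‖ < s := by rw [hs, lt_div_iff₀ hcpos]; exact hlt
  obtain ⟨i00, i01, i10, i11⟩ := coe_inv_apply B
  have hci : B⁻¹ 1 0 ≠ 0 := by rw [i10]; exact neg_ne_zero.2 hc
  set q : H3 := ofCoords (-(B⁻¹ 1 1) / B⁻¹ 1 0) s hspos with hq
  have hq1 : height q = s := height_ofCoords _ _ _
  have hq2 : height (mob B⁻¹ q) = s := by
    rw [hq, (mob_pole hci hspos).2, i10, Complex.normSq_neg, Complex.normSq_eq_norm_sq, hs]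
    field_simp
  have hshort : ∀ p : H3, height p = s → disp (transSL w) p < 1 / 100 := by
    intro p hp
    rw [disp_transSL, Complex.normSq_eq_norm_sq, hp, div_lt_iff₀ (by positivity)]
    nlinarith
  have h1 : disp (B * transSL w * B⁻¹) q < 1 / 100 := by
    have := disp_conj B (transSL w) (mob B⁻¹ q)
    rw [mob_mob_inv] at this
    rw [this]; exact hshort _ hq2
  have hne : ((B * transSL w * B⁻¹ : SL(2, ℂ)) : PSL(2, ℂ)) ≠ 1 := by
    have e : ((B * transSL w * B⁻¹ : SL(2, ℂ)) : PSL(2, ℂ)) =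
      (B : PSL(2, ℂ)) * (transSL w : PSL(2, ℂ)) * (B : PSL(2, ℂ))⁻¹ := rfl
    rw [e]; intro h1
    exact mk_transSL_ne_one hw0 (conj_eq_one_iff.1 h1)
  have hcomm : Commute (transSL w) (B * transSL w * B⁻¹) := by
    rw [← commute_conj' (g := h)]
    refine commute_of_short hΓ (x := mob h⁻¹ q) (InConj.nontrivial hw (mk_transSL_ne_one hw0))
      (((hB.mul hw).mul hB.inv).nontrivial hne) ?_ ?_
    · rw [disp_conj', mob_mob_inv]; exact hshort _ hq1
    · rwa [disp_conj', mob_mob_inv]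
  have h2 := commute_transSL hw0 hcomm
  simp only [mul_apply10, mul_apply11, transSL_00, transSL_10, transSL_01, transSL_11, i00, i10] at h2
  have h3 : B 1 0 * B 1 0 * w = 0 := by linear_combination -h2
  simp [hc, hw0] at h3

/-- The smallest lower left entry is attained. -/
theorem exists_min_lower_left (hΓ : IsCusped Γ) {h : SL(2, ℂ)}
    (hc : ∃ w ∈ cuspLattice Γ h, w ≠ 0) : ∃ B : SL(2, ℂ), InConj Γ h B ∧ B 1 0 ≠ 0 ∧
      ∀ D : SL(2, ℂ), InConj Γ h D → D 1 0 ≠ 0 → ‖B 1 0‖ ≤ ‖D 1 0‖ := by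
  obtain ⟨w, hw, hw0⟩ := id hc
  have hwpos : 0 < ‖w‖ := norm_pos_iff.2 hw0
  obtain ⟨B₀, hB₀, hB₀c⟩ := exists_not_upper hΓ hc
  obtain ⟨R, hR⟩ := exists_cocompact hΓ hc
  set L := ‖B₀ 1 0‖ with hL
  have hLpos : 0 < L := norm_pos_iff.2 hB₀c
  -- Lattice translations on either side keep c and bring a / c = B∞ and −d / c = B⁻¹∞ into a
  -- bounded set, so a minimum over V is a minimum over all elements.
  set V : Set SL(2, ℂ) := {B | InConj Γ h B ∧ B 1 0 ≠ 0 ∧ ‖B 1 0‖ ≤ L ∧ ‖B 0 0 / B 1 0‖ ≤ R ∧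
    ‖-(B 1 1) / B 1 0‖ ≤ R} with hV
  have hmove : ∀ B, InConj Γ h B → B 1 0 ≠ 0 → ‖B 1 0‖ ≤ L → ∃ D ∈ V, D 1 0 = B 1 0 := by
    intro B hB hBc hBL
    obtain ⟨v, hv, hvR⟩ := hR (B 0 0 / B 1 0)
    obtain ⟨u, hu, huR⟩ := hR (-(B 1 1) / B 1 0)
    have e10 : (transSL v * B * transSL (-u)) 1 0 = B 1 0 := by simp [mul_apply10]
    have e00 : (transSL v * B * transSL (-u)) 0 0 = B 0 0 + v * B 1 0 := by
      simp [mul_apply00]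
    have e11 : (transSL v * B * transSL (-u)) 1 1 = B 1 1 - B 1 0 * u := by
      simp [mul_apply10, mul_apply11]; ring
    refine ⟨transSL v * B * transSL (-u), ⟨?_, ?_, ?_, ?_, ?_⟩, e10⟩
    · exact (InConj.mul hv hB).mul ((cuspLattice Γ h).neg_mem hu)
    · rwa [e10]
    · rwa [e10]
    · rw [e00, e10]
      have : (B 0 0 + v * B 1 0) / B 1 0 = B 0 0 / B 1 0 + v := by field_simp
      rwa [this]
    · rw [e11, e10]
      have : -(B 1 1 - B 1 0 * u) / B 1 0 = -(B 1 1) / B 1 0 + u := by field_simp; ring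
      rwa [this]
  -- B maps the point at height 1 / |c| over B⁻¹∞ to the point at the same height over B∞. Both lie
  -- in one compact box, by the two-sided bound on |c|.
  have hVfin : V.Finite := by
    have hbox := isCompact_box (a := 1 / L) (by positivity) (10 * ‖w‖) (R ^ 2)
    have hfin := finite_mob_mem hΓ.properlyDiscontinuous (hbox.image (continuous_mob h⁻¹))
      (hbox.image (continuous_mob h⁻¹))
    refine (hfin.image fun A => h * A * h⁻¹).subset ?_
    rintro B ⟨hB, hBc, hBL, h1, h2⟩
    have hcpos : 0 < ‖B 1 0‖ := norm_pos_iff.2 hBc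
    have hspos : 0 < 1 / ‖B 1 0‖ := by positivity
    have hlow : 1 / L ≤ 1 / ‖B 1 0‖ := one_div_le_one_div_of_le hcpos hBL
    have hup : 1 / ‖B 1 0‖ ≤ 10 * ‖w‖ := by
      rw [div_le_iff₀ hcpos]; exact normSq_lower_left_ge hΓ hw hw0 hB hBc
    obtain ⟨m1, m2⟩ := mob_pole hBc hspos
    refine ⟨h⁻¹ * B * h, ⟨hB, mob h⁻¹ (ofCoords (-(B 1 1) / B 1 0) _ hspos), ⟨_, ⟨?_, ?_, ?_⟩, rfl⟩,
      ⟨mob B (ofCoords (-(B 1 1) / B 1 0) _ hspos), ⟨?_, ?_, ?_⟩, ?_⟩⟩, by group⟩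
    · rwa [height_ofCoords]
    · rwa [height_ofCoords]
    · rw [horiz_ofCoords, Complex.normSq_eq_norm_sq]
      exact pow_le_pow_left₀ (norm_nonneg _) h2 2
    · rw [m2, Complex.normSq_eq_norm_sq]
      have : 1 / (‖B 1 0‖ ^ 2 * (1 / ‖B 1 0‖)) = 1 / ‖B 1 0‖ := by field_simp
      rwa [this]
    · rw [m2, Complex.normSq_eq_norm_sq]
      have : 1 / (‖B 1 0‖ ^ 2 * (1 / ‖B 1 0‖)) = 1 / ‖B 1 0‖ := by field_simp
      rwa [this]
    · rw [m1, Complex.normSq_eq_norm_sq]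
      exact pow_le_pow_left₀ (norm_nonneg _) h1 2
    · rw [mob_mul, mob_mob_inv, mob_mul]
  obtain ⟨D₀, hD₀, -⟩ := hmove B₀ hB₀ hB₀c le_rfl
  obtain ⟨B, hBV, hmin⟩ := Set.exists_min_image V (fun B : SL(2, ℂ) => ‖B 1 0‖) hVfin ⟨D₀, hD₀⟩
  refine ⟨B, hBV.1, hBV.2.1, fun D hD hDc => ?_⟩
  rcases le_or_gt ‖D 1 0‖ L with h1 | h1
  · obtain ⟨D', hD', e⟩ := hmove D hD hDc h1
    have := hmin D' hD'
    simp only [e] at this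
    exact this
  · exact hBV.2.2.1.trans h1.le

end

/-! ### Bases of planar lattices -/

/-- Λ spans over ℝ: a functional vanishing on Λ is bounded, because every z differs from a lattice
point by at most R, and a bounded functional is 0. -/
theorem exists_lattice_basis (Λ : AddSubgroup ℂ) {δ R : ℝ} (hδ : 0 < δ)
    (hmin : ∀ v ∈ Λ, v ≠ 0 → δ ≤ ‖v‖) (hR : ∀ z : ℂ, ∃ v ∈ Λ, ‖z + v‖ ≤ R) :
    ∃ μ ν : ℂ, LinearIndependent ℝ ![μ, ν] ∧
      ∀ v, v ∈ Λ ↔ ∃ m n : ℤ, v = m * μ + n * ν := by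
  set L : Submodule ℤ ℂ := AddSubgroup.toIntSubmodule Λ with hL
  have hmem : ∀ v, v ∈ L ↔ v ∈ Λ := fun v => Iff.rfl
  have hdisc : DiscreteTopology L := by
    refine DiscreteTopology.of_forall_le_dist hδ fun v w hvw => ?_
    change δ ≤ dist v w
    rw [Subtype.dist_eq, dist_eq_norm]
    refine hmin _ (Λ.sub_mem v.2 w.2) (sub_ne_zero.2 fun h => hvw (Subtype.ext h))
  have hspan : Submodule.span ℝ (L : Set ℂ) = ⊤ := by
    by_contra hne
    obtain ⟨f, hf0, hf⟩ := Submodule.exists_le_ker_of_lt_top _ (lt_top_iff_ne_top.2 hne)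
    obtain ⟨z, hz⟩ : ∃ z, f z ≠ 0 := by
      by_contra hcon
      push Not at hcon
      exact hf0 (LinearMap.ext hcon)
    have hbound : ∀ c : ℝ, |c| * |f z| ≤ ‖LinearMap.toContinuousLinearMap f‖ * R := by
      intro c
      obtain ⟨v, hv, hvR⟩ := hR (c • z)
      have h1 : f v = 0 := hf (Submodule.subset_span ((hmem v).2 hv))
      have h2 := (LinearMap.toContinuousLinearMap f).le_opNorm (c • z + v)
      have h3 : (LinearMap.toContinuousLinearMap f) (c • z + v) = c * f z := by
        change f (c • z + v) = _
        rw [map_add, map_smul, h1, add_zero, smul_eq_mul]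
      rw [h3, norm_mul, Real.norm_eq_abs, Real.norm_eq_abs] at h2
      exact h2.trans (mul_le_mul_of_nonneg_left hvR (norm_nonneg _))
    have hz' : 0 < |f z| := abs_pos.2 hz
    have h4 := hbound ((‖LinearMap.toContinuousLinearMap f‖ * R + 1) / |f z|)
    have h5 := hbound 0
    rw [abs_zero, zero_mul] at h5
    rw [abs_of_nonneg (by positivity), div_mul_cancel₀ _ hz'.ne'] at h4
    linarith
  have hz : IsZLattice ℝ L := ⟨hspan⟩
  have hfin : Module.Finite ℤ L := ZLattice.module_finite ℝ L
  have hfree : Module.Free ℤ L := ZLattice.module_free ℝ L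
  have hrank : Module.finrank ℤ L = 2 := by
    rw [ZLattice.rank ℝ L, Complex.finrank_real_complex]
  let b := Module.finBasisOfFinrankEq ℤ L hrank
  let b' := b.ofZLatticeBasis ℝ L
  refine ⟨b 0, b 1, ?_, fun v => ?_⟩
  · have h := b'.linearIndependent
    have e : (b' : Fin 2 → ℂ) = ![(b 0 : ℂ), (b 1 : ℂ)] := by
      funext i
      fin_cases i <;> simp [b']
    rwa [e] at h
  · constructor
    · intro hv
      have h := b.sum_repr ⟨v, (hmem v).2 hv⟩
      rw [Fin.sum_univ_two] at h
      have h2 := congrArg Subtype.val h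
      refine ⟨b.repr ⟨v, (hmem v).2 hv⟩ 0, b.repr ⟨v, (hmem v).2 hv⟩ 1, ?_⟩
      simpa using h2.symm
    · rintro ⟨m, n, rfl⟩
      have h0 : (b 0 : ℂ) ∈ Λ := (b 0).2
      have h1 : (b 1 : ℂ) ∈ Λ := (b 1).2
      have h := Λ.add_mem (Λ.zsmul_mem h0 m) (Λ.zsmul_mem h1 n)
      simpa using h

section

variable {Γ : Subgroup PSL(2, ℂ)}

/-! ### Normalization of cusps -/

theorem inConj_diagSL_mul {h B : SL(2, ℂ)} (u : ℂˣ) :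
    InConj Γ (diagSL u * h) B ↔ InConj Γ h (diagSL u⁻¹ * B * diagSL u) := by
  have : (diagSL u * h)⁻¹ * B * (diagSL u * h) = h⁻¹ * (diagSL u⁻¹ * B * diagSL u) * h := by
    rw [diagSL_inv]; group
  rw [InConj, InConj, this]

theorem diagSL_conj_10 (u : ℂˣ) (B : SL(2, ℂ)) :
    (diagSL u⁻¹ * B * diagSL u) 1 0 = u ^ 2 * B 1 0 := by
  simp [mul_apply10, mul_apply11]
  ring

/-- Scaling makes the smallest nonzero |c| equal to 1. Since heights of t and of the image satisfy t
t′ ≤ 1 / |c|², with equality over the pole, this is the normalization in which t ≥ 1 is the maximal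
horoball. -/
theorem exists_normalized_frame (hΓ : IsCusped Γ) {h : SL(2, ℂ)}
    (hc : ∃ w ∈ cuspLattice Γ h, w ≠ 0) : ∃ h' : SL(2, ℂ), (h' * h⁻¹) 1 0 = 0 ∧
      (∃ μ ν : ℂ, LinearIndependent ℝ ![μ, ν] ∧ ∀ B : SL(2, ℂ), (InConj Γ h' B ∧ B 1 0 = 0) ↔
        ∃ m n : ℤ, (B : PSL(2, ℂ)) = translation (m * μ + n * ν)) ∧
      (∀ B : SL(2, ℂ), InConj Γ h' B → B 1 0 ≠ 0 → 1 ≤ ‖B 1 0‖) ∧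
      ∃ B : SL(2, ℂ), InConj Γ h' B ∧ B 1 0 ≠ 0 ∧ ‖B 1 0‖ = 1 := by
  obtain ⟨B₀, hB₀, hB₀c, hmin⟩ := exists_min_lower_left hΓ hc
  have hpos : 0 < ‖B₀ 1 0‖ := norm_pos_iff.2 hB₀c
  have hs : (Real.sqrt ‖B₀ 1 0‖ : ℂ) ≠ 0 := by exact_mod_cast (Real.sqrt_pos.2 hpos).ne'
  -- Passing to the frame `diagSL u * h` divides lower left entries by u², and |u|² is the smallest
  -- modulus.
  set u : ℂˣ := Units.mk0 _ hs with hu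
  have hu2 : ‖(u : ℂ)‖ ^ 2 = ‖B₀ 1 0‖ := by
    rw [hu, Units.val_mk0, Complex.norm_real, Real.norm_of_nonneg (Real.sqrt_nonneg _),
      Real.sq_sqrt hpos.le]
  have hcusp : ∃ w ∈ cuspLattice Γ (diagSL u * h), w ≠ 0 := by
    obtain ⟨w, hw, hw0⟩ := hc
    refine ⟨u ^ 2 * w, ?_, mul_ne_zero (pow_ne_zero 2 u.ne_zero) hw0⟩
    rw [mem_cuspLattice, inConj_diagSL_mul]
    have e : diagSL u⁻¹ * transSL (u ^ 2 * w) * diagSL u = transSL w := by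
      have h1 := upper_conj_transSL (A := diagSL u⁻¹) (by simp) (u ^ 2 * w)
      rw [← diagSL_inv, inv_inv] at h1
      rw [h1]
      congr 1
      simp
    rw [e]; exact hw
  refine ⟨diagSL u * h, ?_, ?_, ?_, ?_⟩
  · rw [mul_inv_cancel_right]; simp
  · obtain ⟨w, hw, hw0, hwmin⟩ := exists_shortest hΓ hcusp
    obtain ⟨R, hR⟩ := exists_cocompact hΓ hcusp
    obtain ⟨μ, ν, hind, hbasis⟩ := exists_lattice_basis _ (norm_pos_iff.2 hw0) hwmin hR
    refine ⟨μ, ν, hind, fun B => ⟨?_, ?_⟩⟩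
    · rintro ⟨hB, h10⟩
      obtain ⟨v, hv, hBv⟩ := exists_eq_translation hΓ hcusp hB h10
      obtain ⟨m, n, rfl⟩ := (hbasis v).1 hv
      exact ⟨m, n, mk_eq_mk.2 hBv⟩
    · rintro ⟨m, n, hB⟩
      have hv := (hbasis _).2 ⟨m, n, rfl⟩
      rw [← mk_transSL] at hB
      rw [mem_cuspLattice] at hv
      rcases mk_eq_mk.1 hB with h1 | h1
      · rw [h1]; exact ⟨hv, rfl⟩
      · refine ⟨?_, by rw [h1]; simp⟩
        have e : (diagSL u * h)⁻¹ * B * (diagSL u * h) =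
          -((diagSL u * h)⁻¹ * transSL (m * μ + n * ν) * (diagSL u * h)) := by rw [h1]; simp
        rw [InConj, e, mk_eq_mk.2 (Or.inr rfl : -((diagSL u * h)⁻¹ * transSL (m * μ + n * ν) *
          (diagSL u * h)) = _ ∨ _)]
        exact hv
  · intro B hB hBc
    rw [inConj_diagSL_mul] at hB
    have h1 := hmin _ hB (by
      rw [diagSL_conj_10]; exact mul_ne_zero (pow_ne_zero 2 u.ne_zero) hBc)
    rw [diagSL_conj_10, norm_mul, norm_pow, hu2] at h1
    exact (le_mul_iff_one_le_right hpos).1 h1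
  · have e : diagSL u⁻¹ * (diagSL u * B₀ * diagSL u⁻¹) * diagSL u = B₀ := by
      rw [diagSL_inv]; group
    have h10 := diagSL_conj_10 u (diagSL u * B₀ * diagSL u⁻¹)
    rw [e] at h10
    refine ⟨diagSL u * B₀ * diagSL u⁻¹, ?_, ?_, ?_⟩
    · rw [inConj_diagSL_mul, e]; exact hB₀
    · intro h0
      rw [h0, mul_zero] at h10
      exact hB₀c h10
    · have h2 := congrArg (fun z : ℂ => ‖z‖) h10
      simp only [norm_mul, norm_pow, hu2] at h2
      have h3 : ‖B₀ 1 0‖ * 1 = ‖B₀ 1 0‖ * ‖(diagSL u * B₀ * diagSL u⁻¹) 1 0‖ := by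
        rw [mul_one]; exact h2
      exact (mul_left_cancel₀ hpos.ne' h3).symm

theorem FixesInfty.mul {a b : PSL(2, ℂ)} (ha : FixesInfty a) (hb : FixesInfty b) :
    FixesInfty (a * b) := by
  obtain ⟨A, rfl, hA⟩ := ha
  obtain ⟨B, rfl, hB⟩ := hb
  exact ⟨A * B, rfl, by rw [mul_apply10, hA, hB]; ring⟩

theorem FixesInfty.inv {a : PSL(2, ℂ)} (ha : FixesInfty a) : FixesInfty a⁻¹ := by
  obtain ⟨A, rfl, hA⟩ := ha
  exact ⟨A⁻¹, rfl, by rw [(coe_inv_apply A).2.2.1, hA, neg_zero]⟩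

theorem fixesInfty_one : FixesInfty 1 := ⟨1, rfl, by simp⟩

theorem height_mob_le {B : SL(2, ℂ)} (hc : B 1 0 ≠ 0) (p : H3) :
    height (mob B p) ≤ 1 / (‖B 1 0‖ ^ 2 * height p) := by
  have ht := height_pos p
  have hn : 0 < ‖B 1 0‖ := norm_pos_iff.2 hc
  rw [height_mob, div_le_div_iff₀ (mobDenom_pos B p) (by positivity), mobDenom,
    Complex.normSq_eq_norm_sq (B 1 0)]
  nlinarith [Complex.normSq_nonneg (B 1 0 * horiz p + B 1 1)]

/-- The boundary points `h⁻¹ ∞` that are parabolic fixed points. -/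
def IsCuspFrame (Γ : Subgroup PSL(2, ℂ)) (h : PSL(2, ℂ)) : Prop :=
  ∃ w : ℂ, w ≠ 0 ∧ h⁻¹ * translation w * h ∈ Γ

theorem isCuspFrame_mk {h : SL(2, ℂ)} :
    IsCuspFrame Γ (h : PSL(2, ℂ)) ↔ ∃ w ∈ cuspLattice Γ h, w ≠ 0 :=
  ⟨fun ⟨w, hw, hm⟩ => ⟨w, hm, hw⟩, fun ⟨w, hm, hw⟩ => ⟨w, hw, hm⟩⟩

/-- Equivalence of parabolic fixed points under `Γ`. -/
def cuspSetoid (Γ : Subgroup PSL(2, ℂ)) : Setoid {h : PSL(2, ℂ) // IsCuspFrame Γ h} where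
  r h h' := ∃ γ ∈ Γ, FixesInfty (h.1 * γ * h'.1⁻¹)
  iseqv :=
    { refl := fun h => ⟨1, Γ.one_mem, by
        rw [mul_one, mul_inv_cancel]; exact fixesInfty_one⟩
      symm := fun {h h'} ⟨γ, hγ, hf⟩ => ⟨γ⁻¹, Γ.inv_mem hγ, by
        have := hf.inv
        rwa [mul_inv_rev, mul_inv_rev, inv_inv, ← mul_assoc] at this⟩
      trans := fun {h h' h''} ⟨γ, hγ, hf⟩ ⟨γ', hγ', hf'⟩ => ⟨γ * γ', Γ.mul_mem hγ hγ', by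
        have := hf.mul hf'
        have e : h.1 * γ * h'.1⁻¹ * (h'.1 * γ' * h''.1⁻¹) = h.1 * (γ * γ') * h''.1⁻¹ := by group
        rwa [e] at this⟩ }

/-- Two cusps whose parabolic elements are conjugate by Γ to the same member of the finite set are
equivalent, because a parabolic element determines its fixed point. -/
theorem finite_cusps (hΓ : IsCusped Γ) : Finite (Quotient (cuspSetoid Γ)) := by
  obtain ⟨F, hF, h⟩ := exists_finite_cusps hΓ
  have hlift : ∀ q : Quotient (cuspSetoid Γ), ∃ h : SL(2, ℂ), (h : PSL(2, ℂ)) = q.out.1 := fun q =>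
    exists_mk _
  choose l hl using hlift
  have hcusp : ∀ q, ∃ w ∈ cuspLattice Γ (l q), w ≠ 0 := fun q => by
    rw [← isCuspFrame_mk, hl]; exact q.out.2
  choose B hBF G w hw hG hB using fun q => h (l q) (hcusp q)
  have := hF.to_subtype
  refine Finite.of_injective (fun q => (⟨B q, hBF q⟩ : F)) fun q q' hqq' => ?_
  have hBB : B q = B q' := congrArg Subtype.val hqq'
  have hS : ((l q) * ((G q)⁻¹ * G q') * (l q')⁻¹) 1 0 = 0 := by
    refine upper_of_conj_transSL (w := w q) (hw q') ?_
    have h1 := hB q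
    have h2 := hB q'
    rw [← hBB, ← h1] at h2
    have e1 : l q * ((G q)⁻¹ * G q') * (l q')⁻¹ * transSL (w q') *
        (l q * ((G q)⁻¹ * G q') * (l q')⁻¹)⁻¹ = l q * (G q)⁻¹ *
        (G q' * ((l q')⁻¹ * transSL (w q') * l q') * (G q')⁻¹) * G q * (l q)⁻¹ := by group
    rw [e1, h2]
    group
  have hrel : (cuspSetoid Γ).r q.out q'.out := by
    refine ⟨((G q)⁻¹ * G q' : SL(2, ℂ)), Γ.mul_mem (Γ.inv_mem (hG q)) (hG q'), ?_⟩
    rw [← hl, ← hl]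
    exact ⟨_, rfl, hS⟩
  have := Quotient.sound (s := cuspSetoid Γ) hrel
  rwa [Quotient.out_eq, Quotient.out_eq] at this

theorem exists_cuspData (hΓ : IsCusped Γ) : ∃ k : ℕ, Nonempty (CuspData Γ k) := by
  have hfin := finite_cusps hΓ
  obtain ⟨k, ⟨e⟩⟩ := Finite.exists_equiv_fin (Quotient (cuspSetoid Γ))
  have hlift : ∀ i : Fin k, ∃ h : SL(2, ℂ), (h : PSL(2, ℂ)) = (e.symm i).out.1 := fun i =>
    exists_mk _
  choose l hl using hlift
  have hcusp : ∀ i, ∃ w ∈ cuspLattice Γ (l i), w ≠ 0 := fun i => by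
    rw [← isCuspFrame_mk, hl]; exact (e.symm i).out.2
  choose n hn hb hmin htan using fun i => exists_normalized_frame hΓ (hcusp i)
  choose μ ν hind hstab using hb
  choose T hT hTc hT1 using htan
  have hnl : ∀ i, FixesInfty ((n i : PSL(2, ℂ)) * (l i : PSL(2, ℂ))⁻¹) := fun i => ⟨_, rfl, hn i⟩
  refine ⟨k, ⟨{
    frame := fun i => (n i : PSL(2, ℂ))
    μ := μ
    ν := ν
    indep := hind
    stabilizer := ?_
    disjoint := ?_
    tangent := ?_
    complete := ?_ }⟩⟩
  · intro i h
    obtain ⟨B, rfl⟩ := exists_mk h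
    rw [fixesInfty_mk]
    exact hstab i B
  · intro i h hh hf
    obtain ⟨B, rfl⟩ := exists_mk h
    rw [fixesInfty_mk] at hf
    have h1 := hmin i B hh hf
    rw [Set.disjoint_left]
    rintro _ hp ⟨q, hq, rfl⟩
    have hp : Real.exp 0 < height (mob B q) := hp
    have hq : Real.exp 0 < height q := hq
    rw [Real.exp_zero] at hp hq
    have h2 := height_mob_le hf q
    have h3 : 1 ≤ ‖B 1 0‖ ^ 2 * height q := by nlinarith
    have h4 : 1 / (‖B 1 0‖ ^ 2 * height q) ≤ 1 := (div_le_one (by linarith)).2 h3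
    linarith
  · intro i
    -- With |c| = 1 the point at height 1 over the pole is sent to height 1, so the two closed
    -- horoballs meet.
    refine ⟨T i, hT i, fun h => hTc i (fixesInfty_mk.1 h), ?_⟩
    obtain ⟨m1, m2⟩ := mob_pole (hTc i) one_pos
    refine ⟨_, ?_, ⟨ofCoords (-(T i 1 1) / T i 1 0) 1 one_pos, ?_, rfl⟩⟩
    · change Real.exp 0 ≤ height (mob _ _)
      rw [m2, Real.exp_zero, Complex.normSq_eq_norm_sq, hT1]
      norm_num
    · change Real.exp 0 ≤ height _
      rw [height_ofCoords, Real.exp_zero]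
  · intro h hh
    set q : Quotient (cuspSetoid Γ) := Quotient.mk _ ⟨h, hh⟩ with hq
    refine ⟨e q, ?_, ?_⟩
    · have h1 : q = Quotient.mk _ (e.symm (e q)).out := by
        rw [Quotient.out_eq, Equiv.symm_apply_apply]
      obtain ⟨γ, hγ, hf⟩ : (cuspSetoid Γ).r ⟨h, hh⟩ (e.symm (e q)).out := Quotient.exact h1
      refine ⟨γ, hγ, ?_⟩
      rw [← hl] at hf
      have := hf.mul (hnl (e q)).inv
      have e1 : h * γ * (l (e q) : PSL(2, ℂ))⁻¹ * ((n (e q) : PSL(2, ℂ)) *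
        (l (e q) : PSL(2, ℂ))⁻¹)⁻¹ = h * γ * (n (e q) : PSL(2, ℂ))⁻¹ := by group
      rwa [e1] at this
    · rintro j ⟨γ, hγ, hf⟩
      have h1 := hf.mul (hnl j)
      have e1 : h * γ * (n j : PSL(2, ℂ))⁻¹ * ((n j : PSL(2, ℂ)) * (l j : PSL(2, ℂ))⁻¹) =
        h * γ * (l j : PSL(2, ℂ))⁻¹ := by group
      rw [e1, hl] at h1
      have hrel : (cuspSetoid Γ).r ⟨h, hh⟩ (e.symm j).out := ⟨γ, hγ, h1⟩
      have h2 := Quotient.sound (s := cuspSetoid Γ) hrel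
      rw [Quotient.out_eq] at h2
      rw [hq]
      rw [h2, Equiv.apply_symm_apply]

end

/-! ### Compactness of the truncated manifold -/

namespace CuspData

variable {Γ : Subgroup PSL(2, ℂ)} {k : ℕ} (C : CuspData Γ k)

theorem mem_Ω {τ : ℝ} {p : H3} :
    p ∈ C.Ω τ ↔ ∀ i, ∀ γ ∈ Γ, height (C.frame i • γ • p) ≤ Real.exp τ := by
  simp only [Ω, mem_compl_iff, mem_iUnion, not_exists]
  constructor
  · intro h i γ hγ
    by_contra hlt
    push Not at hlt
    refine h i γ⁻¹ (Γ.inv_mem hγ) ⟨γ • p, ⟨C.frame i • γ • p, hlt, ?_⟩, ?_⟩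
    · exact inv_smul_smul _ _
    · exact inv_smul_smul _ _
  · rintro h i γ hγ ⟨_, ⟨q, hq, rfl⟩, rfl⟩
    have h1 := h i γ⁻¹ (Γ.inv_mem hγ)
    simp only [inv_smul_smul, smul_inv_smul] at h1
    exact absurd hq (not_lt.2 h1)

theorem mem_lattice (i : Fin k) (m n : ℤ) :
    (C.frame i)⁻¹ * translation (m * C.μ i + n * C.ν i) * C.frame i ∈ Γ :=
  ((C.stabilizer i _).2 ⟨m, n, rfl⟩).1

theorem exists_lattice_reduce (i : Fin k) (z : ℂ) :
    ∃ m n : ℤ, ‖z + (m * C.μ i + n * C.ν i)‖ ≤ ‖C.μ i‖ + ‖C.ν i‖ := by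
  have hspan : Submodule.span ℝ (range ![C.μ i, C.ν i]) = ⊤ :=
    (C.indep i).span_eq_top_of_card_eq_finrank (by simp [Complex.finrank_real_complex])
  have hz : z ∈ Submodule.span ℝ (range ![C.μ i, C.ν i]) := by rw [hspan]; trivial
  rw [Matrix.range_cons, Matrix.range_cons, Matrix.range_empty, union_empty, singleton_union,
    Submodule.mem_span_pair] at hz
  obtain ⟨a, b, rfl⟩ := hz
  refine ⟨-⌊a⌋, -⌊b⌋, ?_⟩
  have e : a • C.μ i + b • C.ν i + (((-⌊a⌋ : ℤ) : ℂ) * C.μ i + ((-⌊b⌋ : ℤ) : ℂ) * C.ν i) =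
      (Int.fract a : ℝ) • C.μ i + (Int.fract b : ℝ) • C.ν i := by
    simp only [Int.fract, Complex.real_smul]
    push_cast
    ring
  rw [e]
  refine (norm_add_le _ _).trans (add_le_add ?_ ?_)
  · rw [norm_smul, Real.norm_of_nonneg (Int.fract_nonneg a)]
    exact mul_le_of_le_one_left (norm_nonneg _) (Int.fract_lt_one a).le
  · rw [norm_smul, Real.norm_of_nonneg (Int.fract_nonneg b)]
    exact mul_le_of_le_one_left (norm_nonneg _) (Int.fract_lt_one b).le

/-- A point that is not thick has a short loxodromic or a short parabolic element. In the parabolic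
case, in the frame of the cusp, it is moved by a translation v with ‖v‖ below its height. The height
then lies between the shortest translation and e^τ, and the lattice bounds the horizontal
coordinate. -/
theorem relCompact_Ω (hΓ : IsCusped Γ) (τ : ℝ) : RelCompact Γ (C.Ω τ) := by
  obtain ⟨K₁, hK₁, hcov₁⟩ := relCompact_Thick hΓ
  obtain ⟨K₂, hK₂, hcov₂⟩ := relCompact_loxodromic hΓ
  have hbox : ∀ i : Fin k, ∃ L : Set H3, IsCompact L ∧ ∀ p, height (C.frame i • p) ≤ Real.exp τ →
      (∃ v : ℂ, v ≠ 0 ∧ (C.frame i)⁻¹ * translation v * C.frame i ∈ Γ ∧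
        ‖v‖ ≤ height (C.frame i • p)) → ∃ γ ∈ Γ, γ • p ∈ L := by
    intro i
    obtain ⟨f, hf⟩ := exists_mk (C.frame i)
    by_cases hc : ∃ w ∈ cuspLattice Γ f, w ≠ 0
    · obtain ⟨w, hw, hw0, hmin⟩ := exists_shortest hΓ hc
      refine ⟨mob f⁻¹ '' {p | ‖w‖ ≤ height p ∧ height p ≤ Real.exp τ ∧
        Complex.normSq (horiz p) ≤ (‖C.μ i‖ + ‖C.ν i‖) ^ 2},
        (isCompact_box (norm_pos_iff.2 hw0) _ _).image (continuous_mob _), ?_⟩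
      rintro p hp ⟨v, hv0, hv, hle⟩
      rw [← hf] at hp hv hle
      obtain ⟨m, n, hmn⟩ := C.exists_lattice_reduce i (horiz (mob f p))
      refine ⟨_, C.mem_lattice i m n, mob (transSL (m * C.μ i + n * C.ν i)) (mob f p),
        ⟨?_, ?_, ?_⟩, ?_⟩
      · rw [height_transSL]; exact (hmin v hv hv0).trans hle
      · rw [height_transSL]; exact hp
      · rw [horiz_transSL, Complex.normSq_eq_norm_sq]
        exact pow_le_pow_left₀ (norm_nonneg _) hmn 2
      · rw [← hf, mul_smul, mul_smul]; rfl
    · refine ⟨∅, isCompact_empty, ?_⟩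
      rintro p - ⟨v, hv0, hv, -⟩
      rw [← hf] at hv
      exact absurd ⟨v, hv, hv0⟩ hc
  choose L hL hcovL using hbox
  refine ⟨K₁ ∪ K₂ ∪ ⋃ i, L i, (hK₁.union hK₂).union (isCompact_iUnion hL), fun x hx => ?_⟩
  by_cases hthick : Thick Γ x
  · obtain ⟨γ, hγ, h⟩ := hcov₁ x hthick
    exact ⟨γ, hγ, Or.inl (Or.inl h)⟩
  · rw [Thick] at hthick
    push Not at hthick
    obtain ⟨A, hA, hAx⟩ := hthick
    obtain ⟨g, ⟨w, hw, hgw⟩ | ⟨u, hu, hgu⟩⟩ := exists_normal_form hA.2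
    · have hgw : g⁻¹ * A * g = transSL w := by
        refine hgw.resolve_right fun h => ?_
        have h1 := disp_neg_transSL w (mob g⁻¹ x)
        rw [← h, disp_conj', mob_mob_inv] at h1
        linarith
      have hcusp : ((g⁻¹ : SL(2, ℂ)) : PSL(2, ℂ))⁻¹ * translation w *
          ((g⁻¹ : SL(2, ℂ)) : PSL(2, ℂ)) ∈ Γ := by
        have : (((g⁻¹)⁻¹ * transSL w * g⁻¹ : SL(2, ℂ)) : PSL(2, ℂ)) ∈ Γ := by
          rw [← hgw]
          have e : (g⁻¹)⁻¹ * (g⁻¹ * A * g) * g⁻¹ = A := by group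
          rw [e]; exact hA.1
        exact this
      obtain ⟨i, ⟨γ, hγ, hf⟩, -⟩ := C.complete _ ⟨w, hw, hcusp⟩
      obtain ⟨G, rfl⟩ := exists_mk γ
      obtain ⟨f, hfi⟩ := exists_mk (C.frame i)
      rw [← hfi] at hf
      have hf : (g⁻¹ * G * f⁻¹) 1 0 = 0 := fixesInfty_mk.1 hf
      -- conjugate the short element into the frame
      set y := mob G⁻¹ x with hy
      have e1 : G⁻¹ * A * G = f⁻¹ * ((g⁻¹ * G * f⁻¹)⁻¹ * transSL w * (g⁻¹ * G * f⁻¹)) * f := by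
        rw [← hgw]; group
      have hfi10 : (g⁻¹ * G * f⁻¹)⁻¹ 1 0 = 0 := by
        rw [(coe_inv_apply _).2.2.1, hf, neg_zero]
      have e2 := upper_conj_transSL hfi10 w
      rw [inv_inv] at e2
      rw [e2] at e1
      set v := ((g⁻¹ * G * f⁻¹)⁻¹ 0 0) ^ 2 * w with hv
      have hv0 : v ≠ 0 :=
        mul_ne_zero (pow_ne_zero 2 (left_ne_zero_of_mul_eq_one (mul_eq_one_of_upper hfi10))) hw
      have hdisp : disp (transSL v) (mob f y) < 1 / 100 := by
        rw [← disp_conj', ← e1, disp_conj', hy, mob_mob_inv]; exact hAx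
      have hyx : y ∈ C.Ω τ := by
        rw [mem_Ω] at hx ⊢
        intro j γ' hγ'
        have := hx j (γ' * (G : PSL(2, ℂ))⁻¹) (Γ.mul_mem hγ' (Γ.inv_mem hγ))
        rwa [mul_smul] at this
      have hyh : height (C.frame i • y) ≤ Real.exp τ := by
        have := C.mem_Ω.1 hyx i 1 Γ.one_mem
        rwa [one_smul] at this
      obtain ⟨γ', hγ', h⟩ := hcovL i y hyh ⟨v, hv0, by
        rw [← hfi]
        have h1 : ((G⁻¹ * A * G : SL(2, ℂ)) : PSL(2, ℂ)) ∈ Γ :=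
          Γ.mul_mem (Γ.mul_mem (Γ.inv_mem hγ) hA.1) hγ
        rw [e1] at h1
        exact h1, by
        rw [← hfi]
        change ‖v‖ ≤ height (mob f y)
        rw [disp_transSL, Complex.normSq_eq_norm_sq, div_lt_iff₀ (pow_pos (height_pos _) 2)] at hdisp
        have := height_pos (mob f y)
        nlinarith [norm_nonneg v]⟩
      refine ⟨γ' * (G : PSL(2, ℂ))⁻¹, Γ.mul_mem hγ' (Γ.inv_mem hγ), Or.inr (mem_iUnion.2 ⟨i, ?_⟩)⟩
      rw [mul_smul]; exact h
    · obtain ⟨γ, hγ, h⟩ := hcov₂ x ⟨A, g, u, hA, hgu, hAx⟩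
      exact ⟨γ, hγ, Or.inl (Or.inr h)⟩

end CuspData

/-! ### Topology of the quotient and of its truncation. -/

instance (Γ : Subgroup PSL(2, ℂ)) : ContinuousConstSMul Γ H3 :=
  ⟨fun γ => continuous_const_smul (γ : PSL(2, ℂ))⟩

theorem continuous_proj (Γ : Subgroup PSL(2, ℂ)) : Continuous (proj Γ) := continuous_quotient_mk'

theorem isOpenMap_proj (Γ : Subgroup PSL(2, ℂ)) : IsOpenMap (proj Γ) :=
  isOpenMap_quotient_mk'_mul (Γ := Γ) (T := H3)

theorem t2Space_Quot3 {Γ : Subgroup PSL(2, ℂ)} (hΓ : IsCusped Γ) : T2Space (Quot3 Γ) := by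
  have := hΓ.properlyDiscontinuous
  have : LocallyCompactSpace H3 := upperHalfSpace.isOpen.locallyCompactSpace
  exact t2Space_of_properlyDiscontinuousSMul_of_t2Space

theorem proj_smul {Γ : Subgroup PSL(2, ℂ)} {γ : PSL(2, ℂ)} (hγ : γ ∈ Γ) (p : H3) :
    proj Γ (γ • p) = proj Γ p :=
  Quotient.sound (MulAction.orbitRel_apply.2 ⟨⟨γ, hγ⟩, rfl⟩)

theorem exists_smul_of_proj_eq {Γ : Subgroup PSL(2, ℂ)} {p q : H3} (h : proj Γ p = proj Γ q) :
    ∃ γ ∈ Γ, γ • p = q := by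
  obtain ⟨γ, hγ⟩ := MulAction.orbitRel_apply.1 (Quotient.exact h.symm)
  exact ⟨γ, γ.2, hγ⟩

theorem isOpen_openHoroball (τ : ℝ) : IsOpen (openHoroball τ) :=
  isOpen_lt continuous_const continuous_height

theorem isOpen_translate (h : PSL(2, ℂ)) {s : Set H3} (hs : IsOpen s) : IsOpen (translate h s) :=
  isOpenMap_smul h s hs

namespace CuspData

variable {Γ : Subgroup PSL(2, ℂ)} {k : ℕ} (C : CuspData Γ k)

theorem isClosed_M (τ : ℝ) : IsClosed (C.M τ) := by
  refine isClosed_compl_iff.2 (isOpen_iUnion fun i => ?_)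
  exact isOpenMap_proj Γ _ (isOpen_translate _ (isOpen_openHoroball τ))

theorem compactSpace_M (hΓ : IsCusped Γ) (τ : ℝ) : CompactSpace (C.M τ) := by
  rw [← isCompact_iff_compactSpace]
  have := t2Space_Quot3 hΓ
  obtain ⟨K, hK, hcov⟩ := C.relCompact_Ω hΓ τ
  refine (hK.image (continuous_proj Γ)).of_isClosed_subset (C.isClosed_M τ) fun x hx => ?_
  obtain ⟨p, rfl⟩ : ∃ p, proj Γ p = x := Quotient.exists_rep x
  have hp : p ∈ C.Ω τ := by rw [← C.proj_preimage_M]; exact hx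
  obtain ⟨γ, hγ, h⟩ := hcov p hp
  exact ⟨γ • p, h, proj_smul hγ p⟩

end CuspData

namespace CuspData

variable {Γ : Subgroup PSL(2, ℂ)} {k : ℕ} (C : CuspData Γ k)

/-! ### Separation of the cusps -/

theorem μ_ne_zero (i : Fin k) : C.μ i ≠ 0 := (C.indep i).ne_zero 0

theorem isCuspFrame (i : Fin k) : IsCuspFrame Γ (C.frame i) :=
  ⟨C.μ i, C.μ_ne_zero i, by simpa using C.mem_lattice i 1 0⟩

theorem eq_of_fixesInfty {i j : Fin k} {γ : PSL(2, ℂ)} (hγ : γ ∈ Γ)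
    (h : FixesInfty (C.frame i * γ * (C.frame j)⁻¹)) : i = j :=
  (C.complete _ (C.isCuspFrame i)).unique
    ⟨1, Γ.one_mem, by rw [mul_one, mul_inv_cancel]; exact fixesInfty_one⟩ ⟨γ, hγ, h⟩

/-- For |c| < 1 the point at height 1 / |c| > 1 over the pole is sent to the same height, so two
distinct translates of t > 1 would overlap. -/
theorem one_le_lower_left {i : Fin k} {B : SL(2, ℂ)}
    (hB : (C.frame i)⁻¹ * (B : PSL(2, ℂ)) * C.frame i ∈ Γ) (hc : B 1 0 ≠ 0) : 1 ≤ ‖B 1 0‖ := by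
  by_contra hlt
  push Not at hlt
  have hpos : 0 < ‖B 1 0‖ := norm_pos_iff.2 hc
  have h1 : 1 < 1 / ‖B 1 0‖ := (one_lt_div hpos).2 hlt
  refine Set.disjoint_left.1 (C.disjoint i B hB fun h => hc (fixesInfty_mk.1 h))
    (?_ : mob B (ofCoords (-(B 1 1) / B 1 0) (1 / ‖B 1 0‖) (by positivity)) ∈ _) ⟨_, ?_, rfl⟩
  · change Real.exp 0 < height (mob _ _)
    rw [(mob_pole hc _).2, Complex.normSq_eq_norm_sq, Real.exp_zero]
    have : ‖B 1 0‖ ^ 2 * (1 / ‖B 1 0‖) = ‖B 1 0‖ := by field_simp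
    rwa [this]
  · change Real.exp 0 < height _
    rwa [height_ofCoords, Real.exp_zero]

theorem proj_mem_cuspRegion {i : Fin k} {τ : ℝ} {p : H3} :
    proj Γ p ∈ C.cuspRegion i τ ↔ ∃ γ ∈ Γ, Real.exp τ < height (C.frame i • γ • p) := by
  constructor
  · rintro ⟨_, ⟨q, hq, rfl⟩, h⟩
    obtain ⟨γ, hγ, h1⟩ := exists_smul_of_proj_eq h.symm
    refine ⟨γ, hγ, ?_⟩
    rw [h1]
    change _ < height (C.frame i • (C.frame i)⁻¹ • q)
    rw [smul_inv_smul]; exact hq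
  · rintro ⟨γ, hγ, h⟩
    exact ⟨γ • p, ⟨C.frame i • γ • p, h, inv_smul_smul _ _⟩, proj_smul hγ p⟩

theorem separates_iff {τ : ℝ} : C.Separates τ ↔ 0 ≤ τ ∧ ∀ i j, i ≠ j → ∀ γ ∈ Γ, ∀ γ' ∈ Γ, ∀ p : H3,
    ¬ (Real.exp τ < height (C.frame i • γ • p) ∧ Real.exp τ < height (C.frame j • γ' • p)) := by
  refine and_congr_right fun _ => forall_congr' fun i => forall_congr' fun j =>
    imp_congr_right fun _ => ?_
  rw [Set.disjoint_left]
  constructor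
  · intro h γ hγ γ' hγ' p hp
    exact h (C.proj_mem_cuspRegion.2 ⟨γ, hγ, hp.1⟩) (C.proj_mem_cuspRegion.2 ⟨γ', hγ', hp.2⟩)
  · intro h x
    obtain ⟨p, rfl⟩ : ∃ p, proj Γ p = x := Quotient.exists_rep x
    intro h1 h2
    obtain ⟨γ, hγ, h1⟩ := C.proj_mem_cuspRegion.1 h1
    obtain ⟨γ', hγ', h2⟩ := C.proj_mem_cuspRegion.1 h2
    exact h γ hγ γ' hγ' p ⟨h1, h2⟩

/-- Suppose p has heights s and s′ above S in two different cusps. The matrix B relating the frames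
has c ≠ 0 and s s′ ≤ 1 / |c|². Conjugating the translation by μ_i into the other frame gives an
element with lower left entry −c² μ_i, so 1 ≤ |c|²‖μ_i‖ ≤ |c|² S < |c|² s s′ ≤ 1. -/
theorem exists_separates : ∃ τ, C.Separates τ := by
  set S : ℝ := 1 + ∑ i, ‖C.μ i‖ with hS
  have hsum : 0 ≤ ∑ i, ‖C.μ i‖ := Finset.sum_nonneg fun i _ => norm_nonneg _
  have hS1 : 1 ≤ S := by linarith
  refine ⟨Real.log S, C.separates_iff.2 ⟨Real.log_nonneg hS1, ?_⟩⟩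
  rintro i j hij γ hγ γ' hγ' p ⟨h1, h2⟩
  rw [Real.exp_log (by linarith)] at h1 h2
  obtain ⟨B, hB⟩ := exists_mk (C.frame i * (γ * γ'⁻¹) * (C.frame j)⁻¹)
  have hmem : γ * γ'⁻¹ ∈ Γ := Γ.mul_mem hγ (Γ.inv_mem hγ')
  have hc : B 1 0 ≠ 0 := fun h => hij (C.eq_of_fixesInfty hmem ⟨B, hB, h⟩)
  have hconj : (C.frame j)⁻¹ * ((B⁻¹ * transSL (C.μ i) * B : SL(2, ℂ)) : PSL(2, ℂ)) * C.frame j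
      ∈ Γ := by
    have e : ((B⁻¹ * transSL (C.μ i) * B : SL(2, ℂ)) : PSL(2, ℂ)) =
        (B : PSL(2, ℂ))⁻¹ * translation (C.μ i) * (B : PSL(2, ℂ)) := rfl
    have e2 : (C.frame j)⁻¹ * ((B : PSL(2, ℂ))⁻¹ * translation (C.μ i) * (B : PSL(2, ℂ))) *
        C.frame j = (γ * γ'⁻¹)⁻¹ * ((C.frame i)⁻¹ * translation (C.μ i) * C.frame i) *
          (γ * γ'⁻¹) := by rw [hB]; group
    rw [e, e2]
    have := C.mem_lattice i 1 0
    simp only [Int.cast_one, one_mul, Int.cast_zero, zero_mul, add_zero] at this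
    exact Γ.mul_mem (Γ.mul_mem (Γ.inv_mem hmem) this) hmem
  have h10 : (B⁻¹ * transSL (C.μ i) * B) 1 0 = -(B 1 0 ^ 2 * C.μ i) := by
    obtain ⟨-, -, e10, e11⟩ := coe_inv_apply B
    simp [mul_apply10, mul_apply11, e10, e11]
    ring
  have h3 := C.one_le_lower_left hconj (by
    rw [h10]; exact neg_ne_zero.2 (mul_ne_zero (pow_ne_zero 2 hc) (C.μ_ne_zero i)))
  rw [h10, norm_neg, norm_mul, norm_pow] at h3
  have h4 := height_mob_le hc (C.frame j • γ' • p)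
  have e3 : mob B (C.frame j • γ' • p) = C.frame i • γ • p := by
    rw [← mk_smul, hB]
    simp only [← mul_smul]
    congr 1
    group
  rw [e3] at h4
  have hcn : 0 < ‖B 1 0‖ := norm_pos_iff.2 hc
  have hjp := height_pos (C.frame j • γ' • p)
  rw [le_div_iff₀ (by positivity)] at h4
  have h5 : ‖C.μ i‖ ≤ S := by
    have := Finset.single_le_sum (f := fun i => ‖C.μ i‖) (fun i _ => norm_nonneg _)
      (Finset.mem_univ i)
    linarith
  have h6 : ‖B 1 0‖ ^ 2 * S < ‖B 1 0‖ ^ 2 * (height (C.frame i • γ • p) *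
      height (C.frame j • γ' • p)) := by
    refine mul_lt_mul_of_pos_left ?_ (by positivity)
    nlinarith
  have h7 : ‖B 1 0‖ ^ 2 * ‖C.μ i‖ ≤ ‖B 1 0‖ ^ 2 * S := mul_le_mul_of_nonneg_left h5 (by positivity)
  nlinarith

/-- The regions are given by strict inequalities, so for each point the levels at which two of them
overlap form an open set, and separation is a closed condition. -/
theorem exists_isLeast_separates : ∃ τ₀ : ℝ, IsLeast {τ : ℝ | C.Separates τ} τ₀ := by
  refine ⟨_, IsClosed.isLeast_csInf ?_ C.exists_separates ⟨0, fun τ h => h.1⟩⟩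
  have e : {τ : ℝ | C.Separates τ} = Ici 0 ∩ ⋂ i, ⋂ j, ⋂ (_ : i ≠ j), ⋂ γ ∈ Γ, ⋂ γ' ∈ Γ,
      ⋂ p : H3, ({τ | Real.exp τ < height (C.frame i • γ • p)} ∩
        {τ | Real.exp τ < height (C.frame j • γ' • p)})ᶜ := by
    ext τ
    simp only [mem_inter_iff, mem_iInter, mem_Ici, mem_compl_iff]
    exact C.separates_iff
  rw [e]
  refine isClosed_Ici.inter ?_
  repeat refine isClosed_iInter fun _ => ?_
  exact ((isOpen_lt Real.continuous_exp continuous_const).inter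
    (isOpen_lt Real.continuous_exp continuous_const)).isClosed_compl

/-! ### Heights in the cusps -/

variable {C} {τ₀ : ℝ}

theorem Separates.one_le_L₀ (hs : C.Separates τ₀) : 1 ≤ C.L₀ τ₀ :=
  (Real.one_le_exp hs.1).trans (le_max_left _ _)

theorem Separates.L₀_pos (hs : C.Separates τ₀) : 0 < C.L₀ τ₀ := by
  linarith [hs.one_le_L₀]

theorem Separates.exp_level (hs : C.Separates τ₀) {j : ℕ} (hj : 0 < j) :
    Real.exp (C.level τ₀ j) = j * C.L₀ τ₀ :=
  Real.exp_log (mul_pos (Nat.cast_pos.2 hj) hs.L₀_pos)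

/-- As L₀ ≥ e^τ₀, both frames belong to one cusp; as L₀ ≥ 1, disjointness of horoballs makes the
element relating them fix ∞. It is then a translation and keeps heights. -/
theorem Separates.height_eq (hs : C.Separates τ₀) {i j : Fin k} {γ γ' : PSL(2, ℂ)} (hγ : γ ∈ Γ)
    (hγ' : γ' ∈ Γ) {p : H3} (h : C.L₀ τ₀ < height (C.frame i • γ • p))
    (h' : C.L₀ τ₀ < height (C.frame j • γ' • p)) :
    height (C.frame i • γ • p) = height (C.frame j • γ' • p) := by
  have hij : i = j := by
    by_contra hij
    exact (C.separates_iff.1 hs).2 i j hij γ hγ γ' hγ' p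
      ⟨(le_max_left _ _).trans_lt h, (le_max_left _ _).trans_lt h'⟩
  subst hij
  set g := C.frame i * (γ * γ'⁻¹) * (C.frame i)⁻¹ with hg
  have hmem : (C.frame i)⁻¹ * g * C.frame i ∈ Γ := by
    have : (C.frame i)⁻¹ * g * C.frame i = γ * γ'⁻¹ := by rw [hg]; group
    rw [this]; exact Γ.mul_mem hγ (Γ.inv_mem hγ')
  have hgp : g • C.frame i • γ' • p = C.frame i • γ • p := by
    simp only [← mul_smul, hg]
    congr 1
    group
  have hfix : FixesInfty g := by
    by_contra hf
    refine Set.disjoint_left.1 (C.disjoint i g hmem hf)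
      (?_ : C.frame i • γ • p ∈ _) ⟨C.frame i • γ' • p, ?_, hgp⟩
    · change Real.exp 0 < _
      rw [Real.exp_zero]; exact hs.one_le_L₀.trans_lt h
    · change Real.exp 0 < _
      rw [Real.exp_zero]; exact hs.one_le_L₀.trans_lt h'
  obtain ⟨m, n, hmn⟩ := (C.stabilizer i g).1 ⟨hmem, hfix⟩
  rw [← hgp, hmn, ← mk_transSL, mk_smul, height_transSL]

open Classical in
/-- The height of a point above the cusp whose region `T_i × (log L₀, ∞)` contains it, and `L₀` for
points outside these regions. -/
def cuspHeight (C : CuspData Γ k) (τ₀ : ℝ) (p : H3) : ℝ :=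
  if h : ∃ i, ∃ γ ∈ Γ, C.L₀ τ₀ < height (C.frame i • γ • p) then
    height (C.frame h.choose • h.choose_spec.choose • p) else C.L₀ τ₀

theorem Separates.cuspHeight_eq (hs : C.Separates τ₀) {i : Fin k} {γ : PSL(2, ℂ)} (hγ : γ ∈ Γ)
    {p : H3} (h : C.L₀ τ₀ < height (C.frame i • γ • p)) :
    C.cuspHeight τ₀ p = height (C.frame i • γ • p) := by
  have hex : ∃ i, ∃ γ ∈ Γ, C.L₀ τ₀ < height (C.frame i • γ • p) := ⟨i, γ, hγ, h⟩
  rw [cuspHeight, dif_pos hex]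
  exact hs.height_eq hex.choose_spec.choose_spec.1 hγ hex.choose_spec.choose_spec.2 h

theorem cuspHeight_eq_L₀ {p : H3} (h : ∀ i, ∀ γ ∈ Γ, height (C.frame i • γ • p) ≤ C.L₀ τ₀) :
    C.cuspHeight τ₀ p = C.L₀ τ₀ := by
  rw [cuspHeight, dif_neg]
  push Not
  exact h

theorem cuspHeight_eq_or (hs : C.Separates τ₀) (p : H3) :
    (∃ i, ∃ γ ∈ Γ, C.L₀ τ₀ < height (C.frame i • γ • p) ∧
      C.cuspHeight τ₀ p = height (C.frame i • γ • p)) ∨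
    (∀ i, ∀ γ ∈ Γ, height (C.frame i • γ • p) ≤ C.L₀ τ₀) ∧ C.cuspHeight τ₀ p = C.L₀ τ₀ := by
  by_cases h : ∃ i, ∃ γ ∈ Γ, C.L₀ τ₀ < height (C.frame i • γ • p)
  · obtain ⟨i, γ, hγ, h⟩ := h
    exact Or.inl ⟨i, γ, hγ, h, hs.cuspHeight_eq hγ h⟩
  · push Not at h
    exact Or.inr ⟨h, cuspHeight_eq_L₀ h⟩

theorem Separates.L₀_le_cuspHeight (hs : C.Separates τ₀) (p : H3) :
    C.L₀ τ₀ ≤ C.cuspHeight τ₀ p := by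
  rcases cuspHeight_eq_or hs p with ⟨i, γ, -, h, e⟩ | ⟨-, e⟩
  · rw [e]; exact h.le
  · exact e.ge

theorem Separates.cuspHeight_pos (hs : C.Separates τ₀) (p : H3) : 0 < C.cuspHeight τ₀ p :=
  hs.L₀_pos.trans_le (hs.L₀_le_cuspHeight p)

theorem Separates.height_le_cuspHeight (hs : C.Separates τ₀) (i : Fin k) {γ : PSL(2, ℂ)}
    (hγ : γ ∈ Γ) (p : H3) : height (C.frame i • γ • p) ≤ C.cuspHeight τ₀ p := by
  by_cases h : C.L₀ τ₀ < height (C.frame i • γ • p)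
  · exact (hs.cuspHeight_eq hγ h).ge
  · exact (not_lt.1 h).trans (hs.L₀_le_cuspHeight p)

theorem Separates.cuspHeight_le_iff (hs : C.Separates τ₀) {p : H3} {r : ℝ} (hr : C.L₀ τ₀ ≤ r) :
    C.cuspHeight τ₀ p ≤ r ↔ ∀ i, ∀ γ ∈ Γ, height (C.frame i • γ • p) ≤ r := by
  refine ⟨fun h i γ hγ => (hs.height_le_cuspHeight i hγ p).trans h, fun h => ?_⟩
  rcases cuspHeight_eq_or hs p with ⟨i, γ, hγ, -, e⟩ | ⟨-, e⟩
  · rw [e]; exact h i γ hγ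
  · rw [e]; exact hr

theorem Separates.mem_Ω_level (hs : C.Separates τ₀) {j : ℕ} (hj : 0 < j) {p : H3} :
    p ∈ C.Ω (C.level τ₀ j) ↔ C.cuspHeight τ₀ p ≤ j * C.L₀ τ₀ := by
  have h1 : (1 : ℝ) ≤ j := by exact_mod_cast hj
  rw [mem_Ω, hs.exp_level hj, hs.cuspHeight_le_iff]
  nlinarith [hs.L₀_pos]

theorem Separates.cuspHeight_smul (hs : C.Separates τ₀) {γ : PSL(2, ℂ)} (hγ : γ ∈ Γ) (p : H3) :
    C.cuspHeight τ₀ (γ • p) = C.cuspHeight τ₀ p := by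
  rcases cuspHeight_eq_or hs p with ⟨i, γ', hγ', h, e⟩ | ⟨h, e⟩
  · have e' : C.frame i • (γ' * γ⁻¹) • γ • p = C.frame i • γ' • p := by
      rw [mul_smul, inv_smul_smul]
    rw [e, ← e']
    exact hs.cuspHeight_eq (Γ.mul_mem hγ' (Γ.inv_mem hγ)) (by rwa [e'])
  · rw [e]
    refine cuspHeight_eq_L₀ fun i γ' hγ' => ?_
    rw [← mul_smul γ']
    exact h i _ (Γ.mul_mem hγ' hγ)

theorem Separates.smul_mem_Ω (hs : C.Separates τ₀) {j : ℕ} (hj : 0 < j) {γ : PSL(2, ℂ)}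
    (hγ : γ ∈ Γ) {p : H3} (hp : p ∈ C.Ω (C.level τ₀ j)) : γ • p ∈ C.Ω (C.level τ₀ j) := by
  rw [hs.mem_Ω_level hj] at hp ⊢
  rwa [hs.cuspHeight_smul hγ]

end CuspData

/-! ### The modified metric -/

theorem hypMetric_apply (p : H3) (v w : E3) : hypMetric p v w = 1 / height p ^ 2 * inner ℝ v w :=
  rfl

/-- By conformality the pull-back is the hyperbolic metric times (t / f(t))², so it depends on h
only through the height t of h • p. -/
theorem conformalMetric_dsmul (f : ℝ → ℝ) (h : PSL(2, ℂ)) (p : H3) (v w : E3) :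
    conformalMetric f (h • p) (dsmul h p v) (dsmul h p w) =
      (height (h • p) / f (height (h • p))) ^ 2 / height p ^ 2 * inner ℝ v w := by
  change 1 / f (height (h • p)) ^ 2 * inner ℝ (dsmul h p v) (dsmul h p w) = _
  rw [inner_dsmul]
  ring

/-- If ∞ were moved, some point of t = a would drop below the slab. Hence h acts as a similarity,
and its factor must be 1. This makes the modified metric independent of the isometries chosen in its
definition. -/
theorem height_eq_of_translate_slab {a b : ℝ} (ha : 0 < a) (hab : a < b) {h : PSL(2, ℂ)}
    (hS : translate h (slab a b) = slab a b) (p : H3) : height (h • p) = height p := by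
  obtain ⟨B, rfl⟩ := exists_mk h
  have hmap : ∀ q, a ≤ height q → height q ≤ b →
      a ≤ height (mob B q) ∧ height (mob B q) ≤ b := fun q h1 h2 => by
    have : mob B q ∈ slab a b := hS ▸ ⟨q, ⟨h1, h2⟩, rfl⟩
    exact this
  have h10 : B 1 0 = 0 := by
    by_contra hc
    have hn : 0 < Complex.normSq (B 1 0) := Complex.normSq_pos.2 hc
    -- Only R² > 1 matters: the point is chosen with c z + d = R, so its image has height below a /
    -- R² < a.
    obtain ⟨R, hR⟩ : ∃ R : ℝ, a / a < R ^ 2 := ⟨2, by rw [div_self ha.ne']; norm_num⟩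
    rw [div_self ha.ne'] at hR
    have h1 := (hmap (ofCoords ((R - B 1 1) / B 1 0) a ha) (by simp) (by simp [hab.le])).1
    have e : mobDenom B (ofCoords ((R - B 1 1) / B 1 0) a ha) = R ^ 2 + Complex.normSq (B 1 0) *
        a ^ 2 := by
      rw [mobDenom, horiz_ofCoords, height_ofCoords]
      have : B 1 0 * ((R - B 1 1) / B 1 0) + B 1 1 = R := by field_simp; ring
      rw [this, Complex.normSq_ofReal]; ring
    have hp : 0 < R ^ 2 + Complex.normSq (B 1 0) * a ^ 2 := by positivity
    rw [height_mob, e, height_ofCoords, le_div_iff₀ hp] at h1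
    nlinarith [mul_pos hn (pow_pos ha 2)]
  have hN := height_upper h10
  have h1 := hmap (ofCoords 0 a ha) (by simp) (by simp [hab.le])
  have h2 := hmap (ofCoords 0 b (ha.trans hab)) (by simp [hab.le]) (by simp)
  rw [hN, height_ofCoords] at h1 h2
  have h3 : Complex.normSq (B 0 0) = 1 := by
    apply le_antisymm
    · by_contra hlt
      push Not at hlt
      nlinarith [h2.2]
    · by_contra hlt
      push Not at hlt
      nlinarith [h1.1]
  change height (mob B p) = _
  rw [hN, h3, one_mul]

section

variable {Γ : Subgroup PSL(2, ℂ)} {k : ℕ} {C : CuspData Γ k} {τ₀ : ℝ}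

/-- On Ω(τ₃) the factor is 1 because f is the identity there. On a lifted slab the chosen isometry
and the frame differ by a map preserving the slab, so both show the cusp height. One formula
replaces all choices, and existence and invariance are read off from it. -/
theorem CuspData.Separates.isModifiedMetric_iff (hs : C.Separates τ₀) {f φ : ℝ → ℝ}
    (hf : IsCutoff (3 * C.L₀ τ₀) (4 * C.L₀ τ₀) φ f) {b : Tensor2} :
    IsModifiedMetric C τ₀ f b ↔ ∀ p ∈ C.Ω (C.level τ₀ 4), ∀ v w : E3, b p v w =
      (C.cuspHeight τ₀ p / f (C.cuspHeight τ₀ p)) ^ 2 / height p ^ 2 * inner ℝ v w := by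
  have hL := hs.L₀_pos
  have hratio : ∀ p, p ∈ C.Ω (C.level τ₀ 3) → C.cuspHeight τ₀ p / f (C.cuspHeight τ₀ p) = 1 := by
    intro p hp
    rw [hs.mem_Ω_level (by norm_num)] at hp
    rw [hf.f_eq_id _ (hs.cuspHeight_pos p) (by simpa using hp),
      div_self (hs.cuspHeight_pos p).ne']
  have hslab : ∀ i, ∀ γ ∈ Γ, ∀ p, p ∈ translate γ (translate (C.frame i)⁻¹
      (slab (3 * C.L₀ τ₀) (4 * C.L₀ τ₀))) ↔ 3 * C.L₀ τ₀ ≤ C.cuspHeight τ₀ p ∧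
        C.cuspHeight τ₀ p ≤ 4 * C.L₀ τ₀ ∧
          C.cuspHeight τ₀ p = height (C.frame i • γ⁻¹ • p) := by
    intro i γ hγ p
    constructor
    · rintro ⟨_, ⟨q, hq, rfl⟩, rfl⟩
      have e : C.frame i • γ⁻¹ • γ • (C.frame i)⁻¹ • q = q := by
        rw [inv_smul_smul, smul_inv_smul]
      have h3 := hs.cuspHeight_eq (Γ.inv_mem hγ) (i := i) (p := γ • (C.frame i)⁻¹ • q) (by
        rw [e]; linarith [hq.1])
      change _ ≤ C.cuspHeight τ₀ (γ • (C.frame i)⁻¹ • q) ∧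
        C.cuspHeight τ₀ (γ • (C.frame i)⁻¹ • q) ≤ _ ∧
        C.cuspHeight τ₀ (γ • (C.frame i)⁻¹ • q) = height (C.frame i • γ⁻¹ • γ • (C.frame i)⁻¹ • q)
      rw [h3, e]
      exact ⟨hq.1, hq.2, rfl⟩
    · rintro ⟨h1, h2, h3⟩
      refine ⟨γ⁻¹ • p, ⟨C.frame i • γ⁻¹ • p, ⟨?_, ?_⟩, inv_smul_smul _ _⟩, smul_inv_smul _ _⟩
      · rwa [← h3]
      · rwa [← h3]
  constructor
  · rintro ⟨h1, h2⟩ p hp v w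
    by_cases hp3 : p ∈ C.Ω (C.level τ₀ 3)
    · rw [h1 p hp3, hratio p hp3, hypMetric_apply]
      ring
    · rw [hs.mem_Ω_level (by norm_num)] at hp hp3
      push_cast at hp hp3
      push Not at hp3
      rcases C.cuspHeight_eq_or hs p with ⟨i, γ, hγ, h, e⟩ | ⟨-, e⟩
      · obtain ⟨g, hg, hb⟩ := h2 i γ⁻¹ (Γ.inv_mem hγ)
        have hpU := (hslab i γ⁻¹ (Γ.inv_mem hγ) p).2 ⟨hp3.le, hp, by rwa [inv_inv]⟩
        rw [hb p hpU, conformalMetric_dsmul]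
        have hS : translate (g * γ⁻¹ * (C.frame i)⁻¹) (slab (3 * C.L₀ τ₀) (4 * C.L₀ τ₀)) =
            slab (3 * C.L₀ τ₀) (4 * C.L₀ τ₀) := by
          refine Eq.trans ?_ hg
          simp only [translate, image_image, mul_smul]
        have h4 := height_eq_of_translate_slab (by linarith) (by linarith) hS (C.frame i • γ • p)
        have e2 : (g * γ⁻¹ * (C.frame i)⁻¹) • C.frame i • γ • p = g • p := by
          simp only [← mul_smul]; congr 1; group
        rw [e2] at h4
        rw [h4, ← e]
      · rw [e] at hp3; linarith
  · intro hb
    have hsub : ∀ p, p ∈ C.Ω (C.level τ₀ 3) → p ∈ C.Ω (C.level τ₀ 4) := by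
      intro p hp
      rw [hs.mem_Ω_level (by norm_num)] at hp ⊢
      push_cast at hp ⊢
      linarith
    refine ⟨fun p hp => ?_, fun i γ hγ => ⟨C.frame i * γ⁻¹, ?_, fun p hp v w => ?_⟩⟩
    · ext v w
      rw [hb p (hsub p hp), hratio p hp, hypMetric_apply]
      ring
    · simp only [translate, image_image, mul_smul, inv_smul_smul, smul_inv_smul, image_id']
    · rw [hslab i γ hγ] at hp
      rw [conformalMetric_dsmul, mul_smul, ← hp.2.2]
      refine hb p ?_ v w
      rw [hs.mem_Ω_level (by norm_num)]
      exact_mod_cast hp.2.1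

theorem CuspData.Separates.exists_isModifiedMetric (hs : C.Separates τ₀) {f φ : ℝ → ℝ}
    (hf : IsCutoff (3 * C.L₀ τ₀) (4 * C.L₀ τ₀) φ f) : ∃ b, IsModifiedMetric C τ₀ f b := by
  refine ⟨fun p => ((C.cuspHeight τ₀ p / f (C.cuspHeight τ₀ p)) ^ 2 / height p ^ 2) • innerSL ℝ,
    (hs.isModifiedMetric_iff hf).2 fun p _ v w => rfl⟩

theorem CuspData.Separates.modifiedMetric_dsmul (hs : C.Separates τ₀) {f φ : ℝ → ℝ}
    (hf : IsCutoff (3 * C.L₀ τ₀) (4 * C.L₀ τ₀) φ f) {b : Tensor2} (hb : IsModifiedMetric C τ₀ f b)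
    {γ : PSL(2, ℂ)} (hγ : γ ∈ Γ) {p : H3} (hp : p ∈ C.Ω (C.level τ₀ 4)) (v w : E3) :
    b (γ • p) (dsmul γ p v) (dsmul γ p w) = b p v w := by
  rw [hs.isModifiedMetric_iff hf] at hb
  rw [hb p hp, hb _ (hs.smul_mem_Ω (by norm_num) hγ hp), hs.cuspHeight_smul hγ, inner_dsmul]
  have h1 := height_pos (γ • p)
  have h2 := height_pos p
  field_simp

/-! ### The isometry group -/

theorem contDiffOn_smul (h : PSL(2, ℂ)) {c : ℝ → H3} {s : Set ℝ}
    (hc : ContDiffOn ℝ 1 (fun t => (c t : E3)) s) :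
    ContDiffOn ℝ 1 (fun t => ((h • c t : H3) : E3)) s := by
  obtain ⟨A, rfl⟩ := exists_mk h
  intro t ht
  have h1 : ContDiffAt ℝ 1 (mobE A) (c t) := (contDiffAt_mobE A (c t).2).of_le (by norm_num)
  have h2 := h1.comp_contDiffWithinAt t (hc t ht)
  refine h2.congr (fun u _ => ?_) ?_ <;> exact (mobE_coe A _).symm

theorem derivWithin_smul (h : PSL(2, ℂ)) {c : ℝ → H3} {t : ℝ}
    (hc : ContDiffOn ℝ 1 (fun t => (c t : E3)) (Icc 0 1)) (ht : t ∈ Icc (0 : ℝ) 1) :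
    derivWithin (fun s => ((h • c s : H3) : E3)) (Icc 0 1) t =
      dsmul h (c t) (derivWithin (fun s => (c s : E3)) (Icc 0 1) t) := by
  obtain ⟨A, rfl⟩ := exists_mk h
  rw [dsmul_mk]
  have hu : UniqueDiffWithinAt ℝ (Icc (0 : ℝ) 1) t := uniqueDiffOn_Icc one_pos t ht
  have h1 : HasFDerivAt (mobE A) (fderiv ℝ (mobE A) (c t)) (c t : E3) :=
    ((contDiffAt_mobE A (c t).2).differentiableAt (by simp)).hasFDerivAt
  have h2 : HasDerivWithinAt (fun s => (c s : E3)) _ (Icc 0 1) t :=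
    ((hc t ht).differentiableWithinAt (by norm_num)).hasDerivWithinAt
  have h3 := h1.comp_hasDerivWithinAt t h2
  refine HasDerivWithinAt.derivWithin (h3.congr (fun u _ => ?_) ?_) hu <;>
    exact (mobE_coe A _).symm

/-- Moving a curve by h keeps its length. Only one inequality is needed, since the other is the same
statement for the inverse. -/
theorem pathDist_smul_le {b : Tensor2} {X : Set H3} {h : PSL(2, ℂ)}
    (hX : ∀ p ∈ X, h • p ∈ X)
    (hb : ∀ p ∈ X, ∀ v w : E3, b (h • p) (dsmul h p v) (dsmul h p w) = b p v w) (p q : X) :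
    pathDist b X ⟨h • (p : H3), hX p p.2⟩ ⟨h • (q : H3), hX q q.2⟩ ≤ pathDist b X p q := by
  refine le_iInf fun c => le_iInf fun hc => le_iInf fun hcX => le_iInf fun h0 => le_iInf fun h1 => ?_
  refine iInf_le_of_le (fun t => h • c t) <| iInf_le_of_le (contDiffOn_smul h hc) <|
    iInf_le_of_le (fun t ht => hX _ (hcX t ht)) <| iInf_le_of_le (by simp only [h0]) <|
    iInf_le_of_le (by simp only [h1]) (le_of_eq ?_)
  refine setLIntegral_congr_fun measurableSet_Icc fun t ht => ?_
  simp only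
  rw [derivWithin_smul h hc ht, hb _ (hcX t ht)]

/-- The action of a subgroup preserving `X` and the tensor `b` by isometries of `X`. -/
def isomHom {b : Tensor2} {X : Set H3} (hX : ∀ h ∈ Γ, ∀ p ∈ X, h • p ∈ X)
    (hb : ∀ h ∈ Γ, ∀ p ∈ X, ∀ v w : E3, b (h • p) (dsmul h p v) (dsmul h p w) = b p v w) :
    Γ →* isomGroup b X where
  toFun γ := ⟨{ toFun := fun p => ⟨(γ : PSL(2, ℂ)) • (p : H3), hX γ γ.2 p p.2⟩
                invFun := fun p => ⟨(γ : PSL(2, ℂ))⁻¹ • (p : H3), hX _ (Γ.inv_mem γ.2) p p.2⟩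
                left_inv := fun p => Subtype.ext (inv_smul_smul _ _)
                right_inv := fun p => Subtype.ext (smul_inv_smul _ _) }, fun p q => by
    refine le_antisymm (pathDist_smul_le (hX γ γ.2) (hb γ γ.2) p q) ?_
    have h := pathDist_smul_le (hX _ (Γ.inv_mem γ.2)) (hb _ (Γ.inv_mem γ.2))
      ⟨(γ : PSL(2, ℂ)) • (p : H3), hX γ γ.2 p p.2⟩ ⟨(γ : PSL(2, ℂ)) • (q : H3), hX γ γ.2 q q.2⟩
    simp only [inv_smul_smul] at h
    exact h⟩
  map_one' := Subtype.ext (Equiv.ext fun p => Subtype.ext (one_smul _ _))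
  map_mul' γ γ' := Subtype.ext (Equiv.ext fun p => Subtype.ext (mul_smul _ _ _))

theorem CuspData.Separates.nonempty_Ω (hs : C.Separates τ₀) : (C.Ω (C.level τ₀ 4)).Nonempty := by
  by_cases hk : Nonempty (Fin k)
  · obtain ⟨i⟩ := hk
    have hL := hs.L₀_pos
    refine ⟨(C.frame i)⁻¹ • ofCoords 0 (4 * C.L₀ τ₀) (by linarith), ?_⟩
    rw [hs.mem_Ω_level (by norm_num), hs.cuspHeight_eq Γ.one_mem (i := i)]
    · rw [one_smul, smul_inv_smul, height_ofCoords]; norm_num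
    · rw [one_smul, smul_inv_smul, height_ofCoords]; linarith
  · refine ⟨basePoint, C.mem_Ω.2 fun i => absurd ⟨i⟩ hk⟩

theorem injective_isomHom {b : Tensor2} {X : Set H3} (hΓ : IsCusped Γ) (hne : X.Nonempty)
    (hX : ∀ h ∈ Γ, ∀ p ∈ X, h • p ∈ X)
    (hb : ∀ h ∈ Γ, ∀ p ∈ X, ∀ v w : E3, b (h • p) (dsmul h p v) (dsmul h p w) = b p v w) :
    Function.Injective (isomHom hX hb) := by
  rw [injective_iff_map_eq_one]
  intro γ hγ
  obtain ⟨p, hp⟩ := hne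
  have h1 := congrArg (fun σ : isomGroup b X => (((σ : Equiv.Perm X) ⟨p, hp⟩ : X) : H3)) hγ
  exact Subtype.ext (hΓ.free γ γ.2 p h1)

end

/-! ### Horospherical coordinates -/

/-- The coordinates `(a - t, x, y)` on Euclidean space, in which `t ≤ a` becomes a half-space. -/
def horoE (a : ℝ) (x : E3) : E3 := !₂[a - x 2, x 0, x 1]

/-- The inverse of the coordinate change `horoE`. -/
def horoInvE (a : ℝ) (y : E3) : E3 := !₂[y 1, y 2, a - y 0]

@[simp] theorem horoE_horoInvE (a : ℝ) (y : E3) : horoE a (horoInvE a y) = y := by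
  ext i; fin_cases i <;> simp [horoE, horoInvE]

@[simp] theorem horoInvE_horoE (a : ℝ) (x : E3) : horoInvE a (horoE a x) = x := by
  ext i; fin_cases i <;> simp [horoE, horoInvE]

/-- The linear part of `horoE`. -/
def horoL : E3 →L[ℝ] E3 := LinearMap.toContinuousLinearMap
  { toFun := fun x => !₂[-x 2, x 0, x 1]
    map_add' := fun x y => by ext i; fin_cases i <;> simp [add_comm]
    map_smul' := fun c x => by ext i; fin_cases i <;> simp }

/-- The linear part of `horoInvE`. -/
def horoInvL : E3 →L[ℝ] E3 := LinearMap.toContinuousLinearMap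
  { toFun := fun y => !₂[y 1, y 2, -y 0]
    map_add' := fun x y => by ext i; fin_cases i <;> simp [add_comm]
    map_smul' := fun c x => by ext i; fin_cases i <;> simp }

theorem inner_horoL (v w : E3) : inner ℝ (horoL v) (horoL w) = inner ℝ v w := by
  simp [horoL, PiLp.inner_apply, Fin.sum_univ_three]; ring

theorem inner_horoInvL (v w : E3) : inner ℝ (horoInvL v) (horoInvL w) = inner ℝ v w := by
  simp [horoInvL, PiLp.inner_apply, Fin.sum_univ_three]; ring

theorem hasFDerivAt_horoE (a : ℝ) (x : E3) : HasFDerivAt (horoE a) horoL x := by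
  have : horoE a = fun x => horoL x + horoE a 0 := by
    funext x; ext i; fin_cases i <;> simp [horoE, horoL]; ring
  rw [this]
  exact horoL.hasFDerivAt.add_const _

theorem hasFDerivAt_horoInvE (a : ℝ) (x : E3) : HasFDerivAt (horoInvE a) horoInvL x := by
  have : horoInvE a = fun x => horoInvL x + horoInvE a 0 := by
    funext x; ext i; fin_cases i <;> simp [horoInvE, horoInvL]; ring
  rw [this]
  exact horoInvL.hasFDerivAt.add_const _

theorem contDiff_horoE (a : ℝ) : ContDiff ℝ ∞ (horoE a) := by
  have : horoE a = fun x => horoL x + horoE a 0 := by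
    funext x; ext i; fin_cases i <;> simp [horoE, horoL]; ring
  rw [this]
  exact horoL.contDiff.add contDiff_const

theorem contDiff_horoInvE (a : ℝ) : ContDiff ℝ ∞ (horoInvE a) := by
  have : horoInvE a = fun x => horoInvL x + horoInvE a 0 := by
    funext x; ext i; fin_cases i <;> simp [horoInvE, horoInvL]; ring
  rw [this]
  exact horoInvL.contDiff.add contDiff_const

/-- A Möbius transformation in horospherical coordinates. -/
def horoMob (a : ℝ) (A : SL(2, ℂ)) (y : E3) : E3 := horoE a (mobE A (horoInvE a y))

theorem horoMob_horoE (a : ℝ) (A : SL(2, ℂ)) (p : H3) :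
    horoMob a A (horoE a p) = horoE a (mob A p) := by
  rw [horoMob, horoInvE_horoE, mobE_coe]

theorem contDiffAt_horoMob (a : ℝ) (A : SL(2, ℂ)) (p : H3) :
    ContDiffAt ℝ ∞ (horoMob a A) (horoE a p) := by
  have h1 : ContDiffAt ℝ ∞ (mobE A) (horoInvE a (horoE a p)) := by
    rw [horoInvE_horoE]; exact contDiffAt_mobE A p.2
  have h2 := h1.comp (horoE a p) (contDiff_horoInvE a).contDiffAt
  exact (contDiff_horoE a).contDiffAt.comp (horoE a p) h2

theorem fderiv_horoMob (a : ℝ) (A : SL(2, ℂ)) (p : H3) : fderiv ℝ (horoMob a A) (horoE a p) =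
    horoL ∘L fderiv ℝ (mobE A) (p : E3) ∘L horoInvL := by
  have h1 : HasFDerivAt (mobE A) (fderiv ℝ (mobE A) p) (horoInvE a (horoE a p)) := by
    rw [horoInvE_horoE]
    exact ((contDiffAt_mobE A p.2).differentiableAt (by simp)).hasFDerivAt
  exact ((hasFDerivAt_horoE a _).comp _ (h1.comp _ (hasFDerivAt_horoInvE a _))).fderiv

theorem inner_fderiv_horoMob (a : ℝ) (A : SL(2, ℂ)) (p : H3) (v w : E3) :
    inner ℝ (fderiv ℝ (horoMob a A) (horoE a p) v) (fderiv ℝ (horoMob a A) (horoE a p) w) =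
      (height (mob A p) / height p) ^ 2 * inner ℝ v w := by
  rw [fderiv_horoMob]
  simp only [ContinuousLinearMap.comp_apply]
  rw [inner_horoL, inner_fderiv_mobE, inner_horoInvL]

/-! ### Horospherical charts -/

/-- `π` exhibits `X` as the quotient of `D` by the group `N`. -/
structure IsQuotientBy {D : Set H3} {X : Type*} [TopologicalSpace X] (π : D → X)
    (N : Subgroup PSL(2, ℂ)) : Prop where
  surjective : Function.Surjective π
  continuous : Continuous π
  isOpenMap : IsOpenMap π
  eq_iff : ∀ p q : D, π p = π q ↔ ∃ γ ∈ N, γ • (p : H3) = q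

/-- `h` maps the open set `W` to upper half-space in such a way that `D ∩ W` becomes a part of
`t ≤ a`, and the height function `c` on `D` becomes the height `t`, at least above the height `b`.
No two points of `W` are equivalent under `N`. -/
structure IsHoroPatch (c : H3 → ℝ) (b a : ℝ) (D : Set H3) (N : Subgroup PSL(2, ℂ)) (h : PSL(2, ℂ))
    (W : Set H3) : Prop where
  isOpen : IsOpen W
  mem_iff : ∀ q ∈ W, q ∈ D ↔ height (h • q) ≤ a
  height_eq : ∀ q ∈ W, q ∈ D → c q = height (h • q) ∨ (c q < b ∧ height (h • q) < b)
  free : ∀ γ ∈ N, ∀ q ∈ W, γ • q ∈ W → γ • q = q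

/-- `e` is the chart of `X` given by the horospherical coordinates on `h W`. -/
structure IsHoroChart {D : Set H3} {X : Type*} [TopologicalSpace X] (a : ℝ) (π : D → X)
    (h : PSL(2, ℂ)) (W : Set H3) (e : OpenPartialHomeomorph X (EuclideanHalfSpace 3)) : Prop where
  source_eq : e.source = π '' {p | (p : H3) ∈ W}
  coe_eq : ∀ p : D, (p : H3) ∈ W → ((e (π p)).1 : E3) = horoE a (h • (p : H3) : H3)

theorem exists_openPartialHomeomorph {Y Z : Type*} [TopologicalSpace Y] [TopologicalSpace Z]
    [Nonempty Y] {f : Y → Z} {V : Set Y} (hV : IsOpen V) (hc : ContinuousOn f V) (hi : InjOn f V)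
    (ho : ∀ U ⊆ V, IsOpen U → IsOpen (f '' U)) :
    ∃ e : OpenPartialHomeomorph Y Z, e.source = V ∧ ∀ x, e x = f x := by
  let e := hi.bijOn_image.toPartialEquiv
  refine ⟨OpenPartialHomeomorph.ofContinuousOpenRestrict e hc (fun U hU => ?_) hV, rfl,
    fun x => rfl⟩
  have : (e.source.domRestrict e) '' U = f '' (Subtype.val '' U) := by
    rw [image_image]; rfl
  rw [this]
  refine ho _ ?_ (hV.isOpenMap_subtype_val U hU)
  rintro _ ⟨x, -, rfl⟩
  exact x.2

/-- Horospherical coordinates with values in the half-space (cut off at height `a`). -/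
def horoHalf (a : ℝ) (p : H3) : EuclideanHalfSpace 3 :=
  ⟨!₂[max 0 (a - height p), (p : E3) 0, (p : E3) 1], le_max_left _ _⟩

theorem horoHalf_coe {a : ℝ} {p : H3} (h : height p ≤ a) : (horoHalf a p).1 = horoE a p := by
  have h1 : max 0 (a - height p) = a - height p := max_eq_right (by linarith)
  change !₂[max 0 (a - height p), (p : E3) 0, (p : E3) 1] = _
  rw [h1]
  rfl

theorem continuous_horoHalf (a : ℝ) : Continuous (horoHalf a) := by
  refine Continuous.subtype_mk ?_ _
  have := continuous_height
  fun_prop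

/-- The chart is a local inverse of π followed by the coordinates of h. The projection is injective
on the patch because no two of its points are equivalent. -/
theorem IsHoroPatch.exists_chart {c : H3 → ℝ} {b a : ℝ} {D : Set H3} {N : Subgroup PSL(2, ℂ)}
    {h : PSL(2, ℂ)} {W : Set H3} (hW : IsHoroPatch c b a D N h W) {X : Type*} [TopologicalSpace X]
    [Nonempty D] {π : D → X} (hπ : IsQuotientBy π N) : ∃ e, IsHoroChart a π h W e := by
  set V : Set D := {p | (p : H3) ∈ W} with hV
  have hVo : IsOpen V := hW.isOpen.preimage continuous_subtype_val
  have hcoe : ∀ p : D, p ∈ V → (horoHalf a (h • (p : H3))).1 = horoE a (h • (p : H3) : H3) :=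
    fun p hp => horoHalf_coe ((hW.mem_iff p hp).1 p.2)
  have hi : InjOn π V := fun p hp q hq hpq => by
    obtain ⟨γ, hγ, hγp⟩ := (hπ.eq_iff p q).1 hpq
    have := hW.free γ hγ p hp (by rw [hγp]; exact hq)
    exact Subtype.ext (this.symm.trans hγp)
  obtain ⟨e₁, hs₁, he₁⟩ := exists_openPartialHomeomorph hVo hπ.continuous.continuousOn hi
    fun U _ hU => hπ.isOpenMap U hU
  obtain ⟨e₂, hs₂, he₂⟩ := exists_openPartialHomeomorph
    (f := fun p : D => horoHalf a (h • (p : H3))) hVo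
    ((continuous_horoHalf a).comp (continuous_subtype_val.const_smul h)).continuousOn
    (fun p hp q hq hpq => by
      have h1 := congrArg Subtype.val hpq
      simp only at h1
      rw [hcoe p hp, hcoe q hq] at h1
      have h2 := congrArg (horoInvE a) h1
      rw [horoInvE_horoE, horoInvE_horoE] at h2
      exact Subtype.ext (smul_left_cancel h (Subtype.ext h2)))
    -- A half-space point lying over h(U′ ∩ W) has height at most a, so `mem_iff` places its
    -- preimage in D. The image is thus relatively open in the half-space, boundary points included.
    (fun U hUV hU => by
      obtain ⟨U', hU', rfl⟩ := isOpen_induced_iff.1 hU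
      have e : (fun p : D => horoHalf a (h • (p : H3))) '' (Subtype.val ⁻¹' U') =
          (fun y : EuclideanHalfSpace 3 => horoInvE a y.1) ⁻¹'
            (Subtype.val '' translate h (U' ∩ W)) := by
        ext y
        constructor
        · rintro ⟨p, hp, rfl⟩
          refine ⟨h • (p : H3), ⟨p, ⟨hp, hUV hp⟩, rfl⟩, ?_⟩
          simp only
          rw [hcoe p (hUV hp), horoInvE_horoE]
        · rintro ⟨_, ⟨q, ⟨hq, hqW⟩, rfl⟩, hqy⟩
          have hqy : ((h • q : H3) : E3) = horoInvE a y.1 := hqy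
          have h1 : horoE a (h • q : H3) = y.1 := by rw [hqy, horoE_horoInvE]
          have h2 : height (h • q) ≤ a := by
            have h3 : height (h • q) = a - y.1 0 := by
              rw [height, hqy]; simp [horoInvE]
            have := y.2
            linarith
          refine ⟨⟨q, (hW.mem_iff q hqW).2 h2⟩, hq, Subtype.ext ?_⟩
          change (horoHalf a (h • q)).1 = _
          rw [horoHalf_coe h2, h1]
      rw [e]
      refine IsOpen.preimage ((contDiff_horoInvE a).continuous.comp continuous_subtype_val) ?_
      exact upperHalfSpace.isOpen.isOpenMap_subtype_val _
        (isOpen_translate h (hU'.inter hW.isOpen)))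
  have himg : e₁.target = π '' V := by
    rw [← e₁.image_source_eq_target, hs₁]
    exact image_congr fun p _ => he₁ p
  refine ⟨e₁.symm.trans e₂, ?_, fun p hp => ?_⟩
  · rw [OpenPartialHomeomorph.trans_source, e₁.symm_source, himg, hs₂]
    refine inter_eq_left.2 ?_
    rintro _ ⟨p, hp, rfl⟩
    change e₁.symm (π p) ∈ V
    rw [← he₁ p, e₁.left_inv (hs₁.symm ▸ hp)]
    exact hp
  · change (e₂ (e₁.symm (π p))).1 = _
    rw [← he₁ p, e₁.left_inv (hs₁.symm ▸ hp), he₂]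
    exact hcoe p hp

/-! ### Transition maps -/

section

variable {c : H3 → ℝ} {b a : ℝ} {D : Set H3} {N N' : Subgroup PSL(2, ℂ)} {h h' : PSL(2, ℂ)}
  {W W' : Set H3} {X X' : Type*} [TopologicalSpace X] [TopologicalSpace X'] {π : D → X}
  {π' : D → X'} {e : OpenPartialHomeomorph X (EuclideanHalfSpace 3)}
  {e' : OpenPartialHomeomorph X' (EuclideanHalfSpace 3)}

theorem IsHoroChart.mem_source (he : IsHoroChart a π h W e) {p : D} (hp : (p : H3) ∈ W) :
    π p ∈ e.source := by
  rw [he.source_eq]; exact ⟨p, hp, rfl⟩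

/-- Near the coordinates of p every half-space point comes from a point of D close to p. Identities
between maps can therefore be checked on D, at the boundary as well. -/
theorem IsHoroChart.eventually_symm (he : IsHoroChart a π h W e) (hW : IsHoroPatch c b a D N h W)
    {p : D} (hp : (p : H3) ∈ W) {U : Set H3} (hU : U ∈ nhds (p : H3)) :
    ∀ᶠ z in nhdsWithin (horoE a (h • (p : H3) : H3)) (range (𝓡∂ 3)), ∃ q : D, (q : H3) ∈ W ∧
      (q : H3) ∈ U ∧ horoE a (h • (q : H3) : H3) = z ∧ e.symm ((𝓡∂ 3).symm z) = π q := by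
  obtain ⟨U', hU'U, hU'o, hpU'⟩ := mem_nhds_iff.1 hU
  have ho : IsOpen (horoInvE a ⁻¹' (Subtype.val '' translate h (W ∩ U'))) :=
    (upperHalfSpace.isOpen.isOpenMap_subtype_val _
      (isOpen_translate h (hW.isOpen.inter hU'o))).preimage (contDiff_horoInvE a).continuous
  have hmem : horoE a (h • (p : H3) : H3) ∈
      horoInvE a ⁻¹' (Subtype.val '' translate h (W ∩ U')) := by
    rw [mem_preimage, horoInvE_horoE]
    exact ⟨_, ⟨p, ⟨hp, hpU'⟩, rfl⟩, rfl⟩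
  filter_upwards [nhdsWithin_le_nhds (ho.mem_nhds hmem), self_mem_nhdsWithin] with z hz hzr
  obtain ⟨_, ⟨q, ⟨hqW, hqU⟩, rfl⟩, hqz⟩ := hz
  obtain ⟨y, rfl⟩ := hzr
  have hqy : ((h • q : H3) : E3) = horoInvE a y.1 := hqz
  have h1 : horoE a (h • q : H3) = y.1 := by rw [hqy, horoE_horoInvE]
  have h2 : height (h • q) ≤ a := by
    have h3 : height (h • q) = a - y.1 0 := by
      rw [height, hqy]; simp [horoInvE]
    have := y.2
    linarith
  refine ⟨⟨q, (hW.mem_iff q hqW).2 h2⟩, hqW, hU'U hqU, h1, ?_⟩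
  rw [(𝓡∂ 3).left_inv]
  have h4 : e (π ⟨q, (hW.mem_iff q hqW).2 h2⟩) = y := by
    apply Subtype.ext
    rw [he.coe_eq _ hqW]
    exact h1
  rw [← h4, e.left_inv (he.mem_source hqW)]

/-- A map covered by the identity of D is in charts the Möbius map h′ γ h⁻¹. With F the identity
this treats transition maps, with F = π the projection. -/
theorem IsHoroChart.eventually_transition (he : IsHoroChart a π h W e)
    (hW : IsHoroPatch c b a D N h W) (he' : IsHoroChart a π' h' W' e')
    (hW' : IsHoroPatch c b a D N' h' W') (hπ' : IsQuotientBy π' N')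
    (hN' : ∀ γ ∈ N', ∀ q ∈ D, γ • q ∈ D) {F : X → X'}
    (hF : ∀ p, F (π p) = π' p) {p : D} (hp : (p : H3) ∈ W) {γ : PSL(2, ℂ)} (hγ : γ ∈ N')
    (hγp : γ • (p : H3) ∈ W') {A : SL(2, ℂ)} (hA : (A : PSL(2, ℂ)) = h' * γ * h⁻¹) :
    ∀ᶠ z in nhdsWithin (horoE a (h • (p : H3) : H3)) (range (𝓡∂ 3)),
      F (e.symm ((𝓡∂ 3).symm z)) ∈ e'.source ∧
      (e' (F (e.symm ((𝓡∂ 3).symm z)))).1 = horoMob a A z := by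
  have hU : {q : H3 | γ • q ∈ W'} ∈ nhds (p : H3) :=
    (hW'.isOpen.preimage (continuous_const_smul γ)).mem_nhds hγp
  filter_upwards [he.eventually_symm hW hp hU] with z ⟨q, hqW, hqU, hqz, hqe⟩
  have h1 : π' q = π' ⟨γ • (q : H3), hN' γ hγ q q.2⟩ := (hπ'.eq_iff _ _).2 ⟨γ, hγ, rfl⟩
  rw [hqe, hF, h1]
  refine ⟨he'.mem_source hqU, ?_⟩
  rw [he'.coe_eq _ hqU, ← hqz, horoMob_horoE, ← mk_smul, hA]
  congr 2
  simp only [← mul_smul]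
  congr 1
  group

end

section

variable {c : H3 → ℝ} {b a : ℝ} {D : Set H3} {N N' : Subgroup PSL(2, ℂ)}
  {X X' : Type*} [TopologicalSpace X] [TopologicalSpace X'] {π : D → X} {π' : D → X'}

/-! ### The smooth structure -/

/-- The charts of `X` are given by horospherical coordinates. -/
def IsHoroAtlas (c : H3 → ℝ) (b a : ℝ) (π : D → X) (N : Subgroup PSL(2, ℂ))
    [ChartedSpace (EuclideanHalfSpace 3) X] : Prop :=
  ∀ e ∈ atlas (EuclideanHalfSpace 3) X, ∃ h W, IsHoroPatch c b a D N h W ∧ IsHoroChart a π h W e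

theorem exists_chartedSpace (hπ : IsQuotientBy π N)
    (hD : ∀ p ∈ D, ∃ h W, IsHoroPatch c b a D N h W ∧ p ∈ W) :
    ∃ _ : ChartedSpace (EuclideanHalfSpace 3) X, IsHoroAtlas c b a π N := by
  have hx : ∀ x : X, ∃ e : OpenPartialHomeomorph X (EuclideanHalfSpace 3), x ∈ e.source ∧
      ∃ h W, IsHoroPatch c b a D N h W ∧ IsHoroChart a π h W e := by
    intro x
    obtain ⟨p, rfl⟩ := hπ.surjective x
    obtain ⟨h, W, hW, hp⟩ := hD p p.2
    have : Nonempty D := ⟨p⟩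
    obtain ⟨e, he⟩ := hW.exists_chart hπ
    exact ⟨e, he.mem_source hp, h, W, hW, he⟩
  choose e he hpatch using hx
  refine ⟨{ atlas := range e, chartAt := e, mem_chart_source := he,
            chart_mem_atlas := fun x => ⟨x, rfl⟩ }, ?_⟩
  rintro _ ⟨x, rfl⟩
  exact hpatch x

theorem IsHoroAtlas.isManifold [ChartedSpace (EuclideanHalfSpace 3) X]
    (hX : IsHoroAtlas c b a π N) (hπ : IsQuotientBy π N) (hN : ∀ γ ∈ N, ∀ q ∈ D, γ • q ∈ D) :
    IsManifold (𝓡∂ 3) ∞ X := by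
  refine isManifold_of_contDiffOn _ _ _ fun e e' hm hm' z hz => ?_
  obtain ⟨h, W, hW, he⟩ := hX e hm
  obtain ⟨h', W', hW', he'⟩ := hX e' hm'
  obtain ⟨hz1, hz2⟩ := hz
  rw [mem_preimage, OpenPartialHomeomorph.trans_source, OpenPartialHomeomorph.symm_source] at hz1
  obtain ⟨hz1, hz3⟩ := hz1
  have hs : e.symm ((𝓡∂ 3).symm z) ∈ e.source := e.map_target hz1
  rw [he.source_eq] at hs
  obtain ⟨p, hp, hpz⟩ := hs
  have hz3 : e.symm ((𝓡∂ 3).symm z) ∈ e'.source := hz3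
  rw [he'.source_eq] at hz3
  obtain ⟨p', hp', hpz'⟩ := hz3
  obtain ⟨γ, hγ, hγp⟩ := (hπ.eq_iff p p').1 (hpz.trans hpz'.symm)
  obtain ⟨A, hA⟩ := exists_mk (h' * γ * h⁻¹)
  have hzp : horoE a (h • (p : H3) : H3) = z := by
    rw [← he.coe_eq p hp, hpz, e.right_inv hz1]
    exact (𝓡∂ 3).right_inv hz2
  have hev := he.eventually_transition hW he' hW' hπ hN (F := id) (fun _ => rfl) hp hγ
    (by rw [hγp]; exact hp') hA
  have hsm := contDiffAt_horoMob a A (h • (p : H3))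
  rw [hzp] at hev hsm
  refine (hsm.contDiffWithinAt.congr_of_eventuallyEq_of_mem ?_ hz2).mono inter_subset_right
  filter_upwards [hev] with y hy using hy.2

theorem IsHoroAtlas.exists_chart [ChartedSpace (EuclideanHalfSpace 3) X]
    (hX : IsHoroAtlas c b a π N) (x : X) : ∃ h W, ∃ p : D, IsHoroPatch c b a D N h W ∧
      IsHoroChart a π h W (chartAt (EuclideanHalfSpace 3) x) ∧ (p : H3) ∈ W ∧ π p = x := by
  obtain ⟨h, W, hW, he⟩ := hX _ (chart_mem_atlas (EuclideanHalfSpace 3) x)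
  have hs := mem_chart_source (EuclideanHalfSpace 3) x
  rw [he.source_eq] at hs
  obtain ⟨p, hp, hpx⟩ := hs
  exact ⟨h, W, p, hW, he, hp, hpx⟩

theorem IsHoroChart.extChartAt_eq [ChartedSpace (EuclideanHalfSpace 3) X] {x : X} {h : PSL(2, ℂ)}
    {W : Set H3} (he : IsHoroChart a π h W (chartAt (EuclideanHalfSpace 3) x)) {p : D}
    (hp : (p : H3) ∈ W) : extChartAt (𝓡∂ 3) x (π p) = horoE a (h • (p : H3) : H3) :=
  he.coe_eq p hp

/-- The derivative of a map induced by the identity of `D`, in horospherical charts. -/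
theorem IsHoroChart.hasFDerivWithinAt [ChartedSpace (EuclideanHalfSpace 3) X]
    [ChartedSpace (EuclideanHalfSpace 3) X'] {x : X} {x' : X'} {h h' : PSL(2, ℂ)} {W W' : Set H3}
    (he : IsHoroChart a π h W (chartAt (EuclideanHalfSpace 3) x)) (hW : IsHoroPatch c b a D N h W)
    (he' : IsHoroChart a π' h' W' (chartAt (EuclideanHalfSpace 3) x'))
    (hW' : IsHoroPatch c b a D N' h' W') (hπ' : IsQuotientBy π' N')
    (hN' : ∀ γ ∈ N', ∀ q ∈ D, γ • q ∈ D) {F : X → X'}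
    (hF : ∀ p, F (π p) = π' p) {p : D} (hp : (p : H3) ∈ W) {γ : PSL(2, ℂ)} (hγ : γ ∈ N')
    (hγp : γ • (p : H3) ∈ W') {A : SL(2, ℂ)} (hA : (A : PSL(2, ℂ)) = h' * γ * h⁻¹) :
    HasFDerivWithinAt (extChartAt (𝓡∂ 3) x' ∘ F ∘ (extChartAt (𝓡∂ 3) x).symm)
      (fderiv ℝ (horoMob a A) (horoE a (h • (p : H3) : H3))) (range (𝓡∂ 3))
      (horoE a (h • (p : H3) : H3)) := by
  have h1 := ((contDiffAt_horoMob a A (h • (p : H3))).differentiableAt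
    (by simp)).hasFDerivAt.hasFDerivWithinAt (s := range (𝓡∂ 3))
  refine (Filter.EventuallyEq.hasFDerivWithinAt_iff_of_mem ?_ ?_).2 h1
  · filter_upwards [he.eventually_transition hW he' hW' hπ' hN' hF hp hγ hγp hA] with z hz
    exact hz.2
  · rw [← he.extChartAt_eq hp]
    exact mem_range_self _

theorem IsQuotientBy.continuous_of_comp (hπ : IsQuotientBy π N) (hπ' : IsQuotientBy π' N')
    {F : X → X'} (hF : ∀ p, F (π p) = π' p) : Continuous F := by
  have hq : Topology.IsQuotientMap π := hπ.isOpenMap.isQuotientMap hπ.continuous hπ.surjective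
  rw [hq.continuous_iff]
  exact hπ'.continuous.congr fun p => (hF p).symm

theorem IsHoroChart.hasMFDerivAt [ChartedSpace (EuclideanHalfSpace 3) X]
    [ChartedSpace (EuclideanHalfSpace 3) X'] {h h' : PSL(2, ℂ)} {W W' : Set H3}
    {p : D} (he : IsHoroChart a π h W (chartAt (EuclideanHalfSpace 3) (π p)))
    (hW : IsHoroPatch c b a D N h W)
    (he' : IsHoroChart a π' h' W' (chartAt (EuclideanHalfSpace 3) (π' p)))
    (hW' : IsHoroPatch c b a D N' h' W') (hπ : IsQuotientBy π N) (hπ' : IsQuotientBy π' N')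
    (hN' : ∀ γ ∈ N', ∀ q ∈ D, γ • q ∈ D) {F : X → X'}
    (hF : ∀ p, F (π p) = π' p) (hp : (p : H3) ∈ W) {γ : PSL(2, ℂ)} (hγ : γ ∈ N')
    (hγp : γ • (p : H3) ∈ W') {A : SL(2, ℂ)} (hA : (A : PSL(2, ℂ)) = h' * γ * h⁻¹) :
    HasMFDerivAt (𝓡∂ 3) (𝓡∂ 3) F (π p)
      (fderiv ℝ (horoMob a A) (horoE a (h • (p : H3) : H3))) := by
  refine ⟨(hπ.continuous_of_comp hπ' hF).continuousAt, ?_⟩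
  rw [he.extChartAt_eq hp, writtenInExtChartAt, hF]
  exact he.hasFDerivWithinAt hW he' hW' hπ' hN' hF hp hγ hγp hA

theorem IsHoroAtlas.contMDiff [ChartedSpace (EuclideanHalfSpace 3) X]
    [ChartedSpace (EuclideanHalfSpace 3) X'] (hX : IsHoroAtlas c b a π N)
    (hX' : IsHoroAtlas c b a π' N') (hπ : IsQuotientBy π N) (hπ' : IsQuotientBy π' N')
    (hN' : ∀ γ ∈ N', ∀ q ∈ D, γ • q ∈ D) {F : X → X'} (hF : ∀ p, F (π p) = π' p) :
    ContMDiff (𝓡∂ 3) (𝓡∂ 3) ∞ F := by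
  intro x
  obtain ⟨h, W, p, hW, he, hp, rfl⟩ := hX.exists_chart x
  obtain ⟨h', W', p', hW', he', hp', hpp'⟩ := hX'.exists_chart (F (π p))
  rw [hF] at hpp'
  obtain ⟨γ, hγ, hγp⟩ := (hπ'.eq_iff p p').1 hpp'.symm
  obtain ⟨A, hA⟩ := exists_mk (h' * γ * h⁻¹)
  rw [contMDiffAt_iff]
  refine ⟨(hπ.continuous_of_comp hπ' hF).continuousAt, ?_⟩
  rw [he.extChartAt_eq hp]
  refine (contDiffAt_horoMob a A (h • (p : H3))).contDiffWithinAt.congr_of_eventuallyEq_of_mem ?_ ?_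
  · filter_upwards [he.eventually_transition hW he' hW' hπ' hN' hF hp hγ
      (by rw [hγp]; exact hp') hA] with z hz
    exact hz.2
  · rw [← he.extChartAt_eq hp]
    exact mem_range_self _

/-! ### The inclusion into hyperbolic space -/

theorem hasFDerivAt_mobE_horoInvE (A : SL(2, ℂ)) (p : H3) :
    HasFDerivAt (fun z => mobE A (horoInvE a z)) (fderiv ℝ (mobE A) (p : E3) ∘L horoInvL)
      (horoE a p) := by
  have h1 : HasFDerivAt (mobE A) (fderiv ℝ (mobE A) p) (horoInvE a (horoE a p)) := by
    rw [horoInvE_horoE]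
    exact ((contDiffAt_mobE A p.2).differentiableAt (by simp)).hasFDerivAt
  exact h1.comp _ (hasFDerivAt_horoInvE a _)

theorem IsHoroChart.eventually_val [ChartedSpace (EuclideanHalfSpace 3) D] {h : PSL(2, ℂ)}
    {W : Set H3} {p : D} (he : IsHoroChart a (id : D → D) h W (chartAt (EuclideanHalfSpace 3) p))
    (hW : IsHoroPatch c b a D N h W) (hp : (p : H3) ∈ W) {A : SL(2, ℂ)}
    (hA : (A : PSL(2, ℂ)) = h⁻¹) (x₀ : H3) :
    (extChartAt (𝓡 3) x₀ ∘ (Subtype.val : D → H3) ∘ (extChartAt (𝓡∂ 3) p).symm)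
      =ᶠ[nhdsWithin (horoE a (h • (p : H3) : H3)) (range (𝓡∂ 3))]
        fun z => mobE A (horoInvE a z) := by
  filter_upwards [he.eventually_symm hW hp Filter.univ_mem] with z ⟨q, hqW, _, hqz, hqe⟩
  have h1 : (extChartAt (𝓡∂ 3) p).symm z = q := hqe
  change extChartAt (𝓡 3) x₀ ((extChartAt (𝓡∂ 3) p).symm z : H3) = _
  rw [h1, extChartAt_H3, ← hqz, horoInvE_horoE, mobE_coe, ← mk_smul, hA, inv_smul_smul]

theorem IsHoroChart.hasMFDerivAt_val [ChartedSpace (EuclideanHalfSpace 3) D] {h : PSL(2, ℂ)}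
    {W : Set H3} {p : D} (he : IsHoroChart a (id : D → D) h W (chartAt (EuclideanHalfSpace 3) p))
    (hW : IsHoroPatch c b a D N h W) (hp : (p : H3) ∈ W) {A : SL(2, ℂ)}
    (hA : (A : PSL(2, ℂ)) = h⁻¹) :
    HasMFDerivAt (𝓡∂ 3) (𝓡 3) (Subtype.val : D → H3) p
      (fderiv ℝ (mobE A) ((h • (p : H3) : H3) : E3) ∘L horoInvL) := by
  refine ⟨continuous_subtype_val.continuousAt, ?_⟩
  have hx : extChartAt (𝓡∂ 3) p p = horoE a (h • (p : H3) : H3) := he.extChartAt_eq hp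
  rw [hx]
  refine ((he.eventually_val hW hp hA _).hasFDerivWithinAt_iff_of_mem ?_).2
    (hasFDerivAt_mobE_horoInvE A _).hasFDerivWithinAt
  rw [← hx]
  exact mem_range_self _

theorem IsHoroAtlas.contMDiff_val [ChartedSpace (EuclideanHalfSpace 3) D]
    (hX : IsHoroAtlas c b a (id : D → D) N) :
    ContMDiff (𝓡∂ 3) (𝓡 3) ∞ (Subtype.val : D → H3) := by
  intro p
  obtain ⟨h, W, _, hW, he, hp, rfl⟩ := hX.exists_chart p
  rename_i p
  obtain ⟨A, hA⟩ := exists_mk h⁻¹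
  rw [contMDiffAt_iff]
  refine ⟨continuous_subtype_val.continuousAt, ?_⟩
  have hx : extChartAt (𝓡∂ 3) p p = horoE a (h • (p : H3) : H3) := he.extChartAt_eq hp
  change ContDiffWithinAt ℝ ∞ _ _ (extChartAt (𝓡∂ 3) p p)
  rw [hx]
  have hsm : ContDiffAt ℝ ∞ (fun z => mobE A (horoInvE a z)) (horoE a (h • (p : H3) : H3)) := by
    have h1 : ContDiffAt ℝ ∞ (mobE A) (horoInvE a (horoE a (h • (p : H3) : H3))) := by
      rw [horoInvE_horoE]; exact contDiffAt_mobE A (h • (p : H3)).2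
    exact h1.comp _ (contDiff_horoInvE a).contDiffAt
  refine hsm.contDiffWithinAt.congr_of_eventuallyEq_of_mem (he.eventually_val hW hp hA _) ?_
  rw [← hx]
  exact mem_range_self _

end

/-! ### The metric in horospherical charts -/

section

variable {c : H3 → ℝ} {b a : ℝ} {D : Set H3} {N N' : Subgroup PSL(2, ℂ)} {f : ℝ → ℝ}
  {X X' : Type*} [TopologicalSpace X] [TopologicalSpace X'] {π : D → X} {π' : D → X'}

/-- Below b the function f is the identity and both quotients are 1. A patch away from the cusps may
thus use a height unrelated to c. -/
theorem IsHoroPatch.ratio_eq {h : PSL(2, ℂ)} {W : Set H3} (hW : IsHoroPatch c b a D N h W)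
    (hc : ∀ p, 0 < c p) (hf : ∀ t, 0 < t → t ≤ b → f t = t) {p : H3} (hp : p ∈ W) (hpD : p ∈ D) :
    height (h • p) / f (height (h • p)) = c p / f (c p) := by
  rcases hW.height_eq p hp hpD with h1 | ⟨h1, h2⟩
  · rw [h1]
  · have h3 := height_pos (h • p)
    rw [hf _ (hc p) h1.le, hf _ h3 h2.le, div_self (hc p).ne', div_self h3.ne']

theorem horoE_zero (a : ℝ) (p : H3) : a - horoE a p 0 = height p := by
  simp [horoE, height]

/-- The conformal factor of the metric at `x`. -/
def horoFactor (a : ℝ) (f : ℝ → ℝ) [ChartedSpace (EuclideanHalfSpace 3) X] (x₀ x : X) : ℝ :=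
  1 / f (a - extChartAt (𝓡∂ 3) x₀ x 0) ^ 2

variable [ChartedSpace (EuclideanHalfSpace 3) X]

theorem IsHoroAtlas.horoFactor_pos (hX : IsHoroAtlas c b a π N)
    (hfpos : ∀ t, 0 < t → 0 < f t) {x₀ x : X}
    (hx : x ∈ (chartAt (EuclideanHalfSpace 3) x₀).source) : 0 < horoFactor a f x₀ x := by
  obtain ⟨h, W, -, hW, he, -, -⟩ := hX.exists_chart x₀
  rw [he.source_eq] at hx
  obtain ⟨p, hp, rfl⟩ := hx
  rw [horoFactor, he.extChartAt_eq hp, horoE_zero]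
  have := hfpos _ (height_pos (h • (p : H3)))
  positivity

theorem IsHoroAtlas.contMDiffAt_horoFactor (hX : IsHoroAtlas c b a π N)
    (hfs : ContDiffOn ℝ ∞ f (Ioi 0)) (hfpos : ∀ t, 0 < t → 0 < f t) (x₀ : X) :
    ContMDiffAt (𝓡∂ 3) 𝓘(ℝ, ℝ) ∞ (horoFactor a f x₀) x₀ := by
  obtain ⟨h, W, p, hW, he, hp, rfl⟩ := hX.exists_chart x₀
  have h1 : ContDiffAt ℝ ∞ (fun y : E3 => 1 / f (a - y 0) ^ 2)
      (extChartAt (𝓡∂ 3) (π p) (π p)) := by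
    rw [he.extChartAt_eq hp]
    have ht := height_pos (h • (p : H3))
    have h2 : ContDiffAt ℝ ∞ f (a - horoE a (h • (p : H3) : H3) 0) := by
      rw [horoE_zero]; exact hfs.contDiffAt (Ioi_mem_nhds ht)
    have h3 : ContDiffAt ℝ ∞ (fun y : E3 => a - y 0) (horoE a (h • (p : H3) : H3)) := by fun_prop
    have h4 := h2.comp (horoE a (h • (p : H3) : H3)) h3
    refine contDiffAt_const.div (h4.pow 2) ?_
    simp only [horoE_zero]
    exact (pow_pos (hfpos _ ht) 2).ne'
  exact h1.contMDiffAt.comp (π p) contMDiffAt_extChartAt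

variable [IsManifold (𝓡∂ 3) ∞ X]

/-- The derivative of a transition map multiplies scalar products by (t′ / t)². By `ratio_eq` and
the invariance of c this is (f(t′) / f(t))², so the local metrics agree. -/
theorem IsHoroAtlas.inner_tangentCoordChange (hX : IsHoroAtlas c b a π N) (hπ : IsQuotientBy π N)
    (hN : ∀ γ ∈ N, ∀ q ∈ D, γ • q ∈ D) (hc : ∀ p, 0 < c p) (hcN : ∀ γ ∈ N, ∀ p, c (γ • p) = c p)
    (hf : ∀ t, 0 < t → t ≤ b → f t = t) (hfpos : ∀ t, 0 < t → 0 < f t) {x₀ x : X}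
    (hx : x ∈ (chartAt (EuclideanHalfSpace 3) x₀).source) (v w : E3) :
    horoFactor a f x x * inner ℝ (tangentCoordChange (𝓡∂ 3) x₀ x x v)
      (tangentCoordChange (𝓡∂ 3) x₀ x x w) = horoFactor a f x₀ x * inner ℝ v w := by
  obtain ⟨h, W, -, hW, he, -, -⟩ := hX.exists_chart x₀
  rw [he.source_eq] at hx
  obtain ⟨p, hp, rfl⟩ := hx
  obtain ⟨h', W', p', hW', he', hp', hpp'⟩ := hX.exists_chart (π p)
  obtain ⟨γ, hγ, hγp⟩ := (hπ.eq_iff p p').1 hpp'.symm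
  obtain ⟨A, hA⟩ := exists_mk (h' * γ * h⁻¹)
  have h1 := he.hasFDerivWithinAt hW he' hW' hπ hN (F := id) (fun _ => rfl) hp hγ
    (by rw [hγp]; exact hp') hA
  have hmem : horoE a (h • (p : H3) : H3) ∈ range (𝓡∂ 3) := by
    rw [← he.extChartAt_eq hp]
    exact mem_range_self _
  have h2 : tangentCoordChange (𝓡∂ 3) x₀ (π p) (π p) =
      fderiv ℝ (horoMob a A) (horoE a (h • (p : H3) : H3)) := by
    rw [tangentCoordChange_def, he.extChartAt_eq hp]
    exact h1.fderivWithin ((𝓡∂ 3).uniqueDiffOn _ hmem)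
  have h3 : mob A (h • (p : H3)) = h' • (p' : H3) := by
    rw [← mk_smul, hA, ← hγp]
    simp only [← mul_smul]
    congr 1
    group
  have h4 : extChartAt (𝓡∂ 3) (π p) (π p) = horoE a (h' • (p' : H3) : H3) := by
    rw [← he'.extChartAt_eq hp', hpp']
  rw [h2, inner_fderiv_horoMob, h3, horoFactor, horoFactor, h4, he.extChartAt_eq hp, horoE_zero,
    horoE_zero]
  have r1 := hW.ratio_eq hc hf hp p.2
  have r2 := hW'.ratio_eq hc hf hp' p'.2
  rw [← hγp, hcN γ hγ, ← r1, hγp] at r2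
  have t1 := height_pos (h • (p : H3))
  have t2 := height_pos (h' • (p' : H3))
  have f1 := hfpos _ t1
  have f2 := hfpos _ t2
  rw [div_eq_div_iff f2.ne' f1.ne'] at r2
  have r3 : height (h' • (p' : H3)) / height (h • (p : H3)) =
      f (height (h' • (p' : H3))) / f (height (h • (p : H3))) := by
    rw [div_eq_div_iff t1.ne' f1.ne']; linarith
  rw [r3]
  field_simp

theorem trivial_linearMapAt {Y : Type*} [TopologicalSpace Y] (x₀ x : Y) (r : ℝ) :
    (trivializationAt ℝ (Bundle.Trivial Y ℝ) x₀).linearMapAt ℝ x r = r := by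
  simp only [Bundle.Trivial.fiberBundle_trivializationAt', Bundle.Trivial.linearMapAt_trivialization]
  rfl

/-- The Euclidean inner product as a continuous bilinear form. -/
def innerE : E3 →L[ℝ] E3 →L[ℝ] ℝ := innerSL ℝ

/-- The scalar products of the metric given by `horoFactor`. -/
def horoInner (a : ℝ) (f : ℝ → ℝ) (x : X) :
    TangentSpace (𝓡∂ 3) x →L[ℝ] TangentSpace (𝓡∂ 3) x →L[ℝ] ℝ :=
  (horoFactor a f x x • innerE : E3 →L[ℝ] E3 →L[ℝ] ℝ)

/-- The Riemannian metric on `X` that is `(dx² + dy² + dt²) / f(t)²` in horospherical charts. -/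
def horoMetric (hX : IsHoroAtlas c b a π N) (hπ : IsQuotientBy π N)
    (hN : ∀ γ ∈ N, ∀ q ∈ D, γ • q ∈ D) (hc : ∀ p, 0 < c p) (hcN : ∀ γ ∈ N, ∀ p, c (γ • p) = c p)
    (hf : ∀ t, 0 < t → t ≤ b → f t = t) (hfs : ContDiffOn ℝ ∞ f (Ioi 0))
    (hfpos : ∀ t, 0 < t → 0 < f t) : Metric3 X where
  inner := horoInner a f
  symm x v w := by
    exact congrArg (horoFactor a f x x * ·) (@real_inner_comm E3 _ _ w v)
  pos x v hv := by
    change 0 < horoFactor a f x x * @inner ℝ E3 _ v v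
    exact mul_pos (hX.horoFactor_pos hfpos (mem_chart_source _ x))
      (@real_inner_self_pos E3 _ _ v |>.2 hv)
  isVonNBounded x := by
    change Bornology.IsVonNBounded ℝ {v : E3 | horoFactor a f x x * inner ℝ v v < 1}
    have hpos := hX.horoFactor_pos hfpos (mem_chart_source (EuclideanHalfSpace 3) x)
    refine (NormedSpace.isVonNBounded_closedBall ℝ E3
      (1 / horoFactor a f x x + 1)).subset fun v hv => ?_
    have hv : horoFactor a f x x * inner ℝ v v < 1 := hv
    rw [real_inner_self_eq_norm_sq] at hv
    rw [mem_closedBall_zero_iff]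
    have h1 : ‖v‖ ^ 2 < 1 / horoFactor a f x x := by
      rw [lt_div_iff₀ hpos]; linarith
    nlinarith [sq_nonneg (‖v‖ - 1), norm_nonneg v]
  contMDiff := by
    intro x₀
    rw [contMDiffAt_hom_bundle]
    refine ⟨contMDiffAt_id, ?_⟩
    -- In the trivialization at x₀ the metric is a smooth scalar times the constant Euclidean form,
    -- although `horoInner` is defined with the chart at x itself.
    have hs : ContMDiffAt (𝓡∂ 3) 𝓘(ℝ, E3 →L[ℝ] E3 →L[ℝ] ℝ) ∞
        (fun x => horoFactor a f x₀ x • innerE) x₀ :=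
      (hX.contMDiffAt_horoFactor hfs hfpos x₀).smul contMDiffAt_const
    refine hs.congr_of_eventuallyEq ?_
    filter_upwards [(chartAt (EuclideanHalfSpace 3) x₀).open_source.mem_nhds
      (mem_chart_source _ x₀)] with x hx
    ext v w
    refine (inCoordinates_apply_eq₂ (E₁ := fun x : X => TangentSpace (𝓡∂ 3) x)
      (E₂ := fun x : X => TangentSpace (𝓡∂ 3) x) (E₃ := Bundle.Trivial X ℝ)
      (ϕ := horoInner a f x) hx hx (mem_univ _)).trans ?_
    have h1 := hX.inner_tangentCoordChange hπ hN hc hcN hf hfpos hx v w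
    have h2 : ∀ u : E3, (trivializationAt E3 (fun x : X => TangentSpace (𝓡∂ 3) x) x₀).symm x u =
        tangentCoordChange (𝓡∂ 3) x₀ x x u := by
      intro u
      have h3 := DFunLike.congr_fun (TangentBundle.symmL_trivializationAt_eq_core (I := 𝓡∂ 3) hx) u
      rw [Bundle.Trivialization.symmL_apply (hb := hx)] at h3
      exact h3
    refine Eq.trans ?_ h1
    rw [h2, h2]
    exact trivial_linearMapAt x₀ x _

end

/-! ### Boundary, curvature and projection in horospherical charts. -/

section

variable {c : H3 → ℝ} {b a : ℝ} {D : Set H3} {N N' : Subgroup PSL(2, ℂ)} {f φ : ℝ → ℝ}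
  {X : Type*} [TopologicalSpace X] {π : D → X}

variable [ChartedSpace (EuclideanHalfSpace 3) X]

/-- The height of a point of `X` in its preferred horospherical chart. -/
def chartHeight (a : ℝ) (x : X) : ℝ := a - extChartAt (𝓡∂ 3) x x 0

/-- The preferred chart at a point was chosen arbitrarily. It shows the invariant height c, except
where both heights are below b and their exact value does not matter. -/
theorem IsHoroAtlas.chartHeight_spec (hX : IsHoroAtlas c b a π N) (hπ : IsQuotientBy π N)
    (hcN : ∀ γ ∈ N, ∀ p, c (γ • p) = c p) (p : D) : 0 < chartHeight a (π p) ∧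
      (c p = chartHeight a (π p) ∨ (c p < b ∧ chartHeight a (π p) < b)) := by
  obtain ⟨h, W, p', hW, he, hp', hpp'⟩ := hX.exists_chart (π p)
  obtain ⟨γ, hγ, hγp⟩ := (hπ.eq_iff p p').1 hpp'.symm
  have h1 : chartHeight a (π p) = height (h • (p' : H3)) := by
    have h2 := he.extChartAt_eq hp'
    rw [hpp'] at h2
    rw [chartHeight, h2, horoE_zero]
  rw [h1, ← hcN γ hγ, hγp]
  exact ⟨height_pos _, hW.height_eq p' hp' p'.2⟩

theorem isBoundaryPoint_iff_chartHeight (a : ℝ) (x : X) :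
    (𝓡∂ 3).IsBoundaryPoint x ↔ chartHeight a x = a := by
  rw [ModelWithCorners.isBoundaryPoint_iff, frontier_range_modelWithCornersEuclideanHalfSpace,
    chartHeight]
  change (0 : ℝ) = _ ↔ _
  constructor <;> intro h <;> linarith

theorem isInteriorPoint_iff_chartHeight (a : ℝ) (x : X) :
    (𝓡∂ 3).IsInteriorPoint x ↔ chartHeight a x < a := by
  rw [ModelWithCorners.IsInteriorPoint, interior_range_modelWithCornersEuclideanHalfSpace,
    chartHeight]
  change (0 : ℝ) < _ ↔ _
  constructor <;> intro h <;> linarith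

/-- A translate of a neighbourhood of p lies in a patch, where no two points are equivalent, so π is
injective near p. In charts its local inverse is again a Möbius map. -/
theorem IsHoroAtlas.isLocalDiffeomorph (hX : IsHoroAtlas c b a π N) (hπ : IsQuotientBy π N)
    (hN : ∀ γ ∈ N, ∀ q ∈ D, γ • q ∈ D)
    [ChartedSpace (EuclideanHalfSpace 3) D] (hD : IsHoroAtlas c b a (id : D → D) N')
    (hπ' : IsQuotientBy (id : D → D) N') : IsLocalDiffeomorph (𝓡∂ 3) (𝓡∂ 3) ∞ π := by
  intro p
  obtain ⟨h₀, W₀, p₀, hW₀, -, hp₀, hpp₀⟩ := hX.exists_chart (π p)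
  obtain ⟨γ₀, hγ₀, hγp₀⟩ := (hπ.eq_iff p p₀).1 hpp₀.symm
  set V : Set D := {q | γ₀ • (q : H3) ∈ W₀} with hV
  have hVo : IsOpen V := hW₀.isOpen.preimage (continuous_subtype_val.const_smul γ₀)
  have hpV : p ∈ V := by
    change γ₀ • (p : H3) ∈ W₀
    rw [hγp₀]; exact hp₀
  have hi : InjOn π V := fun q hq q' hq' hqq => by
    obtain ⟨γ, hγ, hγq⟩ := (hπ.eq_iff q q').1 hqq
    have e : (γ₀ * γ * γ₀⁻¹) • γ₀ • (q : H3) = γ₀ • (q' : H3) := by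
      rw [← hγq]
      simp only [← mul_smul]
      congr 1
      group
    have h1 := hW₀.free _ (N.mul_mem (N.mul_mem hγ₀ hγ) (N.inv_mem hγ₀)) _ hq (by rw [e]; exact hq')
    rw [e] at h1
    exact Subtype.ext (smul_left_cancel γ₀ h1).symm
  have : Nonempty D := ⟨p⟩
  obtain ⟨e, hes, hee⟩ := exists_openPartialHomeomorph hVo hπ.continuous.continuousOn hi
    fun U _ hU => hπ.isOpenMap U hU
  have hsm : ContMDiff (𝓡∂ 3) (𝓡∂ 3) ∞ π := hD.contMDiff hX hπ' hπ hN fun _ => rfl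
  have hfun : (e : D → X) = π := funext hee
  refine ⟨{ toPartialEquiv := e.toPartialEquiv
            open_source := e.open_source
            open_target := e.open_target
            contMDiffOn_toFun := ?_
            contMDiffOn_invFun := ?_ }, hes.symm ▸ hpV, fun q _ => (hee q).symm⟩
  · change ContMDiffOn (𝓡∂ 3) (𝓡∂ 3) ∞ (e : D → X) e.source
    rw [hfun]
    exact hsm.contMDiffOn
  · change ContMDiffOn (𝓡∂ 3) (𝓡∂ 3) ∞ e.symm e.target
    intro y hy
    refine ContMDiffAt.contMDiffWithinAt ?_
    obtain ⟨q, hqV, rfl⟩ : ∃ q ∈ V, π q = y :=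
      ⟨e.symm y, hes ▸ e.map_target hy, by rw [← hee, e.right_inv hy]⟩
    have hsymm : ∀ r ∈ V, e.symm (π r) = r := fun r hr => by
      rw [← hee, e.left_inv (hes.symm ▸ hr)]
    obtain ⟨h, W, _, hW, he, hq, rfl⟩ := hD.exists_chart q
    rename_i q
    change q ∈ V at hqV
    obtain ⟨h', W', q', hW', he', hq', hqq'⟩ := hX.exists_chart (π q)
    obtain ⟨γ, hγ, hγq⟩ := (hπ.eq_iff q q').1 hqq'.symm
    obtain ⟨A, hA⟩ := exists_mk (h * γ⁻¹ * h'⁻¹)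
    have hx : extChartAt (𝓡∂ 3) (π q) (π q) = horoE a (h' • (q' : H3) : H3) := by
      rw [← he'.extChartAt_eq hq', hqq']
    change ContMDiffAt (𝓡∂ 3) (𝓡∂ 3) ∞ e.symm (π q)
    rw [contMDiffAt_iff]
    refine ⟨e.continuousAt_symm hy, ?_⟩
    rw [hsymm q hqV, hx]
    refine (contDiffAt_horoMob a A (h' • (q' : H3))).contDiffWithinAt.congr_of_eventuallyEq_of_mem
      ?_ ?_
    -- The local inverse sends π r to γ⁻¹ • r. The neighbourhood must keep this point both in V and
    -- in the domain of the chart at q.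
    · have hU : {r : H3 | γ₀ • γ⁻¹ • r ∈ W₀ ∧ γ⁻¹ • r ∈ W} ∈ nhds (q' : H3) := by
        refine IsOpen.mem_nhds ((hW₀.isOpen.preimage ((continuous_id.const_smul γ⁻¹).const_smul γ₀)).inter
          (hW.isOpen.preimage (continuous_id.const_smul γ⁻¹))) ?_
        change γ₀ • γ⁻¹ • (q' : H3) ∈ W₀ ∧ γ⁻¹ • (q' : H3) ∈ W
        rw [← hγq, inv_smul_smul]
        exact ⟨hqV, hq⟩
      filter_upwards [he'.eventually_symm hW' hq' hU] with z ⟨r, hrW, hrU, hrz, hre⟩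
      set r' : D := ⟨γ⁻¹ • (r : H3), hN _ (N.inv_mem hγ) r r.2⟩ with hr'
      have h1 : π r = π r' := (hπ.eq_iff _ _).2 ⟨γ⁻¹, N.inv_mem hγ, rfl⟩
      have h2 : (extChartAt (𝓡∂ 3) (π q)).symm z = π r' := hre.trans h1
      change extChartAt (𝓡∂ 3) q (e.symm ((extChartAt (𝓡∂ 3) (π q)).symm z)) = _
      rw [h2, hsymm r' hrU.1]
      have h3 : extChartAt (𝓡∂ 3) q r' = horoE a (h • (r' : H3) : H3) := he.extChartAt_eq hrU.2
      rw [h3, ← hrz, horoMob_horoE, ← mk_smul, hA, hr']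
      congr 2
      simp only [← mul_smul]
      congr 1
      group
    · rw [← hx]
      exact mem_range_self _

variable [IsManifold (𝓡∂ 3) ∞ X]

theorem chartCoeff_horoMetric (hX : IsHoroAtlas c b a π N) (hπ : IsQuotientBy π N)
    (hN : ∀ γ ∈ N, ∀ q ∈ D, γ • q ∈ D) (hc : ∀ p, 0 < c p) (hcN : ∀ γ ∈ N, ∀ p, c (γ • p) = c p)
    (hf : ∀ t, 0 < t → t ≤ b → f t = t) (hfs : ContDiffOn ℝ ∞ f (Ioi 0))
    (hfpos : ∀ t, 0 < t → 0 < f t) (x₀ : X) {y : E3} (hy : y ∈ (extChartAt (𝓡∂ 3) x₀).target) :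
    chartCoeff (horoMetric hX hπ hN hc hcN hf hfs hfpos) x₀ y =
      (1 / f (a - y 0) ^ 2) • (1 : Matrix (Fin 3) (Fin 3) ℝ) := by
  set x := (extChartAt (𝓡∂ 3) x₀).symm y with hx
  have hxs : x ∈ (chartAt (EuclideanHalfSpace 3) x₀).source := by
    rw [← extChartAt_source (𝓡∂ 3)]
    exact (extChartAt (𝓡∂ 3) x₀).map_target hy
  have hyx : extChartAt (𝓡∂ 3) x₀ x = y := (extChartAt (𝓡∂ 3) x₀).right_inv hy
  have h1 := TangentBundle.symmL_trivializationAt (I := 𝓡∂ 3) hxs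
  rw [TangentBundle.symmL_trivializationAt_eq_core hxs, hyx] at h1
  ext i j
  have h2 := hX.inner_tangentCoordChange hπ hN hc hcN hf hfpos hxs
    (EuclideanSpace.single i (1 : ℝ)) (EuclideanSpace.single j (1 : ℝ))
  have h3 : ∀ u : E3, mfderivWithin 𝓘(ℝ, E3) (𝓡∂ 3) (extChartAt (𝓡∂ 3) x₀).symm
      (range (𝓡∂ 3)) y u = tangentCoordChange (𝓡∂ 3) x₀ x x u := fun u =>
    (DFunLike.congr_fun h1 u).symm
  refine Eq.trans ?_ (h2.trans ?_)
  · change horoInner a f x _ _ = _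
    rw [h3, h3]
    rfl
  · rw [horoFactor, hyx, Matrix.smul_apply, Matrix.one_apply, smul_eq_mul,
      EuclideanSpace.inner_single_left]
    congr 1
    by_cases hij : i = j
    · subst hij; simp
    · simp [hij]

/-- The first coordinate is a − t, so the logarithmic derivative of the conformal function is −φ,
and its derivative is +φ′ after a second change of sign. -/
theorem horoMetric_sectionalCurvature (hφ : IsCutoff b a φ f) (hX : IsHoroAtlas c b a π N)
    (hπ : IsQuotientBy π N)
    (hN : ∀ γ ∈ N, ∀ q ∈ D, γ • q ∈ D) (hc : ∀ p, 0 < c p) (hcN : ∀ γ ∈ N, ∀ p, c (γ • p) = c p)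
    (p : D) (u v : E3) :
    sectionalCurvature (horoMetric hX hπ hN hc hcN hφ.f_eq_id hφ.smooth_f hφ.f_pos) (π p) u v =
      f (chartHeight a (π p)) ^ 2 * (deriv φ (chartHeight a (π p)) *
        ((u 0 * v 1 - u 1 * v 0) ^ 2 + (u 0 * v 2 - u 2 * v 0) ^ 2)
        - φ (chartHeight a (π p)) ^ 2 * (u 1 * v 2 - u 2 * v 1) ^ 2) /
      ((u 0 * v 1 - u 1 * v 0) ^ 2 + (u 0 * v 2 - u 2 * v 0) ^ 2 + (u 1 * v 2 - u 2 * v 1) ^ 2) := by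
  have ht := (hX.chartHeight_spec hπ hcN p).1
  have h1 := sectional_conformal (s := range (𝓡∂ 3)) (y := extChartAt (𝓡∂ 3) (π p) (π p))
    (𝓡∂ 3).uniqueDiffOn
    (G := chartCoeff (horoMetric hX hπ hN hc hcN hφ.f_eq_id hφ.smooth_f hφ.f_pos) (π p))
    (F := fun s => f (a - s)) (q := fun s => -φ (a - s)) (q' := deriv φ (chartHeight a (π p)))
    (mem_range_self _) ?_ ?_ ?_ u v
  · rw [sectionalCurvature, h1]
    simp only [neg_sq]
    rfl
  · have hev : ∀ᶠ z in nhds (extChartAt (𝓡∂ 3) (π p) (π p)), 0 < a - z 0 := by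
      have : ContinuousAt (fun z : E3 => a - z 0) (extChartAt (𝓡∂ 3) (π p) (π p)) := by fun_prop
      exact this.eventually (lt_mem_nhds ht)
    filter_upwards [nhdsWithin_le_nhds hev] with z hz
    refine ⟨?_, (hφ.f_pos _ hz).ne'⟩
    have h2 := (hφ.hasDerivAt_f hz).comp (z 0) ((hasDerivAt_id (z 0)).const_sub a)
    have e : f (a - z 0) * φ (a - z 0) * -1 = f (a - z 0) * -φ (a - z 0) := by ring
    rw [← e]
    exact h2
  · filter_upwards [extChartAt_target_mem_nhdsWithin (I := 𝓡∂ 3) (π p)] with y hy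
    exact chartCoeff_horoMetric hX hπ hN hc hcN hφ.f_eq_id hφ.smooth_f hφ.f_pos (π p) hy
  · have h2 := ((hφ.hasDerivAt_φ ht).comp (extChartAt (𝓡∂ 3) (π p) (π p) 0)
      ((hasDerivAt_id (extChartAt (𝓡∂ 3) (π p) (π p) 0)).const_sub a)).neg
    rw [mul_neg_one, neg_neg] at h2
    exact h2

theorem horoMetric_sectionalCurvature_neg (hφ : IsCutoff b a φ f)
    (hX : IsHoroAtlas c b a π N) (hπ : IsQuotientBy π N)
    (hN : ∀ γ ∈ N, ∀ q ∈ D, γ • q ∈ D) (hc : ∀ p, 0 < c p) (hcN : ∀ γ ∈ N, ∀ p, c (γ • p) = c p)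
    {x : X} (hx : (𝓡∂ 3).IsInteriorPoint x) {u v : E3} (huv : LinearIndependent ℝ ![u, v]) :
    sectionalCurvature (horoMetric hX hπ hN hc hcN hφ.f_eq_id hφ.smooth_f hφ.f_pos) x u v < 0 := by
  obtain ⟨p, rfl⟩ := hπ.surjective x
  have ht := (hX.chartHeight_spec hπ hcN p).1
  rw [isInteriorPoint_iff_chartHeight a] at hx
  rw [horoMetric_sectionalCurvature hφ]
  have hd := hφ.deriv_φ_neg' ht hx
  have h0 := hφ.φ_pos ht hx
  have hp := plucker_pos huv
  refine div_neg_of_neg_of_pos (mul_neg_of_pos_of_neg (pow_pos (hφ.f_pos _ ht) 2) ?_) hp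
  set A := (u 0 * v 1 - u 1 * v 0) ^ 2 + (u 0 * v 2 - u 2 * v 0) ^ 2 with hA
  have hA0 : 0 ≤ A := by positivity
  have hB0 : 0 ≤ (u 1 * v 2 - u 2 * v 1) ^ 2 := sq_nonneg _
  have h02 : 0 < φ (chartHeight a (π p)) ^ 2 := pow_pos h0 2
  -- If the minors with the first coordinate vanish, the plane is horizontal and −φ² supplies the
  -- negative term; otherwise φ′ does.
  rcases hA0.eq_or_lt with hA1 | hA1
  · rw [← hA1] at hp ⊢
    nlinarith [mul_pos h02 (by linarith : 0 < (u 1 * v 2 - u 2 * v 1) ^ 2)]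
  · nlinarith [mul_pos (neg_pos.2 hd) hA1, mul_nonneg h02.le hB0]

theorem horoMetric_sectionalCurvature_eq (hφ : IsCutoff b a φ f)
    (hX : IsHoroAtlas c b a π N) (hπ : IsQuotientBy π N)
    (hN : ∀ γ ∈ N, ∀ q ∈ D, γ • q ∈ D) (hc : ∀ p, 0 < c p) (hcN : ∀ γ ∈ N, ∀ p, c (γ • p) = c p)
    {p : D} (hp : c p ≤ b) {u v : E3} (huv : LinearIndependent ℝ ![u, v]) :
    sectionalCurvature (horoMetric hX hπ hN hc hcN hφ.f_eq_id hφ.smooth_f hφ.f_pos) (π p) u v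
      = -1 := by
  obtain ⟨ht, h⟩ := hX.chartHeight_spec hπ hcN p
  have htb : chartHeight a (π p) ≤ b := by
    rcases h with h | h
    · rwa [← h]
    · exact h.2.le
  have hpl := plucker_pos huv
  rw [horoMetric_sectionalCurvature hφ, hφ.f_eq_id _ ht htb, hφ.φ_eq_inv _ ht htb,
    hφ.deriv_φ_eq ht htb, div_eq_iff hpl.ne']
  field_simp
  ring

/-- At the boundary t = a every Christoffel symbol is a multiple of φ(a) = 0. -/
theorem horoMetric_hasTotallyGeodesicBoundary (ha : 0 < a) (hφ : IsCutoff b a φ f)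
    (hX : IsHoroAtlas c b a π N) (hπ : IsQuotientBy π N)
    (hN : ∀ γ ∈ N, ∀ q ∈ D, γ • q ∈ D) (hc : ∀ p, 0 < c p)
    (hcN : ∀ γ ∈ N, ∀ p, c (γ • p) = c p) :
    HasTotallyGeodesicBoundary
      (horoMetric hX hπ hN hc hcN hφ.f_eq_id hφ.smooth_f hφ.f_pos) := by
  intro x hx i j _ _
  have hx : (𝓡∂ 3).IsBoundaryPoint x := hx
  rw [isBoundaryPoint_iff_chartHeight a] at hx
  have ht : a - extChartAt (𝓡∂ 3) x x 0 = a := hx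
  have hpos : 0 < a - extChartAt (𝓡∂ 3) x x 0 := by rwa [ht]
  refine (christoffel_conformal (s := range (𝓡∂ 3)) (y := extChartAt (𝓡∂ 3) x x)
    (F := fun s => f (a - s)) (q := -φ (a - extChartAt (𝓡∂ 3) x x 0))
    ((𝓡∂ 3).uniqueDiffOn _ (mem_range_self _)) ?_ (hφ.f_pos _ hpos).ne' ?_ (mem_range_self _)
    0 i j).trans ?_
  · have h2 := (hφ.hasDerivAt_f hpos).comp (extChartAt (𝓡∂ 3) x x 0)
      ((hasDerivAt_id (extChartAt (𝓡∂ 3) x x 0)).const_sub a)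
    have e : ∀ r s : ℝ, r * s * -1 = r * -s := fun r s => by ring
    rw [e] at h2
    exact h2
  · filter_upwards [extChartAt_target_mem_nhdsWithin (I := 𝓡∂ 3) x] with y hy
    exact chartCoeff_horoMetric hX hπ hN hc hcN hφ.f_eq_id hφ.smooth_f hφ.f_pos x hy
  · rw [ht, hφ.φ_eq_zero a le_rfl, neg_zero, neg_zero, zero_mul]

/-! ### The projection -/

variable [ChartedSpace (EuclideanHalfSpace 3) D]

/-- In the chart of D at height t, the projection scales by t′ / t and the inclusion by `height p` /
t. Dividing out leaves (t′ / f(t′))² / (height p)², where t′ / f(t′) is the invariant ratio. -/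
theorem horoMetric_inner_mfderiv (hX : IsHoroAtlas c b a π N) (hπ : IsQuotientBy π N)
    (hN : ∀ γ ∈ N, ∀ q ∈ D, γ • q ∈ D) (hc : ∀ p, 0 < c p) (hcN : ∀ γ ∈ N, ∀ p, c (γ • p) = c p)
    (hf : ∀ t, 0 < t → t ≤ b → f t = t) (hfs : ContDiffOn ℝ ∞ f (Ioi 0))
    (hfpos : ∀ t, 0 < t → 0 < f t) (hD : IsHoroAtlas c b a (id : D → D) N')
    (hπ' : IsQuotientBy (id : D → D) N') (p : D) (v w : E3) :
    (horoMetric hX hπ hN hc hcN hf hfs hfpos).inner (π p)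
        (mfderiv (𝓡∂ 3) (𝓡∂ 3) π p v) (mfderiv (𝓡∂ 3) (𝓡∂ 3) π p w) =
      (c p / f (c p)) ^ 2 / height p ^ 2 *
        @inner ℝ E3 _ (mfderiv (𝓡∂ 3) (𝓡 3) (Subtype.val : D → H3) p v)
          (mfderiv (𝓡∂ 3) (𝓡 3) (Subtype.val : D → H3) p w) := by
  obtain ⟨h, W, _, hW, he, hp, rfl⟩ := hD.exists_chart p
  rename_i p
  change (horoMetric hX hπ hN hc hcN hf hfs hfpos).inner (π p)
        (mfderiv (𝓡∂ 3) (𝓡∂ 3) π p v) (mfderiv (𝓡∂ 3) (𝓡∂ 3) π p w) =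
      (c p / f (c p)) ^ 2 / height p ^ 2 *
        @inner ℝ E3 _ (mfderiv (𝓡∂ 3) (𝓡 3) (Subtype.val : D → H3) p v)
          (mfderiv (𝓡∂ 3) (𝓡 3) (Subtype.val : D → H3) p w)
  obtain ⟨h', W', p', hW', he', hp', hpp'⟩ := hX.exists_chart (π p)
  obtain ⟨γ, hγ, hγp⟩ := (hπ.eq_iff p p').1 hpp'.symm
  obtain ⟨A, hA⟩ := exists_mk (h' * γ * h⁻¹)
  obtain ⟨B, hB⟩ := exists_mk h⁻¹
  have h1 := (he.hasMFDerivAt hW he' hW' hπ' hπ hN (F := π) (fun _ => rfl) hp hγ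
    (by rw [hγp]; exact hp') hA).mfderiv
  have h2 := (he.hasMFDerivAt_val hW hp hB).mfderiv
  have h1' : mfderiv (𝓡∂ 3) (𝓡∂ 3) π p =
    fderiv ℝ (horoMob a A) (horoE a (h • (p : H3) : H3)) := h1
  have h2' : mfderiv (𝓡∂ 3) (𝓡 3) (Subtype.val : D → H3) p =
    fderiv ℝ (mobE B) ((h • (p : H3) : H3) : E3) ∘L horoInvL := h2
  have h3 : mob A (h • (p : H3)) = h' • (p' : H3) := by
    rw [← mk_smul, hA, ← hγp]
    simp only [← mul_smul]
    congr 1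
    group
  have h4 : mob B (h • (p : H3)) = p := by
    rw [← mk_smul, hB, inv_smul_smul]
  have h5 : extChartAt (𝓡∂ 3) (π p) (π p) = horoE a (h' • (p' : H3) : H3) := by
    rw [← he'.extChartAt_eq hp', hpp']
  rw [h1', h2']
  have e1 := inner_fderiv_horoMob a A (h • (p : H3)) v w
  have e2 := inner_fderiv_mobE B (h • (p : H3)) (horoInvL v) (horoInvL w)
  rw [inner_horoInvL, h4] at e2
  rw [h3] at e1
  refine Eq.trans (congrArg (horoFactor a f (π p) (π p) * ·) e1) ?_
  refine Eq.trans ?_ (congrArg ((c p / f (c p)) ^ 2 / height p ^ 2 * ·) e2.symm)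
  rw [horoFactor, h5, horoE_zero]
  have r2 := hW'.ratio_eq hc hf hp' p'.2
  rw [← hγp, hcN γ hγ, hγp] at r2
  rw [← r2]
  have t1 := height_pos (h • (p : H3))
  have t2 := height_pos (h' • (p' : H3))
  have t3 := height_pos (p : H3)
  have f2 := hfpos _ t2
  field_simp

/-- The derivative is conformal with positive factor, hence injective, and the dimensions agree. -/
theorem IsHoroAtlas.bijective_mfderiv_val (hD : IsHoroAtlas c b a (id : D → D) N') (p : D) :
    Function.Bijective (mfderiv (𝓡∂ 3) (𝓡 3) (Subtype.val : D → H3) p) := by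
  obtain ⟨h, W, _, hW, he, hp, rfl⟩ := hD.exists_chart p
  rename_i p
  obtain ⟨B, hB⟩ := exists_mk h⁻¹
  have h2 := (he.hasMFDerivAt_val hW hp hB).mfderiv
  have h2' : mfderiv (𝓡∂ 3) (𝓡 3) (Subtype.val : D → H3) p =
    fderiv ℝ (mobE B) ((h • (p : H3) : H3) : E3) ∘L horoInvL := h2
  set L : E3 →L[ℝ] E3 := fderiv ℝ (mobE B) ((h • (p : H3) : H3) : E3) ∘L horoInvL with hL
  have hinj : Function.Injective L := by
    rw [injective_iff_map_eq_zero]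
    intro v hv
    have e := inner_fderiv_mobE B (h • (p : H3)) (horoInvL v) (horoInvL v)
    rw [inner_horoInvL] at e
    have hv : fderiv ℝ (mobE B) ((h • (p : H3) : H3) : E3) (horoInvL v) = 0 := hv
    rw [hv, inner_zero_left] at e
    have t1 := height_pos (h • (p : H3))
    have t2 := height_pos (mob B (h • (p : H3)))
    have h5 : inner ℝ v v = 0 := by
      rcases mul_eq_zero.1 e.symm with h6 | h6
      · exact absurd h6 (by positivity)
      · exact h6
    exact inner_self_eq_zero.1 h5
  have hbij : Function.Bijective L :=
    ⟨hinj, (LinearMap.injective_iff_surjective (f := (L : E3 →ₗ[ℝ] E3))).1 hinj⟩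
  rw [← h2'] at hbij
  exact hbij

end

/-! ### Horospherical patches of the truncated manifold -/

/-- A compact neighbourhood meets only finitely many of its translates. Each nontrivial element
among these moves p and is removed by separating p from its image. -/
theorem exists_wandering_nhds {Γ : Subgroup PSL(2, ℂ)} (hΓ : IsCusped Γ) (p : H3) :
    ∃ U : Set H3, IsOpen U ∧ p ∈ U ∧ ∀ γ ∈ Γ, ∀ q ∈ U, γ • q ∈ U → γ • q = q := by
  have hloc : LocallyCompactSpace H3 := upperHalfSpace.isOpen.locallyCompactSpace
  obtain ⟨K, hK, hpK⟩ := exists_compact_mem_nhds p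
  have := hΓ.properlyDiscontinuous
  have hfin : {γ : Γ | ((fun x : H3 => γ • x) '' K ∩ K).Nonempty}.Finite :=
    ProperlyDiscontinuousSMul.finite_disjoint_inter_image hK hK
  have hsep : ∀ γ : Γ, ∃ V : Set H3, IsOpen V ∧ p ∈ V ∧ (γ ≠ 1 → ∀ q ∈ V, γ • q ∉ V) := by
    intro γ
    by_cases hγ : γ = 1
    · exact ⟨univ, isOpen_univ, trivial, fun h => absurd hγ h⟩
    · have hne : γ • p ≠ p := fun h => hγ (Subtype.ext (hΓ.free γ γ.2 p h))
      obtain ⟨V₁, V₂, h1, h2, hp1, hp2, hd⟩ := t2_separation hne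
      refine ⟨V₂ ∩ (fun x => γ • x) ⁻¹' V₁, h2.inter (h1.preimage (continuous_const_smul γ)),
        ⟨hp2, hp1⟩, fun _ q hq hq' => ?_⟩
      exact Set.disjoint_left.1 hd hq.2 hq'.1
  choose V hVo hpV hV using hsep
  refine ⟨interior K ∩ ⋂ γ ∈ {γ : Γ | ((fun x : H3 => γ • x) '' K ∩ K).Nonempty}, V γ,
    isOpen_interior.inter (hfin.isOpen_biInter fun γ _ => hVo γ),
    ⟨mem_interior_iff_mem_nhds.2 hpK, mem_iInter₂.2 fun γ _ => hpV γ⟩, fun γ hγ q hq hq' => ?_⟩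
  by_contra hne
  have hγ1 : (⟨γ, hγ⟩ : Γ) ≠ 1 := fun h => hne (by
    have h1 : γ = 1 := congrArg Subtype.val h
    rw [h1, one_smul])
  have hmem : (⟨γ, hγ⟩ : Γ) ∈ {γ : Γ | ((fun x : H3 => γ • x) '' K ∩ K).Nonempty} :=
    ⟨γ • q, ⟨q, interior_subset hq.1, rfl⟩, interior_subset hq'.1⟩
  exact hV ⟨γ, hγ⟩ hγ1 q (mem_iInter₂.1 hq.2 _ hmem) (mem_iInter₂.1 hq'.2 _ hmem)

theorem exists_smul_eq (p q : H3) : ∃ h : PSL(2, ℂ), h • p = q := by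
  obtain ⟨g, -, hg⟩ := exists_mob_basePoint p
  obtain ⟨g', -, hg'⟩ := exists_mob_basePoint q
  refine ⟨(g' : PSL(2, ℂ)) * (g : PSL(2, ℂ))⁻¹, ?_⟩
  rw [← hg, ← mk_smul, mul_smul, inv_smul_smul, mk_smul, hg']

namespace CuspData

variable {Γ : Subgroup PSL(2, ℂ)} {k : ℕ} {C : CuspData Γ k} {τ₀ : ℝ}

/-- A value of `sep` below 1 keeps the ratio of heights below 3, since s ≥ 3t gives (s − t)² > s t.
-/
theorem Separates.cuspHeight_lt_of_sep (hs : C.Separates τ₀) {p q : H3}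
    (hp : ∀ i, ∀ γ ∈ Γ, height (C.frame i • γ • p) ≤ C.L₀ τ₀) (hq : sep p q < 1) :
    C.cuspHeight τ₀ q < 3 * C.L₀ τ₀ := by
  have hL := hs.L₀_pos
  rcases cuspHeight_eq_or hs q with ⟨i, γ, hγ, -, e⟩ | ⟨-, e⟩
  · rw [e]
    by_contra hlt
    push Not at hlt
    have h1 := hp i γ hγ
    have h2 : sep (C.frame i • γ • p) (C.frame i • γ • q) < 1 := by rwa [sep_smul, sep_smul]
    have t1 := height_pos (C.frame i • γ • p)
    have t2 := height_pos (C.frame i • γ • q)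
    rw [sep, div_lt_one (mul_pos t1 t2)] at h2
    have h3 := Complex.normSq_nonneg (horiz (C.frame i • γ • p) - horiz (C.frame i • γ • q))
    have h4 : 3 * height (C.frame i • γ • p) ≤ height (C.frame i • γ • q) := by linarith
    nlinarith
  · rw [e]; linarith

/-- Above L₀ the frame of the cusp itself gives the patch. Elsewhere a small ball stays below 3 L₀
in every cusp, where the metric is hyperbolic and any isometry can serve as a chart. -/
theorem Separates.exists_patch (hs : C.Separates τ₀) (hΓ : IsCusped Γ) {N : Subgroup PSL(2, ℂ)}
    (hN : N ≤ Γ) (p : H3) : ∃ h W, IsHoroPatch (C.cuspHeight τ₀) (3 * C.L₀ τ₀) (4 * C.L₀ τ₀)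
      (C.Ω (C.level τ₀ 4)) N h W ∧ p ∈ W := by
  have hL := hs.L₀_pos
  obtain ⟨U, hUo, hpU, hU⟩ := exists_wandering_nhds hΓ p
  have hmem : ∀ q, q ∈ C.Ω (C.level τ₀ 4) ↔ C.cuspHeight τ₀ q ≤ 4 * C.L₀ τ₀ := fun q => by
    rw [hs.mem_Ω_level (by norm_num)]; norm_num
  have hcont : ∀ h : PSL(2, ℂ), Continuous fun q : H3 => height (h • q) := fun h =>
    continuous_height.comp (continuous_const_smul h)
  rcases cuspHeight_eq_or hs p with ⟨i, γ, hγ, h, -⟩ | ⟨h, -⟩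
  · have heq : ∀ q, C.L₀ τ₀ < height ((C.frame i * γ) • q) →
        C.cuspHeight τ₀ q = height ((C.frame i * γ) • q) := fun q hq => by
      rw [mul_smul] at hq ⊢
      exact hs.cuspHeight_eq hγ hq
    refine ⟨C.frame i * γ, {q | C.L₀ τ₀ < height ((C.frame i * γ) • q)} ∩ U, ⟨?_, ?_, ?_, ?_⟩,
      ?_, hpU⟩
    · exact (isOpen_lt continuous_const (hcont _)).inter hUo
    · intro q hq
      rw [hmem, heq q hq.1]
    · intro q hq _
      exact Or.inl (heq q hq.1)
    · intro γ' hγ' q hq hq'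
      exact hU γ' (hN hγ') q hq.2 hq'.2
    · change _ < height ((C.frame i * γ) • p)
      rwa [mul_smul]
  -- The choice of g is free; height L₀ leaves room below 3 L₀, and so keeps the patch away from the
  -- boundary t = 4 L₀.
  · obtain ⟨g, hg⟩ := exists_smul_eq p (ofCoords 0 (C.L₀ τ₀) hL)
    refine ⟨g, {q | height (g • q) < 3 * C.L₀ τ₀} ∩ {q | sep p q < 1} ∩ U, ⟨?_, ?_, ?_, ?_⟩,
      ⟨?_, ?_⟩, hpU⟩
    · refine ((isOpen_lt (hcont g) continuous_const).inter ?_).inter hUo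
      exact isOpen_lt (continuous_sep.comp (Continuous.prodMk_right p)) continuous_const
    · intro q hq
      have h1 := hs.cuspHeight_lt_of_sep h hq.1.2
      have h2 : height (g • q) < 3 * C.L₀ τ₀ := hq.1.1
      rw [hmem]
      exact ⟨fun _ => by linarith, fun _ => by linarith⟩
    · intro q hq _
      exact Or.inr ⟨hs.cuspHeight_lt_of_sep h hq.1.2, hq.1.1⟩
    · intro γ' hγ' q hq hq'
      exact hU γ' (hN hγ') q hq.2 hq'.2
    · change height (g • p) < _
      rw [hg, height_ofCoords]; linarith
    · change sep p p < 1
      rw [sep_self]; exact one_pos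

theorem isQuotientBy_projΩ (C : CuspData Γ k) (τ : ℝ) : IsQuotientBy (C.projΩ τ) Γ where
  surjective := by
    rintro ⟨x, hx⟩
    obtain ⟨p, rfl⟩ : ∃ p, proj Γ p = x := Quotient.exists_rep x
    exact ⟨⟨p, by rw [← C.proj_preimage_M]; exact hx⟩, rfl⟩
  continuous := ((continuous_proj Γ).comp continuous_subtype_val).subtype_mk _
  isOpenMap := by
    intro U hU
    obtain ⟨U', hU', rfl⟩ := isOpen_induced_iff.1 hU
    have e : C.projΩ τ '' (Subtype.val ⁻¹' U') = Subtype.val ⁻¹' (proj Γ '' U') := by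
      ext ⟨x, hx⟩
      constructor
      · rintro ⟨p, hp, h⟩
        exact ⟨p, hp, congrArg Subtype.val h⟩
      · rintro ⟨p, hp, rfl⟩
        exact ⟨⟨p, by rw [← C.proj_preimage_M]; exact hx⟩, hp, rfl⟩
    rw [e]
    exact (isOpenMap_proj Γ U' hU').preimage continuous_subtype_val
  eq_iff p q := by
    constructor
    · intro h
      exact exists_smul_of_proj_eq (congrArg Subtype.val h)
    · rintro ⟨γ, hγ, h⟩
      apply Subtype.ext
      change proj Γ p = proj Γ q
      rw [← h, proj_smul hγ]

theorem Separates.exists_height_iff (hs : C.Separates τ₀) (p : H3) :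
    C.cuspHeight τ₀ p = 4 * C.L₀ τ₀ ↔
      ∃ i, ∃ γ ∈ Γ, height (C.frame i • γ • p) = 4 * C.L₀ τ₀ := by
  have hL := hs.L₀_pos
  constructor
  · intro h
    rcases cuspHeight_eq_or hs p with ⟨i, γ, hγ, -, e⟩ | ⟨-, e⟩
    · exact ⟨i, γ, hγ, e ▸ h⟩
    · linarith
  · rintro ⟨i, γ, hγ, h⟩
    rw [hs.cuspHeight_eq hγ (by linarith), h]

end CuspData

theorem isQuotientBy_id (D : Set H3) : IsQuotientBy (id : D → D) (⊥ : Subgroup PSL(2, ℂ)) where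
  surjective := Function.surjective_id
  continuous := continuous_id
  isOpenMap := IsOpenMap.id
  eq_iff p q := by
    constructor
    · rintro h
      exact ⟨1, Subgroup.one_mem _, by rw [one_smul]; exact congrArg Subtype.val h⟩
    · rintro ⟨γ, hγ, h⟩
      rw [Subgroup.mem_bot.1 hγ, one_smul] at h
      exact Subtype.ext h

end CuspedHyperbolic

end

/-! ### The main theorem. -/

open CuspedHyperbolic

theorem theorem4p2 (Γ : Subgroup PSL(2, ℂ)) (hΓ : IsCusped Γ) :
    -- the normalized description of the cusps exists
    (∃ k : ℕ, Nonempty (CuspData Γ k)) ∧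
    ∀ (k : ℕ) (C : CuspData Γ k),
    -- there is a smallest level from which on the cusped regions are disjoint
    (∃ τ₀ : ℝ, IsLeast {τ : ℝ | C.Separates τ} τ₀) ∧
    ∀ τ₀ : ℝ, C.Separates τ₀ →
    -- there are cut-off functions
    (∃ φ f : ℝ → ℝ, IsCutoff (3 * C.L₀ τ₀) (4 * C.L₀ τ₀) φ f) ∧
    ∀ φ f : ℝ → ℝ, IsCutoff (3 * C.L₀ τ₀) (4 * C.L₀ τ₀) φ f →
    -- the modified metric exists
    (∃ b : Tensor2, IsModifiedMetric C τ₀ f b) ∧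
    ∀ b : Tensor2, IsModifiedMetric C τ₀ f b →
    -- `Γ` is a subgroup of the isometry group of `Ω(τ₄)`
    (∃ ρ : Γ →* isomGroup b (C.Ω (C.level τ₀ 4)), Function.Injective ρ ∧
      ∀ (γ : Γ) (p : C.Ω (C.level τ₀ 4)),
        (((ρ γ : Equiv.Perm (C.Ω (C.level τ₀ 4))) p : H3) = (γ : PSL(2, ℂ)) • (p : H3))) ∧
    -- and preserves the modified metric tensor
    (∀ γ ∈ Γ, ∀ p ∈ C.Ω (C.level τ₀ 4), ∀ v w : E3,
      b (γ • p) (dsmul γ p v) (dsmul γ p w) = b p v w) ∧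
    -- `M(τ₄)` is a compact Hausdorff space
    CompactSpace (C.M (C.level τ₀ 4)) ∧ T2Space (C.M (C.level τ₀ 4)) ∧
    -- `Ω(τ₄)` and `M(τ₄)` are smooth manifolds with boundary
    ∃ (_ : ChartedSpace (EuclideanHalfSpace 3) (C.Ω (C.level τ₀ 4)))
      (_ : IsManifold (𝓡∂ 3) ∞ (C.Ω (C.level τ₀ 4)))
      (_ : ChartedSpace (EuclideanHalfSpace 3) (C.M (C.level τ₀ 4)))
      (_ : IsManifold (𝓡∂ 3) ∞ (C.M (C.level τ₀ 4)))
      (g : Metric3 (C.M (C.level τ₀ 4))),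
      -- the inclusion of `Ω(τ₄)` is a smooth immersion, the projection to `M(τ₄)` is a surjective
      -- local diffeomorphism, and `g` is induced by the modified metric
      ContMDiff (𝓡∂ 3) (𝓡 3) ∞ (Subtype.val : C.Ω (C.level τ₀ 4) → H3) ∧
      (∀ p : C.Ω (C.level τ₀ 4), Function.Bijective
        (mfderiv (𝓡∂ 3) (𝓡 3) (Subtype.val : C.Ω (C.level τ₀ 4) → H3) p)) ∧
      IsLocalDiffeomorph (𝓡∂ 3) (𝓡∂ 3) ∞ (C.projΩ (C.level τ₀ 4)) ∧
      Function.Surjective (C.projΩ (C.level τ₀ 4)) ∧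
      (∀ (p : C.Ω (C.level τ₀ 4)) (v w : TangentSpace (𝓡∂ 3) p),
        g.inner (C.projΩ (C.level τ₀ 4) p)
            (mfderiv (𝓡∂ 3) (𝓡∂ 3) (C.projΩ (C.level τ₀ 4)) p v)
            (mfderiv (𝓡∂ 3) (𝓡∂ 3) (C.projΩ (C.level τ₀ 4)) p w) =
          b p (mfderiv (𝓡∂ 3) (𝓡 3) (Subtype.val : C.Ω (C.level τ₀ 4) → H3) p v)
            (mfderiv (𝓡∂ 3) (𝓡 3) (Subtype.val : C.Ω (C.level τ₀ 4) → H3) p w)) ∧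
      -- the boundary of `M(τ₄)` consists of the tori `T_i × {τ₄}`
      Subtype.val '' (𝓡∂ 3).boundary (C.M (C.level τ₀ 4)) =
        {x | ∃ (i : Fin k) (p : H3), height (C.frame i • p) = 4 * C.L₀ τ₀ ∧ proj Γ p = x} ∧
      -- negative curvature
      (∀ x : C.M (C.level τ₀ 4), (𝓡∂ 3).IsInteriorPoint x → ∀ u v : E3,
        LinearIndependent ℝ ![u, v] → sectionalCurvature g x u v < 0) ∧
      -- totally geodesic boundary
      HasTotallyGeodesicBoundary g ∧
      -- the metric on `M(τ₃)` is the hyperbolic one, of constant curvature `-1`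
      (∀ p : C.Ω (C.level τ₀ 4), (p : H3) ∈ C.Ω (C.level τ₀ 3) →
        ∀ v w : TangentSpace (𝓡∂ 3) p,
        g.inner (C.projΩ (C.level τ₀ 4) p)
            (mfderiv (𝓡∂ 3) (𝓡∂ 3) (C.projΩ (C.level τ₀ 4)) p v)
            (mfderiv (𝓡∂ 3) (𝓡∂ 3) (C.projΩ (C.level τ₀ 4)) p w) =
          hypMetric p
            (mfderiv (𝓡∂ 3) (𝓡 3) (Subtype.val : C.Ω (C.level τ₀ 4) → H3) p v)
            (mfderiv (𝓡∂ 3) (𝓡 3) (Subtype.val : C.Ω (C.level τ₀ 4) → H3) p w)) ∧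
      (∀ x : C.M (C.level τ₀ 4), (x : Quot3 Γ) ∈ C.M (C.level τ₀ 3) → ∀ u v : E3,
        LinearIndependent ℝ ![u, v] → sectionalCurvature g x u v = -1) := by
  refine ⟨exists_cuspData hΓ, fun k C => ⟨C.exists_isLeast_separates, fun τ₀ hs => ?_⟩⟩
  have hL := hs.L₀_pos
  refine ⟨exists_isCutoff (by linarith) (by linarith), fun φ f hφ =>
    ⟨hs.exists_isModifiedMetric hφ, fun b hb => ?_⟩⟩
  have hinv : ∀ γ ∈ Γ, ∀ p ∈ C.Ω (C.level τ₀ 4), γ • p ∈ C.Ω (C.level τ₀ 4) := fun γ hγ p hp =>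
    hs.smul_mem_Ω (by norm_num) hγ hp
  have htensor : ∀ γ ∈ Γ, ∀ p ∈ C.Ω (C.level τ₀ 4), ∀ v w : E3,
      b (γ • p) (dsmul γ p v) (dsmul γ p w) = b p v w := fun γ hγ p hp v w =>
    hs.modifiedMetric_dsmul hφ hb hγ hp v w
  have hT2 := t2Space_Quot3 hΓ
  have hc : ∀ p, 0 < C.cuspHeight τ₀ p := hs.cuspHeight_pos
  have hcΓ : ∀ γ ∈ Γ, ∀ p, C.cuspHeight τ₀ (γ • p) = C.cuspHeight τ₀ p := fun γ hγ p =>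
    hs.cuspHeight_smul hγ p
  have hπ := C.isQuotientBy_projΩ (C.level τ₀ 4)
  have hid := isQuotientBy_id (C.Ω (C.level τ₀ 4))
  have hbot : ∀ γ ∈ (⊥ : Subgroup PSL(2, ℂ)), ∀ q ∈ C.Ω (C.level τ₀ 4),
      γ • q ∈ C.Ω (C.level τ₀ 4) := fun γ hγ q hq => hinv γ (bot_le (a := Γ) hγ) q hq
  have hΩ3 : ∀ p : H3, p ∈ C.Ω (C.level τ₀ 3) → C.cuspHeight τ₀ p ≤ 3 * C.L₀ τ₀ := fun p hp => by
    have := (hs.mem_Ω_level (by norm_num)).1 hp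
    exact_mod_cast this
  -- The same construction runs twice, with the trivial group for Ω(τ₄) and with Γ for M(τ₄), so
  -- both carry horospherical charts.
  obtain ⟨csΩ, hΩ⟩ := exists_chartedSpace hid fun p _ => hs.exists_patch hΓ bot_le p
  obtain ⟨csM, hM⟩ := exists_chartedSpace hπ fun p _ => hs.exists_patch hΓ le_rfl p
  have mΩ := hΩ.isManifold hid hbot
  have mM := hM.isManifold hπ hinv
  have hinner := horoMetric_inner_mfderiv hM hπ hinv hc hcΓ hφ.f_eq_id hφ.smooth_f hφ.f_pos hΩ hid
  refine ⟨⟨isomHom hinv htensor, injective_isomHom hΓ hs.nonempty_Ω hinv htensor,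
    fun _ _ => rfl⟩, htensor, C.compactSpace_M hΓ _, inferInstance, csΩ, mΩ, csM, mM,
    horoMetric hM hπ hinv hc hcΓ hφ.f_eq_id hφ.smooth_f hφ.f_pos, hΩ.contMDiff_val,
    hΩ.bijective_mfderiv_val, hM.isLocalDiffeomorph hπ hinv hΩ hid, hπ.surjective,
    fun p v w => ?_, ?_, fun x hx u v huv =>
      horoMetric_sectionalCurvature_neg hφ hM hπ hinv hc hcΓ hx huv,
    horoMetric_hasTotallyGeodesicBoundary (by linarith) hφ hM hπ hinv hc hcΓ,
    fun p hp v w => ?_, fun x hx u v huv => ?_⟩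
  · exact (hinner p v w).trans ((hs.isModifiedMetric_iff hφ).1 hb p p.2 _ _).symm
  -- Boundary points have chart height 4 L₀. The ambiguity between chart height and cusp height
  -- occurs only below 3 L₀, where neither condition can hold.
  · have hbd : ∀ p : C.Ω (C.level τ₀ 4), C.projΩ (C.level τ₀ 4) p ∈
        (𝓡∂ 3).boundary (C.M (C.level τ₀ 4)) ↔ C.cuspHeight τ₀ p = 4 * C.L₀ τ₀ := fun p => by
      obtain ⟨-, h⟩ := hM.chartHeight_spec hπ hcΓ p
      refine (isBoundaryPoint_iff_chartHeight (4 * C.L₀ τ₀) _).trans ?_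
      rcases h with h | ⟨h1, h2⟩
      · rw [h]
      · exact ⟨fun h => by linarith, fun h => by linarith⟩
    ext x
    constructor
    · rintro ⟨y, hy, rfl⟩
      obtain ⟨p, rfl⟩ := hπ.surjective y
      obtain ⟨i, γ, hγ, h⟩ := (hs.exists_height_iff p).1 ((hbd p).1 hy)
      exact ⟨i, γ • (p : H3), h, proj_smul hγ _⟩
    · rintro ⟨i, p, h, rfl⟩
      have h1 : C.cuspHeight τ₀ p = 4 * C.L₀ τ₀ :=
        (hs.exists_height_iff p).2 ⟨i, 1, Γ.one_mem, by rwa [one_smul]⟩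
      have hp : p ∈ C.Ω (C.level τ₀ 4) := by
        rw [hs.mem_Ω_level (by norm_num), h1]; norm_num
      exact ⟨C.projΩ (C.level τ₀ 4) ⟨p, hp⟩, (hbd ⟨p, hp⟩).2 h1, rfl⟩
  · refine (hinner p v w).trans ?_
    have hp3 := hΩ3 p hp
    rw [hφ.f_eq_id _ (hc p) hp3, div_self (hc p).ne', one_pow]
    rfl
  · obtain ⟨p, rfl⟩ := hπ.surjective x
    have hp3 : (p : H3) ∈ C.Ω (C.level τ₀ 3) := by
      rw [← C.proj_preimage_M]; exact hx
    exact horoMetric_sectionalCurvature_eq hφ hM hπ hinv hc hcΓ (hΩ3 p hp3) huv
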